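/- Input strings are over $\{0,1\}$, $\mathbb{Z}^{+}=\{0,1,2,\dots\}$ and $\mathbb{N}=\{1,2,\dots\}$. A function $f:\mathbb{Z}^{+}\to\mathbb{N}$ is polynomially bounded if $f(n)\le p(n)$ for all $n$ and some polynomial $p$. A promise problem is a pair $A=(A_{\mathrm{yes}},A_{\mathrm{no}})$ of disjoint sets of strings. Let $k:\mathbb{Z}^{+}\to\mathbb{N}$ be polynomially bounded. A quantum verifier $V$ for $k$-proof Merlin--Arthur systems consists of polynomially bounded functions $q_{\mathcal V},q_{\mathcal M}:\mathbb{Z}^{+}\to\mathbb{N}$ and a map, computable by a deterministic Turing machine in time polynomial in $|x|$, that takes every string $x$ to the description (a binary string listing the designated output qubit and the gates in order) of a unitary quantum circuit $V(x)$ over the universal gate set $\{\mathrm{NOT}, H, T, \mathrm{CNOT}, \mathrm{Toffoli}\}$. Here $V(x)$ acts on a work space of $q_{\mathcal V}(|x|)$ qubits and on $k(|x|)$ witness spaces of $q_{\mathcal M}(|x|)$ qubits each, and the output qubit is a qubit of the work space. Given pure states (unit vectors) $|\phi_1\rangle,\dots,|\phi_{k(|x|)}\rangle$ of $q_{\mathcal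 M}(|x|)$ qubits each, called quantum proofs, the probability that $V$ accepts $x$ is the probability that measuring the output qubit in the computational basis yields $1$ after $V(x)$ has been applied to $|0\cdots0\rangle\otimes|\phi_1\rangle\otimes\cdots\otimes|\phi_{k(|x|)}\rangle$. For $c,s:\mathbb{Z}^{+}\to[0,1]$, the class $\mathrm{QMA}(k,c,s)$ is the set of promise problems $A$ for which there is a quantum verifier $V$ for $k$-proof Merlin--Arthur systems such that, for every $x$: * if $x\in A_{\mathrm{yes}}$, then some quantum proofs $|\phi_1\rangle,\dots,|\phi_{k(|x|)}\rangle$ make $V$ accept $x$ with probability at least $c(|x|)$; * if $x\in A_{\mathrm{no}}$, then for all quantum proofs $|\phi_1\rangle,\dots,|\phi_{k(|x|)}\rangle$, $V$ accepts $x$ with probability at most $s(|x|)$. **Lemma.** For any polynomially bounded function $k:\mathbb{Z}^{+}\to\mathbb{N}$, any $r\in\{0,1,2\}$, and any functions $\varepsilon,\delta:\mathbb{Z}^{+}\to[0,1]$ satisfying $\delta(n)>10\,\varepsilon(n)$ for all $n$, $$\mathrm{QMA}(3k+r,\;1-\varepsilon,\;1-\delta)\;\subseteq\;\mathrm{QMA}\Bigl(2k+r,\;1-\frac{\varepsilon}{2},\;1-\frac{\delta}{20}\Bigr).$$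 -/

import Mathlib

noncomputable section

namespace QuantumMA

/-! ### Qubits, states and gates -/

/-- The Hilbert space of a finite set `ι` of qubits, with the computational basis `ι → Bool`
(`false` is the basis state 0 and `true` is the basis state 1). -/
abbrev QState (ι : Type) [Fintype ι] : Type := EuclideanSpace ℂ (ι → Bool)

/-- The elementary gates, applied to qubits from the set `ι`: the gates NOT, Hadamard, `T` (the
`π/8` gate), controlled-NOT and Toffoli. The operands of one gate are distinct qubits. -/
inductive Gate (ι : Type) : Type
  | not (t : ι) : Gate ι
  | hadamard (t : ι) : Gate ι
  | phaseT (t : ι) : Gate ι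
  | cnot (c t : ι) (h : c ≠ t) : Gate ι
  | toffoli (c₁ c₂ t : ι) (h₁₂ : c₁ ≠ c₂) (h₁ : c₁ ≠ t) (h₂ : c₂ ≠ t) : Gate ι

/-- The basis string `b` with the bit at `t` flipped. -/
def flipBit {ι : Type} [DecidableEq ι] (b : ι → Bool) (t : ι) : ι → Bool :=
  Function.update b t (!b t)

/-- The action of a gate on a state; the value at `b` is the amplitude of the basis state `b`. -/
def Gate.apply {ι : Type} [Fintype ι] [DecidableEq ι] (g : Gate ι) (ψ : QState ι) : QState ι :=
  WithLp.toLp 2 fun b =>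
    match g with
    | .not t => ψ (flipBit b t)
    | .hadamard t =>
        ((Real.sqrt 2 : ℝ) : ℂ)⁻¹ *
          (ψ (Function.update b t false) +
            (if b t then -1 else 1) * ψ (Function.update b t true))
    | .phaseT t => (if b t then Complex.exp (Complex.I * Real.pi / 4) else 1) * ψ b
    | .cnot c t _ => if b c then ψ (flipBit b t) else ψ b
    | .toffoli c₁ c₂ t _ _ _ => if b c₁ && b c₂ then ψ (flipBit b t) else ψ b

/-! ### Verification circuits -/

/-- The qubits of a verifier: `qV` qubits of work space, and `k` witness spaces of `qM` qubits
each. -/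
abbrev Qubit (qV k qM : ℕ) : Type := Fin qV ⊕ (Fin k × Fin qM)

/-- A quantum circuit on the qubits of a verifier: the gates, in the order in which they are
applied, and the output qubit, which is one of the qubits of the work space. -/
structure Circuit (qV k qM : ℕ) : Type where
  output : Fin qV
  gates : List (Gate (Qubit qV k qM))

/-- The state `|0…0⟩ ⊗ φ 0 ⊗ ⋯ ⊗ φ (k - 1)` of the work space and the `k` witness spaces. -/
def initialState {qV k qM : ℕ} (φ : Fin k → QState (Fin qM)) : QState (Qubit qV k qM) :=
  WithLp.toLp 2 fun b =>
    (if ∀ a, b (Sum.inl a) = false then 1 else 0) * ∏ i, φ i (fun j => b (Sum.inr (i, j)))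

/-- The state after the whole circuit has been applied. -/
def Circuit.run {qV k qM : ℕ} (C : Circuit qV k qM) (ψ : QState (Qubit qV k qM)) :
    QState (Qubit qV k qM) :=
  C.gates.foldl (fun χ g => g.apply χ) ψ

/-- The probability that measuring the output qubit in the computational basis yields 1, after
the circuit has been applied to the work space in state `|0…0⟩` and the proofs `φ i`. -/
def Circuit.acceptProb {qV k qM : ℕ} (C : Circuit qV k qM) (φ : Fin k → QState (Fin qM)) : ℝ :=
  ∑ b : Qubit qV k qM → Bool,
    if b (Sum.inl C.output) then ‖C.run (initialState φ) b‖ ^ 2 else 0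

/-! ### Descriptions of circuits as binary strings -/

/-- The self-delimiting unary code `1ⁿ0` of `n`. -/
def encodeNat (n : ℕ) : List Bool := List.replicate n true ++ [false]

/-- The name of a qubit: a bit for the kind of the qubit, then its index or indices. -/
def encodeQubit {qV k qM : ℕ} : Qubit qV k qM → List Bool
  | .inl a => false :: encodeNat a
  | .inr (i, j) => true :: (encodeNat i ++ encodeNat j)

/-- The description of a gate: a code for the kind of the gate, then its operands. -/
def encodeGate {qV k qM : ℕ} : Gate (Qubit qV k qM) → List Bool
  | .not t => encodeNat 0 ++ encodeQubit t
  | .hadamard t => encodeNat 1 ++ encodeQubit t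
  | .phaseT t => encodeNat 2 ++ encodeQubit t
  | .cnot c t _ => encodeNat 3 ++ encodeQubit c ++ encodeQubit t
  | .toffoli c₁ c₂ t _ _ _ => encodeNat 4 ++ encodeQubit c₁ ++ encodeQubit c₂ ++ encodeQubit t

/-- The description of a circuit: the index of the output qubit, then the gates in order. -/
def Circuit.encode {qV k qM : ℕ} (C : Circuit qV k qM) : List Bool :=
  encodeNat C.output ++ C.gates.flatMap encodeGate

/-! ### Verifiers and the complexity class -/

/-- `f` is bounded above by a polynomial. -/
def PolyBounded (f : ℕ → ℕ) : Prop := ∃ p : Polynomial ℕ, ∀ n, f n ≤ p.eval n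

/-- `f` is computable by a deterministic Turing machine in time polynomial in the length of the
input string. -/
def PolyTimeComputable (f : List Bool → List Bool) : Prop :=
  Nonempty (Turing.TM2ComputableInPolyTime (α := List Bool) (β := List Bool) id id f)

/-- A quantum verifier for `k`-proof quantum Merlin–Arthur proof systems, where `k` is a function
of the input length: a polynomial-time uniformly generated family of quantum circuits, with work
space of `qV |x|` qubits and, on input `x`, `k |x|` witness spaces of `qM |x|` qubits each. -/
structure Verifier (k : ℕ → ℕ) : Type where
  qV : ℕ → ℕ
  qM : ℕ → ℕ
  qV_pos : ∀ n, 0 < qV n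
  qM_pos : ∀ n, 0 < qM n
  qV_polyBounded : PolyBounded qV
  qM_polyBounded : PolyBounded qM
  circuit : ∀ x : List Bool, Circuit (qV x.length) (k x.length) (qM x.length)
  polyTime : PolyTimeComputable fun x => (circuit x).encode

/-- A tuple of quantum proofs for `V` on inputs of length `n`: pure states (unit vectors) whose
sizes are those of the witness spaces. -/
def Verifier.IsProofs {k : ℕ → ℕ} (V : Verifier k) (n : ℕ)
    (φ : Fin (k n) → QState (Fin (V.qM n))) : Prop :=
  ∀ i, ‖φ i‖ = 1

/-- A promise problem over the alphabet `{0, 1}`. -/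
structure PromiseProblem : Type where
  yes : Set (List Bool)
  no : Set (List Bool)
  disjoint : Disjoint yes no

/-- The class `QMA(k, c, s)` of promise problems. -/
def QMA (k : ℕ → ℕ) (c s : ℕ → ℝ) : Set PromiseProblem :=
  {A | ∃ V : Verifier k,
    (∀ x ∈ A.yes, ∃ φ, V.IsProofs x.length φ ∧ c x.length ≤ (V.circuit x).acceptProb φ) ∧
    (∀ x ∈ A.no, ∀ φ, V.IsProofs x.length φ → (V.circuit x).acceptProb φ ≤ s x.length)}

end QuantumMA

end

/-! Instead of three proofs φ₁, φ₂, φ₃ an honest prover can send the two states φ₁ ⊗ φ₂ and φ₁ ⊗ φ₃,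
and the verifier can compare the two copies of φ₁ by a swap test. This is done in each group of
three; the `r` remaining proofs are kept. One swap test with a single control qubit exchanges the
first registers in all groups at once. The old circuit then runs on both registers of the first
merged proof and on the second register of the second one. The new verifier accepts if the swap test
passes and either the old circuit accepts or a fair coin shows heads. Let Ψ be the product of the
merged proofs, Ψ₁ and Ψ₂ its symmetric and antisymmetric parts under the exchange, and R the
unnormalised probability that the old circuit rejects Ψ₁. The acceptance probability is ‖Ψ₁‖² − R/2
= 1 − ‖Ψ₂‖² − R/2 (`Circuit.merge_acceptProb`).

Completeness: honest proofs give Ψ₂ = 0 and R ≤ ε, so the loss is at most ε/2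
(`Circuit.exists_le_merge_acceptProb`).

Soundness: the inner product of Ψ with its exchanged version is the product over the groups of
tr(ρσ), where ρ and σ are the reduced states of the exchanged registers of the two proofs
(`inner_permState`). Since tr(ρσ) is at most the largest eigenvalue of either, each proof has
squared overlap at least tr(ρσ) with a state that is a product across its two registers
(`exists_product_overlap`). Replacing all merged proofs by such states moves Ψ by at most 2‖Ψ₂‖,
hence gives a state within 3‖Ψ₂‖ of Ψ₁ (`exists_joinState_close`). On the new state the old circuit
sees unentangled proofs and rejects with probability at least δ. Square roots of rejection
probabilities are 1-Lipschitz in the state, so √δ ≤ √R + 3‖Ψ₂‖, and Cauchy–Schwarz yields δ ≤ 11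
(R/2 + ‖Ψ₂‖²).

Uniformity: `k`, `qV` and `qM` need not be computable; only the description of the circuit is. The
new description must therefore be found from the old one alone. So qubits are renumbered
independently of these sizes (ancillas come first, registers are interleaved as even and odd
qubits), and the swap test exchanges only qubits below the largest proof number and position that
occur as operands (`Circuit.swapPairs`). Qubits that no gate touches are harmless: they could be
measured beforehand, so that rejection probabilities are sums over the values of these bits
(`sum_rejW_fixOff`). Completeness uses one good value, soundness treats all of them.

The translation of descriptions is a program over stacks of bits (`mergeProg`), compiled to a stack
machine (`Exec.steps`) and appended to the given machine (`PolyTimeComputable.comp_prog`). Its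
running time is cubic in the length of the description. -/

noncomputable section

namespace QuantumMA

open Turing

/-! ### Structured programs on stacks of bits -/

/-- Structured programs acting on finitely many stacks of bits. Each of the last three
constructors pops the stack `i`. -/
inductive Prog (S : Type) : Type
  | skip : Prog S
  | push (i : S) (b : Bool) : Prog S
  | seq (p q : Prog S) : Prog S
  | ite (i : S) (p q : Prog S) : Prog S
  | loop (i : S) (p : Prog S) : Prog S
  | scan (i : S) (p q : Prog S) : Prog S

/-- `Exec P s s' t`: started on the stacks `s`, the program `P` ends with the stacks `s'` after
`t` elementary steps. The program `ite i p q` runs `p` if the symbol popped is `true` and `q`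
otherwise; `loop i p` runs `p` as long as the symbol popped is `true`; `scan i p q` empties the
stack, running `p` or `q` according to the symbol popped. -/
inductive Exec {S : Type} [DecidableEq S] :
    Prog S → (S → List Bool) → (S → List Bool) → ℕ → Prop
  | skip (s) : Exec .skip s s 0
  | push (i b s) : Exec (.push i b) s (Function.update s i (b :: s i)) 1
  | seq {p q s₁ s₂ s₃ t₁ t₂} : Exec p s₁ s₂ t₁ → Exec q s₂ s₃ t₂ →
      Exec (.seq p q) s₁ s₃ (t₁ + t₂)
  | iteTrue {i p q s s' t} : (s i).head? = some true →
      Exec p (Function.update s i (s i).tail) s' t → Exec (.ite i p q) s s' (1 + t)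
  | iteFalse {i p q s s' t} : (s i).head? ≠ some true →
      Exec q (Function.update s i (s i).tail) s' t → Exec (.ite i p q) s s' (1 + t)
  | loopStop {i p s} : (s i).head? ≠ some true →
      Exec (.loop i p) s (Function.update s i (s i).tail) 1
  | loopStep {i p s s₂ s₃ t₁ t₂} : (s i).head? = some true →
      Exec p (Function.update s i (s i).tail) s₂ t₁ → Exec (.loop i p) s₂ s₃ t₂ →
      Exec (.loop i p) s s₃ (1 + t₁ + t₂)
  | scanStop {i p q s} : s i = [] → Exec (.scan i p q) s s 1
  | scanTrue {i p q s s₂ s₃ t₁ t₂} : (s i).head? = some true →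
      Exec p (Function.update s i (s i).tail) s₂ t₁ → Exec (.scan i p q) s₂ s₃ t₂ →
      Exec (.scan i p q) s s₃ (1 + t₁ + t₂)
  | scanFalse {i p q s s₂ s₃ t₁ t₂} : (s i).head? = some false →
      Exec q (Function.update s i (s i).tail) s₂ t₁ → Exec (.scan i p q) s₂ s₃ t₂ →
      Exec (.scan i p q) s s₃ (1 + t₁ + t₂)

/-- The control points of a program. -/
def Prog.Label {S : Type} : Prog S → Type
  | .skip => Empty
  | .push _ _ => Unit
  | .seq p q => p.Label ⊕ q.Label
  | .ite _ p q => Option (p.Label ⊕ q.Label)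
  | .loop _ p => Option p.Label
  | .scan _ p q => Option (p.Label ⊕ q.Label)

/-- Programs have finitely many control points. -/
@[reducible]
def Prog.labelFintype {S : Type} : ∀ P : Prog S, Fintype P.Label
  | .skip => inferInstanceAs (Fintype Empty)
  | .push _ _ => inferInstanceAs (Fintype Unit)
  | .seq p q => by
      letI := p.labelFintype
      letI := q.labelFintype
      exact inferInstanceAs (Fintype (p.Label ⊕ q.Label))
  | .ite _ p q => by
      letI := p.labelFintype
      letI := q.labelFintype
      exact inferInstanceAs (Fintype (Option (p.Label ⊕ q.Label)))
  | .loop _ p => by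
      letI := p.labelFintype
      exact inferInstanceAs (Fintype (Option p.Label))
  | .scan _ p q => by
      letI := p.labelFintype
      letI := q.labelFintype
      exact inferInstanceAs (Fintype (Option (p.Label ⊕ q.Label)))

/-- The control point at which a program starts, when its control points are embedded by `emb`
and it is followed by the control point `exit`. -/
def Prog.entry {S L : Type} : ∀ (P : Prog S), L → (P.Label → L) → L
  | .skip, exit, _ => exit
  | .push _ _, _, emb => emb ()
  | .seq p q, exit, emb =>
      p.entry (q.entry exit fun l => emb (Sum.inr l)) fun l => emb (Sum.inl l)
  | .ite _ _ _, _, emb => emb none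
  | .loop _ _, _, emb => emb none
  | .scan _ _ _, _, emb => emb none

/-- The alphabets of the stacks of a machine extended by stacks of bits. -/
abbrev ExtAlphabet {K : Type} (Γ : K → Type) (S : Type) : K ⊕ S → Type
  | .inl k => Γ k
  | .inr _ => Bool

/-- The statement that pops the stack `i` and jumps according to the symbol popped. -/
def popJump {K S L σ : Type} {Γ : K → Type} (i : S) (lNone lFalse lTrue : L) :
    TM2.Stmt (ExtAlphabet Γ S) L (σ × Option Bool) :=
  .pop (Sum.inr i) (fun v x => (v.1, x)) <|
    .branch (fun v => v.2 = some true) (.load (fun v => (v.1, none)) (.goto fun _ => lTrue)) <|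
    .branch (fun v => v.2 = some false) (.load (fun v => (v.1, none)) (.goto fun _ => lFalse))
      (.load (fun v => (v.1, none)) (.goto fun _ => lNone))

/-- The translation of a program to statements of a stack machine. -/
def Prog.code {K S L σ : Type} {Γ : K → Type} :
    ∀ (P : Prog S), L → (P.Label → L) → P.Label →
      TM2.Stmt (ExtAlphabet Γ S) L (σ × Option Bool)
  | .skip, _, _ => fun l => l.elim
  | .push i b, exit, _ => fun _ => .push (Sum.inr i) (fun _ => b) (.goto fun _ => exit)
  | .seq p q, exit, emb => fun l => Sum.elim
      (p.code (q.entry exit fun l => emb (Sum.inr l)) fun l => emb (Sum.inl l))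
      (q.code exit fun l => emb (Sum.inr l)) l
  | .ite i p q, exit, emb => fun l => Option.elim l
      (popJump i (q.entry exit fun l => emb (some (Sum.inr l)))
        (q.entry exit fun l => emb (some (Sum.inr l)))
        (p.entry exit fun l => emb (some (Sum.inl l))))
      (Sum.elim (p.code exit fun l => emb (some (Sum.inl l)))
        (q.code exit fun l => emb (some (Sum.inr l))))
  | .loop i p, exit, emb => fun l => Option.elim l
      (popJump i exit exit (p.entry (emb none) fun l => emb (some l)))
      (p.code (emb none) fun l => emb (some l))
  | .scan i p q, exit, emb => fun l => Option.elim l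
      (popJump i exit (q.entry (emb none) fun l => emb (some (Sum.inr l)))
        (p.entry (emb none) fun l => emb (some (Sum.inl l))))
      (Sum.elim (p.code (emb none) fun l => emb (some (Sum.inl l)))
        (q.code (emb none) fun l => emb (some (Sum.inr l))))

/-! ### Runs of stack machines -/

section Steps

variable {K L σ : Type} {Γ : K → Type} [DecidableEq K]

/-- `Steps M n c c'`: the machine `M` goes from `c` to `c'` in `n` steps. -/
inductive Steps (M : L → TM2.Stmt Γ L σ) : ℕ → TM2.Cfg Γ L σ → TM2.Cfg Γ L σ → Prop
  | refl (c) : Steps M 0 c c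
  | head {n c₁ c₂ c₃} : TM2.step M c₁ = some c₂ → Steps M n c₂ c₃ → Steps M (n + 1) c₁ c₃

theorem Steps.trans {M : L → TM2.Stmt Γ L σ} {m n : ℕ} {c₁ c₂ c₃ : TM2.Cfg Γ L σ}
    (h₁ : Steps M m c₁ c₂) (h₂ : Steps M n c₂ c₃) : Steps M (m + n) c₁ c₃ := by
  induction h₁ with
  | refl => simpa using h₂
  | @head k _ _ _ h _ ih =>
    rw [show k + 1 + n = (k + n) + 1 by omega]
    exact .head h (ih h₂)

theorem Steps.iterate {M : L → TM2.Stmt Γ L σ} {n : ℕ} {c c' : TM2.Cfg Γ L σ}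
    (h : Steps M n c c') : (flip bind (TM2.step M))^[n] (some c) = some c' := by
  induction h with
  | refl => rfl
  | head h _ ih =>
    rw [Function.iterate_succ_apply]
    simpa [flip, h] using ih

theorem iterate_bind_none (M : L → TM2.Stmt Γ L σ) (n : ℕ) :
    (flip bind (TM2.step M))^[n] none = none := by
  induction n with
  | zero => rfl
  | succ n ih => rw [Function.iterate_succ_apply]; simpa [flip] using ih

theorem Steps.of_iterate {M : L → TM2.Stmt Γ L σ} {n : ℕ} {c c' : TM2.Cfg Γ L σ}
    (h : (flip bind (TM2.step M))^[n] (some c) = some c') : Steps M n c c' := by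
  induction n generalizing c with
  | zero =>
    simp only [Function.iterate_zero, id, Option.some.injEq] at h
    exact h ▸ .refl c
  | succ n ih =>
    rw [Function.iterate_succ_apply] at h
    cases hc : TM2.step M c with
    | none =>
      change (flip bind (TM2.step M))^[n] (TM2.step M c) = _ at h
      rw [hc, iterate_bind_none] at h
      simp at h
    | some c₂ => exact .head hc (ih (by simpa [flip, hc] using h))

/-- The number of push instructions in a statement. -/
def pushCount : TM2.Stmt Γ L σ → ℕ
  | .push _ _ q => pushCount q + 1
  | .peek _ _ q => pushCount q
  | .pop _ _ q => pushCount q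
  | .load _ q => pushCount q
  | .branch _ p q => pushCount p + pushCount q
  | .goto _ => 0
  | .halt => 0

theorem length_stepAux_le (q : TM2.Stmt Γ L σ) (v : σ) (s : ∀ k, List (Γ k)) (k : K) :
    ((TM2.stepAux q v s).stk k).length ≤ (s k).length + pushCount q := by
  induction q generalizing v s with
  | push i f q ih =>
    refine (ih _ _).trans ?_
    by_cases h : k = i
    · subst h; simp [pushCount]; omega
    · simp [pushCount, Function.update_of_ne h]
  | peek i f q ih => exact ih _ _
  | pop i f q ih =>
    refine (ih _ _).trans ?_
    by_cases h : k = i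
    · subst h; simp [pushCount]
    · simp [pushCount, Function.update_of_ne h]
  | load f q ih => exact ih _ _
  | branch f p q ihp ihq =>
    simp only [TM2.stepAux, pushCount]
    cases f v
    · exact (ihq v s).trans (by omega)
    · exact (ihp v s).trans (by omega)
  | goto f => simp
  | halt => simp

/-- A step executes one statement, which pushes at most as often as push instructions occur in it. A
bound on the time is thus also a bound on the length of the output, as needed when a second program
reads that output. -/
theorem Steps.length_stk_le [Fintype L] {M : L → TM2.Stmt Γ L σ} {n : ℕ}
    {c c' : TM2.Cfg Γ L σ} (h : Steps M n c c') (k : K) :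
    (c'.stk k).length ≤ (c.stk k).length + n * ∑ l, pushCount (M l) := by
  induction h with
  | refl => simp
  | @head n c₁ c₂ c₃ h _ ih =>
    refine ih.trans ?_
    rcases c₁ with ⟨_ | l, v, s⟩
    · simp at h
    · simp only [TM2.step, Option.some.injEq] at h
      subst h
      have h₁ := length_stepAux_le (M l) v s k
      have h₂ := Finset.single_le_sum (f := fun l => pushCount (M l)) (fun _ _ => Nat.zero_le _)
        (Finset.mem_univ l)
      simp only at h₂ ⊢
      rw [Nat.add_mul]
      omega

end Steps

/-! ### Correctness of the translation -/

/-- The stacks of a machine extended by stacks of bits. -/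
def joinStk {K S : Type} {Γ : K → Type} (s₁ : ∀ k, List (Γ k)) (s : S → List Bool) :
    ∀ k : K ⊕ S, List (ExtAlphabet Γ S k)
  | .inl k => s₁ k
  | .inr i => s i

section Simulation

variable {K S L σ : Type} {Γ : K → Type} [DecidableEq K] [DecidableEq S]

theorem update_joinStk_inr (s₁ : ∀ k, List (Γ k)) (s : S → List Bool) (i : S)
    (l : List Bool) :
    Function.update (joinStk s₁ s) (Sum.inr i) l = joinStk s₁ (Function.update s i l) := by
  funext k
  rcases k with k | j
  · rw [Function.update_of_ne (by simp)]; rfl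
  · by_cases h : j = i
    · subst h; simp [joinStk]
    · rw [Function.update_of_ne (by simpa using h)]
      simp [joinStk, Function.update_of_ne h]

theorem update_joinStk_inl (s₁ : ∀ k, List (Γ k)) (s : S → List Bool) (i : K)
    (l : List (Γ i)) :
    Function.update (joinStk s₁ s) (Sum.inl i) l = joinStk (Function.update s₁ i l) s := by
  funext k
  rcases k with j | k
  · by_cases h : j = i
    · subst h; simp [joinStk]
    · rw [Function.update_of_ne (by simpa using h)]
      simp [joinStk, Function.update_of_ne h]
  · rw [Function.update_of_ne (by simp)]; rfl

theorem stepAux_popJump (i : S) (lNone lFalse lTrue : L) (v : σ) (s₁ : ∀ k, List (Γ k))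
    (s : S → List Bool) :
    TM2.stepAux (popJump i lNone lFalse lTrue) (v, none) (joinStk s₁ s) =
      ⟨some (match (s i).head? with
        | none => lNone
        | some false => lFalse
        | some true => lTrue), (v, none), joinStk s₁ (Function.update s i (s i).tail)⟩ := by
  rw [← update_joinStk_inr]
  rcases h : s i with _ | ⟨_ | _, l⟩ <;>
    simp [popJump, joinStk, h]

theorem step_popJump {M : L → TM2.Stmt (ExtAlphabet Γ S) L (σ × Option Bool)} {l : L} {i : S}
    {lNone lFalse lTrue : L} (h : M l = popJump i lNone lFalse lTrue) (v : σ)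
    (s₁ : ∀ k, List (Γ k)) (s : S → List Bool) :
    TM2.step M ⟨some l, (v, none), joinStk s₁ s⟩ =
      some ⟨some (match (s i).head? with
        | none => lNone
        | some false => lFalse
        | some true => lTrue), (v, none), joinStk s₁ (Function.update s i (s i).tail)⟩ := by
  rw [TM2.step, h, stepAux_popJump]

/-- Each elementary step is exactly one machine step. The body of a loop has the label of the loop
itself as its exit, so the exit has to vary in the induction. -/
theorem Exec.steps {P : Prog S} {s s' : S → List Bool} {t : ℕ} (h : Exec P s s' t)
    (M : L → TM2.Stmt (ExtAlphabet Γ S) L (σ × Option Bool)) (exit : L) (emb : P.Label → L)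
    (hM : ∀ l, M (emb l) = P.code exit emb l) (s₁ : ∀ k, List (Γ k)) (v : σ) :
    Steps M t ⟨some (P.entry exit emb), (v, none), joinStk s₁ s⟩
      ⟨some exit, (v, none), joinStk s₁ s'⟩ := by
  induction h generalizing exit with
  | skip s => exact .refl _
  | push i b s =>
    refine .head ?_ (.refl _)
    have h : M (emb ()) = .push (Sum.inr i) (fun _ => b) (.goto fun _ => exit) := hM ()
    rw [Prog.entry, TM2.step, h, ← update_joinStk_inr]
    rfl
  | seq _ _ ih₁ ih₂ =>
    exact (ih₁ _ _ fun l => hM (Sum.inl l)).trans (ih₂ _ _ fun l => hM (Sum.inr l))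
  | iteTrue h _ ih =>
    rw [Nat.add_comm]
    refine .head ((step_popJump (hM none) v s₁ _).trans ?_) (ih _ _ fun l => hM (some (Sum.inl l)))
    simp only [h]
  | iteFalse h _ ih =>
    rw [Nat.add_comm]
    refine .head ((step_popJump (hM none) v s₁ _).trans ?_) (ih _ _ fun l => hM (some (Sum.inr l)))
    split <;> simp_all
  | loopStop h =>
    refine .head ((step_popJump (hM none) v s₁ _).trans ?_) (.refl _)
    split <;> simp_all
  | @loopStep i p s s₂ s₃ t₁ t₂ h _ _ ih₁ ih₂ =>
    rw [Nat.add_assoc, Nat.add_comm]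
    refine .head ((step_popJump (hM none) v s₁ _).trans ?_)
      ((ih₁ (emb none) _ fun l => hM (some l)).trans (ih₂ exit emb hM))
    simp only [h]
  | @scanStop i p q s h =>
    refine .head ((step_popJump (hM none) v s₁ _).trans ?_) (.refl _)
    -- `popJump` pops before it tests; on an empty stack the pop has no effect.
    have hs : Function.update s i (s i).tail = s := by
      rw [h, List.tail_nil, ← h, Function.update_eq_self]
    rw [hs]
    simp only [h, List.head?_nil]
  | @scanTrue i p q s s₂ s₃ t₁ t₂ h _ _ ih₁ ih₂ =>
    rw [Nat.add_assoc, Nat.add_comm]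
    refine .head ((step_popJump (hM none) v s₁ _).trans ?_)
      ((ih₁ (emb none) _ fun l => hM (some (Sum.inl l))).trans (ih₂ exit emb hM))
    simp only [h]
  | @scanFalse i p q s s₂ s₃ t₁ t₂ h _ _ ih₁ ih₂ =>
    rw [Nat.add_assoc, Nat.add_comm]
    refine .head ((step_popJump (hM none) v s₁ _).trans ?_)
      ((ih₁ (emb none) _ fun l => hM (some (Sum.inr l))).trans (ih₂ exit emb hM))
    simp only [h]

end Simulation

/-! ### Composing a polynomial-time machine with a program -/

/-- A statement of a machine as a statement of an extension of the machine; instead of halting,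
the extension goes to the label `done`. -/
def liftStmt {K S L L' σ : Type} {Γ : K → Type} (emb : L → L') (done : L') :
    TM2.Stmt Γ L σ → TM2.Stmt (ExtAlphabet Γ S) L' (σ × Option Bool)
  | .push k f q => .push (Sum.inl k) (fun v => f v.1) (liftStmt emb done q)
  | .peek k f q => .peek (Sum.inl k) (fun v x => (f v.1 x, v.2)) (liftStmt emb done q)
  | .pop k f q => .pop (Sum.inl k) (fun v x => (f v.1 x, v.2)) (liftStmt emb done q)
  | .load f q => .load (fun v => (f v.1, v.2)) (liftStmt emb done q)
  | .branch f p q => .branch (fun v => f v.1) (liftStmt emb done p) (liftStmt emb done q)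
  | .goto f => .goto fun v => emb (f v.1)
  | .halt => .goto fun _ => done

/-- The configuration of an extension of a machine that corresponds to a configuration of the
machine. -/
def liftCfg {K S L L' σ : Type} {Γ : K → Type} (emb : L → L') (done : L')
    (s : S → List Bool) (c : TM2.Cfg Γ L σ) :
    TM2.Cfg (ExtAlphabet Γ S) L' (σ × Option Bool) :=
  ⟨some (c.l.elim done emb), (c.var, none), joinStk c.stk s⟩

section Lift

variable {K S L L' σ : Type} {Γ : K → Type} [DecidableEq K] [DecidableEq S]

theorem stepAux_liftStmt (emb : L → L') (done : L') (s : S → List Bool)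
    (q : TM2.Stmt Γ L σ) (v : σ) (s₁ : ∀ k, List (Γ k)) :
    TM2.stepAux (liftStmt emb done q) (v, none) (joinStk s₁ s) =
      liftCfg emb done s (TM2.stepAux q v s₁) := by
  induction q generalizing v s₁ with
  | push k f q ih => rw [liftStmt, TM2.stepAux, TM2.stepAux, ← ih, ← update_joinStk_inl]; rfl
  | peek k f q ih => exact ih _ _
  | pop k f q ih => rw [liftStmt, TM2.stepAux, TM2.stepAux, ← ih, ← update_joinStk_inl]; rfl
  | load f q ih => exact ih _ _
  | branch f p q ihp ihq =>
    change cond (f v) _ _ = liftCfg _ _ _ (cond (f v) _ _)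
    cases f v
    · exact ihq _ _
    · exact ihp _ _
  | goto f => rfl
  | halt => rfl

/-- Lifted statements never access the added stacks, so a run is reproduced step by step; a halted
configuration corresponds to one at the label `done`. -/
theorem Steps.lift {M : L → TM2.Stmt Γ L σ} {n : ℕ} {c c' : TM2.Cfg Γ L σ}
    (h : Steps M n c c') (emb : L → L') (done : L')
    (M' : L' → TM2.Stmt (ExtAlphabet Γ S) L' (σ × Option Bool))
    (hM : ∀ l, M' (emb l) = liftStmt emb done (M l)) (s : S → List Bool) :
    Steps M' n (liftCfg emb done s c) (liftCfg emb done s c') := by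
  induction h with
  | refl => exact .refl _
  | @head n c₁ c₂ c₃ h _ ih =>
    refine .head ?_ ih
    rcases c₁ with ⟨_ | l, v, s₁⟩
    · simp at h
    · simp only [TM2.step, Option.some.injEq] at h
      subst h
      simp only [liftCfg, Option.elim_some, TM2.step, hM, stepAux_liftStmt]

end Lift

/-- The labels of the machine that runs the machine `tm` and then the program `P`: the labels of
`tm`, those of `P`, one for the transfer of the output of `tm` (`false`), and the final one
(`true`). -/
abbrev CompLabel (tm : FinTM2) {S : Type} (P : Prog S) : Type := (tm.Λ ⊕ P.Label) ⊕ Bool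

/-- The instructions of the machine that runs `tm`, moves the output to the stack `inp` in
reverse order and runs the program `P`. -/
def compCode (tm : FinTM2) {S : Type} (P : Prog S) (inp : S) (α : tm.Γ tm.k₁ ≃ Bool) :
    CompLabel tm P → TM2.Stmt (ExtAlphabet tm.Γ S) (CompLabel tm P) (tm.σ × Option Bool)
  | .inl (.inl l) => liftStmt (fun l => .inl (.inl l)) (.inr false) (tm.m l)
  | .inl (.inr l) => P.code (.inr true) (fun l => .inl (.inr l)) l
  | .inr false =>
      .pop (.inl tm.k₁) (fun v x => (v.1, x.map α)) <|
        .branch (fun v => v.2.isSome)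
          (.push (.inr inp) (fun v => v.2.getD false)
            (.load (fun v => (v.1, none)) (.goto fun _ => .inr false)))
          (.goto fun _ => P.entry (.inr true) fun l => .inl (.inr l))
  | .inr true => .halt

/-- The machine that runs `tm`, moves the output to the stack `inp` in reverse order and runs the
program `P`. -/
def compMachine (tm : FinTM2) {S : Type} [DecidableEq S] [Fintype S] (P : Prog S)
    (inp out : S) (α : tm.Γ tm.k₁ ≃ Bool) : FinTM2 :=
  letI := tm.kFin
  letI := tm.ΛFin
  letI := tm.σFin
  letI := P.labelFintype
  { K := tm.K ⊕ S
    k₀ := .inl tm.k₀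
    k₁ := .inr out
    Γ := ExtAlphabet tm.Γ S
    Λ := CompLabel tm P
    main := .inl (.inl tm.main)
    σ := tm.σ × Option Bool
    initialState := (tm.initialState, none)
    Γk₀Fin := tm.Γk₀Fin
    m := compCode tm P inp α }

/-- Moving a stack symbol by symbol reverses it. The last of the `l.length + 1` steps finds the
stack empty and enters the program. -/
theorem steps_transfer (tm : FinTM2) {S : Type} [DecidableEq S] (P : Prog S)
    (inp : S) (α : tm.Γ tm.k₁ ≃ Bool) (l : List Bool) (v : tm.σ)
    (s₁ : ∀ k, List (tm.Γ k)) (s : S → List Bool) (hl : s₁ tm.k₁ = l.map α.symm) :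
    Steps (compCode tm P inp α) (l.length + 1) ⟨some (.inr false), (v, none), joinStk s₁ s⟩
      ⟨some (P.entry (.inr true) fun l => .inl (.inr l)), (v, none),
        joinStk (Function.update s₁ tm.k₁ []) (Function.update s inp (l.reverse ++ s inp))⟩ := by
  induction l generalizing s₁ s with
  | nil =>
    refine .head ?_ (.refl _)
    simp only [List.map_nil] at hl
    simp only [TM2.step, compCode, TM2.stepAux]
    rw [update_joinStk_inl]
    simp [joinStk, hl]
  | cons b l ih =>
    simp only [List.map_cons] at hl
    have := ih (Function.update s₁ tm.k₁ (l.map α.symm)) (Function.update s inp (b :: s inp))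
      (by simp)
    simp only [Function.update_idem, Function.update_self] at this
    refine .head ?_ (by simpa using this)
    simp only [TM2.step, compCode, TM2.stepAux]
    rw [update_joinStk_inl]
    simp only [joinStk, hl]
    simp only [List.head?_cons, Option.map_some, Equiv.apply_symm_apply, Option.isSome_some,
      cond_true, Option.getD_some, List.tail_cons]
    rw [← update_joinStk_inr]

/-- The stacks that are all empty but for the stack `i`, which holds `l`. -/
def singleStk {S : Type} [DecidableEq S] (i : S) (l : List Bool) : S → List Bool :=
  Function.update (fun _ => []) i l

theorem initList_eq_update (tm : FinTM2) (l : List (tm.Γ tm.k₀)) :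
    (initList tm l).stk = Function.update (fun _ => []) tm.k₀ l := by
  funext k
  by_cases h : k = tm.k₀
  · subst h; simp [initList]
  · simp [initList, h, Function.update_of_ne h]

theorem haltList_eq_update (tm : FinTM2) (l : List (tm.Γ tm.k₁)) :
    (haltList tm l).stk = Function.update (fun _ => []) tm.k₁ l := by
  funext k
  by_cases h : k = tm.k₁
  · subst h; simp [haltList]
  · simp [haltList, h, Function.update_of_ne h]

theorem eval_nat_mono (p : Polynomial ℕ) {m n : ℕ} (h : m ≤ n) : p.eval m ≤ p.eval n := by
  rw [Polynomial.eval_eq_sum, Polynomial.eval_eq_sum]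
  exact Finset.sum_le_sum fun i _ => Nat.mul_le_mul_left _ (Nat.pow_le_pow_left h i)

/-- Three runs are concatenated: the given machine, the transfer of its output, and the program. The
program must leave all stacks but `out` empty, because a final configuration holds nothing except
the output. -/
theorem PolyTimeComputable.comp_prog {S : Type} [DecidableEq S] [Fintype S] {P : Prog S}
    {inp out : S} {f g : List Bool → List Bool} (hf : PolyTimeComputable f)
    (p : Polynomial ℕ)
    (hP : ∀ x, ∃ t ≤ p.eval (f x).length,
      Exec P (singleStk inp (f x).reverse) (singleStk out (g x)) t) :
    PolyTimeComputable g := by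
  obtain ⟨⟨⟨tm, α₀, α₁⟩, time, hout⟩⟩ := hf
  letI := tm.ΛFin
  choose time' ht' hexec' using hP
  set C : ℕ := ∑ l, pushCount (tm.m l) with hC
  -- Bounds the length of `f x`. The summand `X` is there because the output stack of `tm` may be
  -- its input stack; each step then adds at most `C` symbols.
  set len : Polynomial ℕ := Polynomial.X + time * Polynomial.C C with hlen
  refine ⟨⟨⟨compMachine tm P inp out α₁, α₀, Equiv.refl Bool⟩,
    time + (len + 1) + p.comp len + 1, fun x => ?_⟩⟩
  obtain ⟨⟨n, hn⟩, hnt⟩ := hout x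
  simp only [id] at hn hnt
  have hn' : Steps tm.m n (initList tm (x.map α₀.symm)) (haltList tm ((f x).map α₁.symm)) :=
    Steps.of_iterate hn
  have hx : (f x).length ≤ len.eval x.length := by
    have h₁ : _ ≤ _ + n * C := hn'.length_stk_le tm.k₁
    rw [initList_eq_update, haltList_eq_update] at h₁
    have h₂ : (Function.update (fun k => ([] : List (tm.Γ k))) tm.k₀ (x.map α₀.symm)
        tm.k₁).length ≤ x.length := by
      by_cases h : tm.k₁ = tm.k₀
      · rw [show (Function.update (fun k => ([] : List (tm.Γ k))) tm.k₀ (x.map α₀.symm)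
          tm.k₁).length = (Function.update (fun k => ([] : List (tm.Γ k))) tm.k₀ (x.map α₀.symm)
          tm.k₀).length by rw [h]]
        simp
      · simp [Function.update_of_ne h]
    simp only [Function.update_self, List.length_map] at h₁
    have h₃ : n * C ≤ time.eval x.length * C := Nat.mul_le_mul_right _ hnt
    simp only [hlen, Polynomial.eval_add, Polynomial.eval_X, Polynomial.eval_mul,
      Polynomial.eval_C]
    omega
  have ht := ht' x
  have hexec := hexec' x
  set t := time' x
  have st₁ := hn'.lift (S := S) (fun l => (.inl (.inl l) : CompLabel tm P)) (.inr false)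
    (compCode tm P inp α₁) (fun l => rfl) (fun _ => [])
  have st₂ := steps_transfer tm P inp α₁ (f x) tm.initialState
    (haltList tm ((f x).map α₁.symm)).stk (fun _ => []) (by simp [haltList_eq_update])
  have hstk : Function.update (fun _ : S => ([] : List Bool)) inp ((f x).reverse ++ []) =
      singleStk inp (f x).reverse := by simp [singleStk]
  rw [hstk, haltList_eq_update, Function.update_idem] at st₂
  have st₃ := hexec.steps (compCode tm P inp α₁) (.inr true)
    (fun l => (.inl (.inr l) : CompLabel tm P)) (fun l => rfl)
    (Function.update (fun _ => []) tm.k₁ []) tm.initialState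
  have st₄ : Steps (compCode tm P inp α₁) 1
      ⟨some (.inr true), (tm.initialState, none),
        joinStk (Function.update (fun _ => []) tm.k₁ []) (singleStk out (g x))⟩
      ⟨none, (tm.initialState, none),
        joinStk (Function.update (fun _ => []) tm.k₁ []) (singleStk out (g x))⟩ :=
    .head rfl (.refl _)
  have st₁' : Steps (compCode tm P inp α₁) n
      (liftCfg (fun l => (.inl (.inl l) : CompLabel tm P)) (.inr false) (fun _ => [])
        (initList tm (x.map α₀.symm)))
      ⟨some (.inr false), (tm.initialState, none),
        joinStk (Function.update (fun _ => []) tm.k₁ ((f x).map α₁.symm)) fun _ => []⟩ := by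
    rw [← haltList_eq_update]
    exact st₁
  have st := ((st₁'.trans st₂).trans st₃).trans st₄
  refine ⟨⟨n + ((f x).length + 1) + t + 1, ?_⟩, ?_⟩
  · have := st.iterate
    have e₁ : liftCfg (fun l => (.inl (.inl l) : CompLabel tm P)) (.inr false) (fun _ => [])
        (initList tm (x.map α₀.symm)) =
        initList (compMachine tm P inp out α₁) (x.map α₀.symm) := by
      simp only [liftCfg]
      rw [initList_eq_update, ← update_joinStk_inl]
      have h := initList_eq_update (compMachine tm P inp out α₁) (x.map α₀.symm)
      have : initList (compMachine tm P inp out α₁) (x.map α₀.symm) =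
        ⟨some (.inl (.inl tm.main)), (tm.initialState, none),
          (initList (compMachine tm P inp out α₁) (x.map α₀.symm)).stk⟩ := rfl
      rw [this, h]
      have h0 : (joinStk (fun _ => []) fun _ => [] : ∀ k : tm.K ⊕ S, List (ExtAlphabet tm.Γ S k))
          = fun _ => [] := by
        funext k; cases k <;> rfl
      rw [h0]
      rfl
    have e₂ : (⟨none, (tm.initialState, none),
        joinStk (Function.update (fun _ => []) tm.k₁ []) (singleStk out (g x))⟩ :
        TM2.Cfg (ExtAlphabet tm.Γ S) (CompLabel tm P) (tm.σ × Option Bool)) =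
        haltList (compMachine tm P inp out α₁) (g x) := by
      have h := haltList_eq_update (compMachine tm P inp out α₁) (g x)
      have : haltList (compMachine tm P inp out α₁) (g x) =
        ⟨none, (tm.initialState, none),
          (haltList (compMachine tm P inp out α₁) (g x)).stk⟩ := rfl
      rw [this, h, singleStk, ← update_joinStk_inr]
      have h0 : (joinStk (Function.update (fun _ => []) tm.k₁ []) fun _ => [] :
          ∀ k : tm.K ⊕ S, List (ExtAlphabet tm.Γ S k)) = fun _ => [] := by
        funext k
        rcases k with k | k
        · simp only [joinStk]
          by_cases h : k = tm.k₁
          · subst h; simp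
          · simp [Function.update_of_ne h]
        · rfl
      rw [h0]
      rfl
    rw [e₁, e₂] at this
    have e₃ : List.map (Equiv.refl Bool).invFun (g x) = g x := List.map_id _
    exact this.trans (congrArg (fun l => some (haltList (compMachine tm P inp out α₁) l)) e₃.symm)
  · simp only [id, Polynomial.eval_add, Polynomial.eval_one, Polynomial.eval_comp]
    have hp : p.eval (f x).length ≤ p.eval (len.eval x.length) :=
      eval_nat_mono p hx
    omega

/-! ### Relabelling gates -/

/-- The gate obtained by relabelling the qubits along an injection. -/
def Gate.map {ι κ : Type} (f : ι ↪ κ) : Gate ι → Gate κ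
  | .not t => .not (f t)
  | .hadamard t => .hadamard (f t)
  | .phaseT t => .phaseT (f t)
  | .cnot c t h => .cnot (f c) (f t) (f.injective.ne h)
  | .toffoli c₁ c₂ t h₁₂ h₁ h₂ =>
      .toffoli (f c₁) (f c₂) (f t) (f.injective.ne h₁₂) (f.injective.ne h₁) (f.injective.ne h₂)

/-- The qubits on which a gate acts. -/
def Gate.operands {ι : Type} : Gate ι → List ι
  | .not t => [t]
  | .hadamard t => [t]
  | .phaseT t => [t]
  | .cnot c t _ => [c, t]
  | .toffoli c₁ c₂ t _ _ _ => [c₁, c₂, t]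

/-- The swap of the qubits `x` and `y`, controlled by the qubit `c`. -/
def cswapGates {ι : Type} (c x y : ι) (hx : c ≠ x) (hy : c ≠ y) (hxy : x ≠ y) : List (Gate ι) :=
  [.toffoli c x y hx hy hxy, .toffoli c y x hy hx hxy.symm, .toffoli c x y hx hy hxy]

/-! ### Merging three groups of proofs into two -/

/-- The merged proof that contains the proof `i`. The first `r` proofs are kept, and of the
following ones each group of three is merged into two proofs. -/
def mergeIdx (r i : ℕ) : ℕ := min i r + 2 * ((i - r) / 3) + if (i - r) % 3 = 2 then 1 else 0

/-- The register (the even qubits or the odd qubits) of the merged proof that contains the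
proof `i`. -/
def mergeReg (r i : ℕ) : ℕ := if (i - r) % 3 = 0 then 0 else 1

theorem mergeIdx_lt {k r i : ℕ} (h : i < 3 * k + r) : mergeIdx r i < 2 * k + r := by
  unfold mergeIdx
  split <;> omega

theorem mergeReg_lt (r i : ℕ) : mergeReg r i < 2 := by
  unfold mergeReg
  split <;> omega

section Merge

variable {qV k r qM : ℕ}

/-- The place of the qubits of the given verifier in the new one. -/
def mergeQubit : Qubit qV (3 * k + r) qM ↪ Qubit (qV + 4) (2 * k + r) (2 * qM) where
  toFun
    -- New numbers depend on old numbers only, not on `qV`, `k` or `qM`: work qubits are shifted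
    -- past the ancillas, and the two registers of a merged proof are interleaved rather than
    -- concatenated.
    | .inl a => .inl ⟨a + 4, by omega⟩
    | .inr (i, j) => .inr (⟨mergeIdx r i, mergeIdx_lt i.2⟩,
        ⟨2 * j + mergeReg r i, by have := mergeReg_lt r i; omega⟩)
  inj' := by
    rintro (a | ⟨i, j⟩) (b | ⟨i', j'⟩) h
    · simp only [Sum.inl.injEq, Fin.mk.injEq] at h
      rw [Fin.ext (show (a : ℕ) = b by omega)]
    · simp at h
    · simp at h
    · simp only [Sum.inr.injEq, Prod.mk.injEq, Fin.mk.injEq, mergeIdx, mergeReg] at h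
      obtain ⟨h₁, h₂⟩ := h
      have hi : i = i' := by
        apply Fin.ext
        split_ifs at h₁ h₂ <;> omega
      subst hi
      rw [Fin.ext (show (j : ℕ) = j' by omega)]

/-- The four new qubits of the work space. -/
def ancilla (m : Fin 4) : Qubit (qV + 4) (2 * k + r) (2 * qM) := .inl ⟨m, by omega⟩

/-- The even qubits of the first merged proof of the group `a`. -/
def swapFst (a : Fin k) (j : Fin qM) : Qubit (qV + 4) (2 * k + r) (2 * qM) :=
  .inr (⟨r + 2 * a, by omega⟩, ⟨2 * j, by omega⟩)

/-- The even qubits of the second merged proof of the group `a`. -/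
def swapSnd (a : Fin k) (j : Fin qM) : Qubit (qV + 4) (2 * k + r) (2 * qM) :=
  .inr (⟨r + 2 * a + 1, by omega⟩, ⟨2 * j, by omega⟩)

/-- A strict upper bound on the numbers of the proofs in a list of qubits. -/
def proofBound (l : List (Qubit qV k qM)) : ℕ :=
  l.foldl (fun m q => Sum.elim (fun _ => m) (fun p => max m (p.1 + 1)) q) 0

/-- A strict upper bound on the positions within the proofs in a list of qubits. -/
def posBound (l : List (Qubit qV k qM)) : ℕ :=
  l.foldl (fun m q => Sum.elim (fun _ => m) (fun p => max m (p.2 + 1)) q) 0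

theorem foldl_max_le {α : Type} (g : α → ℕ) (l : List (Fin qV ⊕ α)) (m B : ℕ) (hm : m ≤ B)
    (hB : ∀ p, g p ≤ B) :
    l.foldl (fun m q => Sum.elim (fun _ => m) (fun p => max m (g p)) q) m ≤ B := by
  induction l generalizing m with
  | nil => exact hm
  | cons q l ih =>
    refine ih _ ?_
    rcases q with a | p
    · exact hm
    · exact max_le hm (hB p)

theorem le_foldl_max {α : Type} (g : α → ℕ) (l : List (Fin qV ⊕ α)) (m : ℕ) :
    m ≤ l.foldl (fun m q => Sum.elim (fun _ => m) (fun p => max m (g p)) q) m ∧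
      ∀ p, Sum.inr p ∈ l →
        g p ≤ l.foldl (fun m q => Sum.elim (fun _ => m) (fun p => max m (g p)) q) m := by
  induction l generalizing m with
  | nil => simp
  | cons q l ih =>
    rcases q with a | p
    · refine ⟨(ih m).1, fun p hp => (ih m).2 p ?_⟩
      simpa using hp
    · refine ⟨(le_max_left _ _).trans (ih (max m (g p))).1, fun p' hp => ?_⟩
      rcases List.mem_cons.1 hp with h | h
      · obtain rfl : p' = p := by simpa using h
        exact (le_max_right _ _).trans (ih (max m (g p'))).1
      · exact (ih (max m (g p))).2 p' h

theorem proofBound_le (l : List (Qubit qV k qM)) : proofBound l ≤ k :=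
  foldl_max_le (fun p : Fin k × Fin qM => (p.1 : ℕ) + 1) l 0 k (Nat.zero_le _) fun p => p.1.2

theorem posBound_le (l : List (Qubit qV k qM)) : posBound l ≤ qM :=
  foldl_max_le (fun p : Fin k × Fin qM => (p.2 : ℕ) + 1) l 0 qM (Nat.zero_le _) fun p => p.2.2

theorem lt_proofBound {l : List (Qubit qV k qM)} {i : Fin k} {j : Fin qM}
    (h : Sum.inr (i, j) ∈ l) : (i : ℕ) < proofBound l :=
  (le_foldl_max (fun p : Fin k × Fin qM => (p.1 : ℕ) + 1) l 0).2 (i, j) h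

theorem lt_posBound {l : List (Qubit qV k qM)} {i : Fin k} {j : Fin qM}
    (h : Sum.inr (i, j) ∈ l) : (j : ℕ) < posBound l :=
  (le_foldl_max (fun p : Fin k × Fin qM => (p.2 : ℕ) + 1) l 0).2 (i, j) h

/-- The qubits touched by a circuit. -/
def Circuit.touched (C : Circuit qV k qM) : List (Qubit qV k qM) :=
  C.gates.flatMap Gate.operands

/-- The number of groups of proofs touched by a circuit. -/
def Circuit.groupBound (r : ℕ) (C : Circuit qV k qM) : ℕ :=
  (proofBound C.touched - r + 2) / 3

theorem Circuit.groupBound_le (C : Circuit qV (3 * k + r) qM) : C.groupBound r ≤ k := by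
  have := proofBound_le C.touched
  unfold groupBound
  omega

/-- The pairs of qubits exchanged in the swap test. -/
def Circuit.swapPairs (C : Circuit qV (3 * k + r) qM) : List (Fin k × Fin qM) :=
  (List.finRange (C.groupBound r)).flatMap fun a =>
    (List.finRange (posBound C.touched)).map fun j =>
      (Fin.castLE C.groupBound_le a, Fin.castLE (posBound_le _) j)

theorem ancilla_ne_swapFst (m : Fin 4) (a : Fin k) (j : Fin qM) :
    (ancilla m : Qubit (qV + 4) (2 * k + r) (2 * qM)) ≠ swapFst a j := by
  simp [ancilla, swapFst]

theorem ancilla_ne_swapSnd (m : Fin 4) (a : Fin k) (j : Fin qM) :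
    (ancilla m : Qubit (qV + 4) (2 * k + r) (2 * qM)) ≠ swapSnd a j := by
  simp [ancilla, swapSnd]

theorem swapFst_ne_swapSnd (a a' : Fin k) (j j' : Fin qM) :
    (swapFst a j : Qubit (qV + 4) (2 * k + r) (2 * qM)) ≠ swapSnd a' j' := by
  simp only [swapFst, swapSnd, ne_eq, Sum.inr.injEq, Prod.mk.injEq, Fin.mk.injEq]
  omega

theorem ancilla_injective :
    Function.Injective (ancilla : Fin 4 → Qubit (qV + 4) (2 * k + r) (2 * qM)) := by
  intro m m' h
  simp only [ancilla, Sum.inl.injEq, Fin.mk.injEq] at h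
  exact Fin.ext h

theorem mergeQubit_ne_ancilla (q : Qubit qV (3 * k + r) qM) (m : Fin 4) :
    mergeQubit q ≠ ancilla m := by
  rcases q with a | ⟨i, j⟩
  · intro h
    have : (a : ℕ) + 4 = m := congrArg Fin.val (Sum.inl.inj h)
    omega
  · simp [mergeQubit, ancilla]

/-- The controlled swaps of the swap test. -/
def swapGates (l : List (Fin k × Fin qM)) : List (Gate (Qubit (qV + 4) (2 * k + r) (2 * qM))) :=
  l.flatMap fun p => cswapGates (ancilla 0) (swapFst p.1 p.2) (swapSnd p.1 p.2)
    (ancilla_ne_swapFst _ _ _) (ancilla_ne_swapSnd _ _ _) (swapFst_ne_swapSnd _ _ _ _)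

/-- The gates that compute the new output from a coin, from the result of the swap test and from
the output of the given circuit. -/
def outputGates (o : Fin qV) : List (Gate (Qubit (qV + 4) (2 * k + r) (2 * qM))) :=
  [.hadamard (ancilla 1),
    -- Ancilla 2 becomes 1 when the given circuit rejects and the coin is 1. After ancillas 2 and 0
    -- are negated, ancilla 3 becomes 1 when this did not happen and the swap test left 0 in ancilla
    -- 0.
    .not (mergeQubit (.inl o)),
    .toffoli (mergeQubit (.inl o)) (ancilla 1) (ancilla 2) (mergeQubit_ne_ancilla _ _)
      (mergeQubit_ne_ancilla _ _) (ancilla_injective.ne (by decide)),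
    .not (ancilla 2),
    .not (ancilla 0),
    .toffoli (ancilla 0) (ancilla 2) (ancilla 3) (ancilla_injective.ne (by decide))
      (ancilla_injective.ne (by decide)) (ancilla_injective.ne (by decide))]

/-- The circuit that performs the swap test on the merged proofs, runs the given circuit on the
first component of the outcome and accepts if the swap test succeeds and either the given circuit
accepts or a coin shows heads. -/
def Circuit.merge (C : Circuit qV (3 * k + r) qM) :
    Circuit (qV + 4) (2 * k + r) (2 * qM) where
  output := ⟨3, by omega⟩
  gates := .hadamard (ancilla 0) :: (swapGates C.swapPairs ++ (.hadamard (ancilla 0) ::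
    (C.gates.map (Gate.map mergeQubit) ++ outputGates C.output)))

end Merge

/-! ### The registers of the translation program -/

/-- The stacks of the translation program. -/
inductive Reg : Type
  | inp | tmp | out | o₁ | o₂ | m | j | aux | cnt | flag
  deriving DecidableEq

instance : Fintype Reg where
  elems := {.inp, .tmp, .out, .o₁, .o₂, .m, .j, .aux, .cnt, .flag}
  complete := by rintro ⟨⟩ <;> decide

/-- The contents of the stacks of the translation program. -/
@[ext]
structure Store : Type where
  inp : List Bool := []
  tmp : List Bool := []
  out : List Bool := []
  o₁ : List Bool := []
  o₂ : List Bool := []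
  m : List Bool := []
  j : List Bool := []
  aux : List Bool := []
  cnt : List Bool := []
  flag : List Bool := []

/-- The contents of a stack. -/
def Store.get (s : Store) : Reg → List Bool
  | .inp => s.inp
  | .tmp => s.tmp
  | .out => s.out
  | .o₁ => s.o₁
  | .o₂ => s.o₂
  | .m => s.m
  | .j => s.j
  | .aux => s.aux
  | .cnt => s.cnt
  | .flag => s.flag

/-- Replace the contents of a stack. -/
def Store.set (s : Store) (l : List Bool) : Reg → Store
  | .inp => { s with inp := l }
  | .tmp => { s with tmp := l }
  | .out => { s with out := l }
  | .o₁ => { s with o₁ := l }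
  | .o₂ => { s with o₂ := l }
  | .m => { s with m := l }
  | .j => { s with j := l }
  | .aux => { s with aux := l }
  | .cnt => { s with cnt := l }
  | .flag => { s with flag := l }

theorem Store.get_set (s : Store) (l : List Bool) (i : Reg) :
    (s.set l i).get = Function.update s.get i l := by
  funext i'
  cases i <;> cases i' <;> rfl

/-- `Run P s s' T`: started on `s`, the program `P` ends with `s'` in at most `T` steps. -/
def Run (P : Prog Reg) (s s' : Store) (T : ℕ) : Prop := ∃ t ≤ T, Exec P s.get s'.get t

namespace Run

variable {p q : Prog Reg} {s s' s₂ s₃ : Store} {T T' T₁ T₂ : ℕ} {i : Reg}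

theorem mono (h : Run p s s' T) (hT : T ≤ T') : Run p s s' T' :=
  h.imp fun _ ht => ⟨ht.1.trans hT, ht.2⟩

theorem skip (s : Store) : Run .skip s s 0 := ⟨0, le_rfl, .skip _⟩

theorem push (i : Reg) (b : Bool) (s : Store) : Run (.push i b) s (s.set (b :: s.get i) i) 1 :=
  ⟨1, le_rfl, by rw [Store.get_set]; exact .push _ _ _⟩

theorem seq (h₁ : Run p s s₂ T₁) (h₂ : Run q s₂ s₃ T₂) : Run (.seq p q) s s₃ (T₁ + T₂) := by
  obtain ⟨t₁, ht₁, h₁⟩ := h₁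
  obtain ⟨t₂, ht₂, h₂⟩ := h₂
  exact ⟨t₁ + t₂, by omega, .seq h₁ h₂⟩

theorem ite_true (h : (s.get i).head? = some true) (hp : Run p (s.set (s.get i).tail i) s' T) :
    Run (.ite i p q) s s' (T + 1) := by
  obtain ⟨t, ht, hp⟩ := hp
  rw [Store.get_set] at hp
  exact ⟨1 + t, by omega, .iteTrue h hp⟩

theorem ite_false (h : (s.get i).head? ≠ some true)
    (hq : Run q (s.set (s.get i).tail i) s' T) : Run (.ite i p q) s s' (T + 1) := by
  obtain ⟨t, ht, hp⟩ := hq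
  rw [Store.get_set] at hp
  exact ⟨1 + t, by omega, .iteFalse h hp⟩

theorem loop_stop (h : (s.get i).head? ≠ some true) :
    Run (.loop i p) s (s.set (s.get i).tail i) 1 :=
  ⟨1, le_rfl, by rw [Store.get_set]; exact .loopStop h⟩

theorem loop_step (h : (s.get i).head? = some true)
    (hp : Run p (s.set (s.get i).tail i) s₂ T₁) (hl : Run (.loop i p) s₂ s₃ T₂) :
    Run (.loop i p) s s₃ (T₁ + 1 + T₂) := by
  obtain ⟨t₁, ht₁, hp⟩ := hp
  obtain ⟨t₂, ht₂, hl⟩ := hl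
  rw [Store.get_set] at hp
  exact ⟨1 + t₁ + t₂, by omega, .loopStep h hp hl⟩

theorem scan_stop (h : s.get i = []) : Run (.scan i p q) s s 1 :=
  ⟨1, le_rfl, .scanStop h⟩

theorem scan_true (h : (s.get i).head? = some true)
    (hp : Run p (s.set (s.get i).tail i) s₂ T₁) (hl : Run (.scan i p q) s₂ s₃ T₂) :
    Run (.scan i p q) s s₃ (T₁ + 1 + T₂) := by
  obtain ⟨t₁, ht₁, hp⟩ := hp
  obtain ⟨t₂, ht₂, hl⟩ := hl
  rw [Store.get_set] at hp
  exact ⟨1 + t₁ + t₂, by omega, .scanTrue h hp hl⟩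

theorem scan_false (h : (s.get i).head? = some false)
    (hp : Run q (s.set (s.get i).tail i) s₂ T₁) (hl : Run (.scan i p q) s₂ s₃ T₂) :
    Run (.scan i p q) s s₃ (T₁ + 1 + T₂) := by
  obtain ⟨t₁, ht₁, hp⟩ := hp
  obtain ⟨t₂, ht₂, hl⟩ := hl
  rw [Store.get_set] at hp
  exact ⟨1 + t₁ + t₂, by omega, .scanFalse h hp hl⟩

/-- A loop that runs `n` times; `f k d` is the state with `k` rounds to go and `d` rounds done. -/
theorem loop (n : ℕ) (f : ℕ → ℕ → Store)
    (hstep : ∀ k d, k + 1 + d = n → ((f (k + 1) d).get i).head? = some true ∧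
      Run p ((f (k + 1) d).set ((f (k + 1) d).get i).tail i) (f k (d + 1)) T)
    (hlast : ((f 0 n).get i).head? ≠ some true) :
    Run (.loop i p) (f n 0) ((f 0 n).set ((f 0 n).get i).tail i) (n * (T + 1) + 1) := by
  have key : ∀ k d, k + d = n →
      Run (.loop i p) (f k d) ((f 0 n).set ((f 0 n).get i).tail i) (k * (T + 1) + 1) := by
    intro k
    induction k with
    | zero =>
      intro d hd
      obtain rfl : d = n := by omega
      exact (loop_stop hlast).mono (by omega)
    | succ k ih =>
      intro d hd
      obtain ⟨h₁, h₂⟩ := hstep k d (by omega)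
      exact (loop_step h₁ h₂ (ih (d + 1) (by omega))).mono (by rw [Nat.add_mul]; omega)
  exact key n 0 (by omega)

theorem cast (h : Run p s s₂ T) (hs : s₂ = s') : Run p s s' T := hs ▸ h

end Run

/-! ### Basic programs -/

/-- Append a string to the stream that is being written (in reverse) to the stack `tmp`. -/
def emit (l : List Bool) : Prog Reg := l.foldr (fun b p => .seq (.push .tmp b) p) .skip

theorem run_emit (l : List Bool) (s : Store) :
    Run (emit l) s { s with tmp := l.reverse ++ s.tmp } l.length := by
  induction l generalizing s with
  | nil => exact Run.skip s
  | cons b l ih =>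
    refine (((Run.push .tmp b s).seq (ih _)).mono ?_).cast ?_
    · simp; omega
    · simp [Store.set, Store.get]

theorem run_pop (i : Reg) (s : Store) :
    Run (.ite i .skip .skip) s (s.set (s.get i).tail i) 1 := by
  by_cases h : (s.get i).head? = some true
  · exact Run.ite_true h (Run.skip _)
  · exact Run.ite_false h (Run.skip _)

/-- Increase the maximum in the course of a comparison. -/
def bump (i : Reg) : Prog Reg := .seq (.ite i .skip .skip) (.push .aux true)

theorem run_bump_m (s : Store) :
    Run (bump .m) s { s with m := s.m.tail, aux := true :: s.aux } 2 :=
  (run_pop _ _).seq (Run.push _ _ _)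

theorem run_bump_j (s : Store) :
    Run (bump .j) s { s with j := s.j.tail, aux := true :: s.aux } 2 :=
  (run_pop _ _).seq (Run.push _ _ _)

/-- Move a unary number from one stack to another. -/
def pour (i i' : Reg) : Prog Reg := .loop i (.push i' true)

theorem run_pour (i i' : Reg) (hi : i ≠ i') (s : Store) (n : ℕ)
    (h : s.get i = List.replicate n true) :
    Run (pour i i') s ((s.set [] i).set (List.replicate n true ++ s.get i') i') (2 * n + 1) := by
  set f : ℕ → ℕ → Store := fun k d =>
    (s.set (List.replicate k true) i).set (List.replicate d true ++ s.get i') i' with hf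
  have hget : ∀ k d, (f k d).get i = List.replicate k true := fun k d => by
    simp [hf, Store.get_set, Function.update_of_ne hi]
  have hget' : ∀ k d, (f k d).get i' = List.replicate d true ++ s.get i' := fun k d => by
    simp [hf, Store.get_set]
  have hinj : ∀ s s' : Store, s.get = s'.get → s = s' := fun s s' h => by
    have h := congrFun h
    ext1
    exacts [h .inp, h .tmp, h .out, h .o₁, h .o₂, h .m, h .j, h .aux, h .cnt, h .flag]
  have := Run.loop (i := i) (p := .push i' true) (T := 1) n f
    (fun k d _ => ⟨by simp [hget, List.replicate_succ], (Run.push _ _ _).cast (hinj _ _ (by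
      simp only [hf, Store.get_set]
      funext x
      by_cases hx : x = i
      · subst hx; simp [Function.update_of_ne hi]
      · by_cases hx' : x = i'
        · subst hx'
          simp [Function.update_of_ne hi.symm, List.replicate_succ]
        · simp [Function.update_of_ne hx, Function.update_of_ne hx']))⟩) (by simp [hget])
  have e₀ : f n 0 = s := hinj _ _ (by
    simp only [hf, Store.get_set, ← h]
    simp)
  rw [e₀] at this
  refine (this.mono (by omega)).cast (hinj _ _ ?_)
  simp only [hf, Store.get_set]
  funext x
  by_cases hx : x = i
  · subst hx; simp [Function.update_of_ne hi]
  · simp [Function.update_of_ne hx]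

theorem replicate_append_cons (n : ℕ) (l : List Bool) :
    List.replicate n true ++ true :: l = List.replicate (n + 1) true ++ l := by
  rw [List.replicate_succ', List.append_assoc]; rfl

theorem encodeNat_append (n : ℕ) (l : List Bool) :
    encodeNat n ++ l = List.replicate n true ++ false :: l := by
  simp [encodeNat]

/-! ### Translating the names of qubits -/

section

variable {rest tmp out o₁ o₂ m j aux cnt flag : List Bool}

/-- Copy a number from the stack `inp` to the output stream. -/
def copyNat : Prog Reg := .seq (.loop .inp (emit [true])) (emit [false])

theorem run_copyNat (n : ℕ) :
    Run copyNat ⟨encodeNat n ++ rest, tmp, out, o₁, o₂, m, j, aux, cnt, flag⟩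
      ⟨rest, (encodeNat n).reverse ++ tmp, out, o₁, o₂, m, j, aux, cnt, flag⟩ (2 * n + 2) := by
  rw [encodeNat_append]
  have h₁ : Run (.loop .inp (emit [true]))
      ⟨List.replicate n true ++ false :: rest, tmp, out, o₁, o₂, m, j, aux, cnt, flag⟩
      ⟨rest, List.replicate n true ++ tmp, out, o₁, o₂, m, j, aux, cnt, flag⟩ (n * (1 + 1) + 1) :=
    Run.loop n (fun k d => ⟨List.replicate k true ++ false :: rest, List.replicate d true ++ tmp,
      out, o₁, o₂, m, j, aux, cnt, flag⟩) (fun k d _ => ⟨rfl, run_emit _ _⟩) (by simp [Store.get])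
  refine ((h₁.seq (run_emit [false] _)).mono ?_).cast ?_
  · simp; omega
  · simp [encodeNat]

/-- Translate a qubit of the work space. -/
def workProg : Prog Reg := .seq (emit [false, true, true, true, true]) copyNat

theorem run_workProg (n : ℕ) :
    Run workProg ⟨encodeNat n ++ rest, tmp, out, o₁, o₂, m, j, aux, cnt, flag⟩
      ⟨rest, (false :: encodeNat (n + 4)).reverse ++ tmp, out, o₁, o₂, m, j, aux, cnt, flag⟩
      (2 * n + 7) := by
  refine (((run_emit _ _).seq (run_copyNat n)).mono ?_).cast ?_
  · simp; omega
  · have : encodeNat (n + 4) = [true, true, true, true] ++ encodeNat n := rfl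
    simp [this]

/-- Read a number, keep the maximum in a stack and run a program for each unit. -/
def readNat (i : Reg) (p : Prog Reg) : Prog Reg :=
  .seq (.loop .inp (.seq p (bump i))) (.seq (bump i) (pour .aux i))

/-- Translate the numbers of the first `r` proofs. -/
def skipProofs : ℕ → Prog Reg
  | 0 => .skip
  | r + 1 => .seq (.ite .cnt (emit [true]) .skip) (skipProofs r)

theorem run_skipProofs (r c : ℕ) :
    Run (skipProofs r) ⟨rest, tmp, out, o₁, o₂, m, j, aux, List.replicate c true, flag⟩
      ⟨rest, List.replicate (min c r) true ++ tmp, out, o₁, o₂, m, j, aux,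
        List.replicate (c - r) true, flag⟩ (2 * r) := by
  induction r generalizing c tmp with
  | zero => exact (Run.skip _).cast (by simp)
  | succ r ih =>
    rcases c with _ | c
    · have h : Run (.ite .cnt (emit [true]) .skip)
          ⟨rest, tmp, out, o₁, o₂, m, j, aux, List.replicate 0 true, flag⟩
          ⟨rest, tmp, out, o₁, o₂, m, j, aux, List.replicate 0 true, flag⟩ 1 :=
        Run.ite_false (by simp [Store.get]) (Run.skip _)
      refine ((h.seq (ih 0)).mono (by omega)).cast (by simp)
    · have h : Run (.ite .cnt (emit [true]) .skip)
          ⟨rest, tmp, out, o₁, o₂, m, j, aux, List.replicate (c + 1) true, flag⟩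
          ⟨rest, true :: tmp, out, o₁, o₂, m, j, aux, List.replicate c true, flag⟩ (1 + 1) :=
        Run.ite_true (by simp [Store.get, List.replicate_succ]) (run_emit [true] _)
      refine ((h.seq (ih c)).mono (by omega)).cast ?_
      rw [replicate_append_cons]
      simp

/-- Translate the numbers of the proofs that are merged. -/
def mergeProofs : Prog Reg :=
  .loop .cnt (.ite .cnt
    (.ite .cnt (emit [true, true]) (.seq (emit [true]) (.push .flag true)))
    (.push .flag true))

/-- Strong induction in steps of three: a full group contributes two merged proofs. A remainder of 1
or 2 raises the flag, which later selects the odd qubits. -/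
theorem run_mergeProofs (c : ℕ) :
    Run mergeProofs ⟨rest, tmp, out, o₁, o₂, m, j, aux, List.replicate c true, []⟩
      ⟨rest, List.replicate (2 * (c / 3) + if c % 3 = 2 then 1 else 0) true ++ tmp, out, o₁, o₂,
        m, j, aux, [], List.replicate (if c % 3 = 0 then 0 else 1) true⟩ (4 * c + 1) := by
  induction c using Nat.strong_induction_on generalizing tmp with
  | _ c ih =>
    rcases c with _ | _ | _ | c
    · exact Run.loop_stop (by simp [Store.get])
    · have h : Run mergeProofs ⟨rest, tmp, out, o₁, o₂, m, j, aux, [true], []⟩ _ (1 + 1 + 1 + 1) :=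
        Run.loop_step rfl (Run.ite_false (by simp [Store.get, Store.set]) (Run.push _ _ _))
          (Run.loop_stop (by simp [Store.get, Store.set]))
      exact h.mono (by omega)
    · have h : Run mergeProofs ⟨rest, tmp, out, o₁, o₂, m, j, aux, [true, true], []⟩ _
          (1 + 1 + 1 + 1 + 1 + 1) :=
        Run.loop_step rfl (Run.ite_true rfl (Run.ite_false (by simp [Store.get, Store.set])
          ((run_emit [true] _).seq (Run.push _ _ _))))
          (Run.loop_stop (by simp [Store.get, Store.set]))
      exact h.mono (by omega)
    · have h : Run mergeProofs
          ⟨rest, tmp, out, o₁, o₂, m, j, aux, List.replicate (c + 3) true, []⟩ _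
          (2 + 1 + 1 + 1 + (4 * c + 1)) :=
        Run.loop_step rfl (Run.ite_true rfl (Run.ite_true rfl (run_emit [true, true] _)))
          (ih c (by omega))
      refine (h.mono (by omega)).cast ?_
      have h₁ : (c + 1 + 1 + 1) % 3 = c % 3 := by omega
      have h₂ : (c + 1 + 1 + 1) / 3 = c / 3 + 1 := by omega
      rw [h₁, h₂]
      simp only [List.reverse_cons, List.reverse_nil, List.nil_append, List.cons_append,
        replicate_append_cons, Store.mk.injEq, true_and, and_true]
      congr 2
      ring

/-- Translate a qubit of a witness space. -/
def witnessProg (r : ℕ) : Prog Reg :=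
  .seq (emit [true]) <| .seq (readNat .m (.push .cnt true)) <|
  .seq (skipProofs r) <| .seq mergeProofs <| .seq (emit [false]) <|
  .seq (readNat .j (emit [true, true])) (.ite .flag (emit [true, false]) (emit [false]))

theorem tail_replicate_sub (a d : ℕ) :
    (List.replicate (a - d) true).tail = List.replicate (a - (d + 1)) true := by
  rw [List.tail_replicate, Nat.sub_sub]

theorem replicate_append_replicate_sub (a n : ℕ) :
    List.replicate n true ++ List.replicate (a - n) true = List.replicate (max a n) true := by
  rw [List.replicate_append_replicate]
  congr 1
  omega

/-- A maximum without comparison: each `bump` takes a unit from `m`, if there is one, and adds a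
unit to `aux`. After `n + 1` of them the stacks hold `a - (n + 1)` and `n + 1` units, and with
truncated subtraction the sum is `max a (n + 1)`. -/
theorem run_readProof (n a : ℕ) :
    Run (readNat .m (.push .cnt true))
      ⟨encodeNat n ++ rest, tmp, out, o₁, o₂, List.replicate a true, j, [], [], flag⟩
      ⟨rest, tmp, out, o₁, o₂, List.replicate (max a (n + 1)) true, j, [],
        List.replicate n true, flag⟩ (6 * n + 6) := by
  rw [encodeNat_append]
  have h₁ : Run (.loop .inp (.seq (.push .cnt true) (bump .m)))
      ⟨List.replicate n true ++ false :: rest, tmp, out, o₁, o₂, List.replicate (a - 0) true, j, [],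
        [], flag⟩
      ⟨rest, tmp, out, o₁, o₂, List.replicate (a - n) true, j, List.replicate n true,
        List.replicate n true, flag⟩ (n * (3 + 1) + 1) :=
    Run.loop n (fun k d => ⟨List.replicate k true ++ false :: rest, tmp, out, o₁, o₂,
      List.replicate (a - d) true, j, List.replicate d true, List.replicate d true, flag⟩)
      (fun k d _ => ⟨rfl, ((Run.push _ _ _).seq (run_bump_m _)).cast (by
        simp [Store.set, Store.get, List.replicate_succ, Nat.sub_sub])⟩)
      (by simp [Store.get])
  refine ((h₁.seq ((run_bump_m _).seq (run_pour .aux .m (by decide) _ (n + 1) rfl))).mono ?_).cast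
    ?_
  · omega
  · simp only [Store.set, Store.get, tail_replicate_sub, replicate_append_replicate_sub]

theorem run_readPos (n a : ℕ) :
    Run (readNat .j (emit [true, true]))
      ⟨encodeNat n ++ rest, tmp, out, o₁, o₂, m, List.replicate a true, [], cnt, flag⟩
      ⟨rest, List.replicate (2 * n) true ++ tmp, out, o₁, o₂, m,
        List.replicate (max a (n + 1)) true, [], cnt, flag⟩ (7 * n + 6) := by
  rw [encodeNat_append]
  have h₁ : Run (.loop .inp (.seq (emit [true, true]) (bump .j)))
      ⟨List.replicate n true ++ false :: rest, tmp, out, o₁, o₂, m, List.replicate (a - 0) true, [],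
        cnt, flag⟩
      ⟨rest, List.replicate (2 * n) true ++ tmp, out, o₁, o₂, m, List.replicate (a - n) true,
        List.replicate n true, cnt, flag⟩ (n * (4 + 1) + 1) :=
    Run.loop n (fun k d => ⟨List.replicate k true ++ false :: rest,
      List.replicate (2 * d) true ++ tmp, out, o₁, o₂, m,
      List.replicate (a - d) true, List.replicate d true, cnt, flag⟩)
      (fun k d _ => ⟨rfl, ((run_emit _ _).seq (run_bump_j _)).cast (by
        simp [Store.set, Store.get, List.replicate_succ, Nat.sub_sub, Nat.mul_add])⟩)
      (by simp [Store.get])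
  refine ((h₁.seq ((run_bump_j _).seq (run_pour .aux .j (by decide) _ (n + 1) rfl))).mono ?_).cast
    ?_
  · omega
  · simp only [Store.set, Store.get, tail_replicate_sub, replicate_append_replicate_sub]

theorem run_witnessProg (r n l a b : ℕ) :
    Run (witnessProg r)
      ⟨encodeNat n ++ (encodeNat l ++ rest), tmp, out, o₁, o₂, List.replicate a true,
        List.replicate b true, [], [], []⟩
      ⟨rest, (true :: (encodeNat (mergeIdx r n) ++ encodeNat (2 * l + mergeReg r n))).reverse ++ tmp,
        out, o₁, o₂, List.replicate (max a (n + 1)) true, List.replicate (max b (l + 1)) true,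
        [], [], []⟩
      ((10 + 2 * r) * (n + l + 2)) := by
  have h₁ : Run (.ite .flag (emit [true, false]) (emit [false]))
      ⟨rest, List.replicate (2 * l) true ++ false ::
        (List.replicate (2 * ((n - r) / 3) + if (n - r) % 3 = 2 then 1 else 0) true ++
        (List.replicate (min n r) true ++ true :: tmp)), out, o₁, o₂,
        List.replicate (max a (n + 1)) true, List.replicate (max b (l + 1)) true,
        [], [], List.replicate (mergeReg r n) true⟩
      ⟨rest, (true :: (encodeNat (mergeIdx r n) ++ encodeNat (2 * l + mergeReg r n))).reverse ++ tmp,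
        out, o₁, o₂, List.replicate (max a (n + 1)) true, List.replicate (max b (l + 1)) true,
        [], [], []⟩ (2 + 1) := by
    have e : ∀ c : ℕ, false :: (List.replicate c true ++ (List.replicate (2 * l) true ++ false ::
        (List.replicate (2 * ((n - r) / 3) + if (n - r) % 3 = 2 then 1 else 0) true ++
        (List.replicate (min n r) true ++ true :: tmp)))) =
        (true :: (encodeNat (mergeIdx r n) ++ encodeNat (2 * l + c))).reverse ++ tmp := by
      intro c
      have e₁ : List.replicate c true ++ (List.replicate (2 * l) true ++ false ::
        (List.replicate (2 * ((n - r) / 3) + if (n - r) % 3 = 2 then 1 else 0) true ++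
        (List.replicate (min n r) true ++ true :: tmp))) = List.replicate (2 * l + c) true ++
          false :: (List.replicate (mergeIdx r n) true ++ true :: tmp) := by
        rw [← List.append_assoc, List.replicate_append_replicate, ← List.append_assoc
          (List.replicate (2 * ((n - r) / 3) + if (n - r) % 3 = 2 then 1 else 0) true),
          List.replicate_append_replicate]
        congr 2
        · omega
        · congr 2
          unfold mergeIdx
          omega
      rw [e₁]
      simp [encodeNat]
    by_cases hc : (n - r) % 3 = 0
    · have hR : mergeReg r n = 0 := if_pos hc
      rw [hR, ← e 0]
      exact (Run.ite_false (by simp [Store.get]) (run_emit [false] _)).mono (by simp)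
    · have hR : mergeReg r n = 1 := if_neg hc
      rw [hR, ← e 1]
      exact Run.ite_true (by simp [Store.get]) (run_emit [true, false] _)
  have h := (run_emit [true] ⟨encodeNat n ++ (encodeNat l ++ rest), tmp, out, o₁, o₂,
    List.replicate a true, List.replicate b true, [], [], []⟩).seq
    ((run_readProof n a).seq ((run_skipProofs r n).seq ((run_mergeProofs (n - r)).seq
      ((run_emit [false] _).seq ((run_readPos l b).seq h₁)))))
  refine h.mono ?_
  have : 2 * r ≤ 2 * r * (n + l + 2) := Nat.le_mul_of_pos_right _ (by omega)
  rw [Nat.add_mul]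
  simp only [List.length_cons, List.length_nil]
  omega

end

/-! ### Translating the gates -/

section

variable {qV k r qM : ℕ} {rest tmp out o₁ o₂ m j aux cnt flag : List Bool}

/-- The bound on the numbers of the proofs after reading a qubit. -/
abbrev proofStep (a : ℕ) (q : Qubit qV k qM) : ℕ :=
  Sum.elim (fun _ => a) (fun p => max a (p.1 + 1)) q

/-- The bound on the positions after reading a qubit. -/
abbrev posStep (a : ℕ) (q : Qubit qV k qM) : ℕ :=
  Sum.elim (fun _ => a) (fun p => max a (p.2 + 1)) q

/-- Translate a qubit. -/
def qubitProg (r : ℕ) : Prog Reg := .ite .inp (witnessProg r) workProg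

theorem run_qubitProg (q : Qubit qV (3 * k + r) qM) (a b : ℕ) :
    Run (qubitProg r)
      ⟨encodeQubit q ++ rest, tmp, out, o₁, o₂, List.replicate a true, List.replicate b true,
        [], [], []⟩
      ⟨rest, (encodeQubit (mergeQubit q)).reverse ++ tmp, out, o₁, o₂,
        List.replicate (proofStep a q) true, List.replicate (posStep b q) true, [], [], []⟩
      ((12 + 2 * r) * (encodeQubit q).length) := by
  rcases q with n | ⟨n, l⟩
  · refine (Run.ite_false (by simp [Store.get, encodeQubit]) (run_workProg n)).mono ?_
    simp only [encodeQubit, encodeNat, List.length_cons, List.length_append, List.length_replicate,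
      List.length_nil]
    rw [Nat.add_mul]
    omega
  · have h : Run (qubitProg r)
      ⟨true :: (encodeNat n ++ (encodeNat l ++ rest)), tmp, out, o₁, o₂, List.replicate a true,
        List.replicate b true, [], [], []⟩ _ _ :=
      Run.ite_true rfl (run_witnessProg r n l a b)
    have e : encodeQubit (.inr (n, l) : Qubit qV (3 * k + r) qM) ++ rest =
        true :: (encodeNat n ++ (encodeNat l ++ rest)) := by simp [encodeQubit]
    rw [e]
    refine h.mono ?_
    simp only [encodeQubit, encodeNat, List.length_cons, List.length_append, List.length_replicate,
      List.length_nil]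
    generalize hx : (n : ℕ) + 0 + 1 + (l + 0 + 1) + 1 = x
    have : (10 + 2 * r) * (n + l + 2) ≤ (10 + 2 * r) * x := Nat.mul_le_mul_left _ (by omega)
    have h₂ : (12 + 2 * r) * x = (10 + 2 * r) * x + 2 * x := by ring
    rw [h₂]
    omega

/-- Translate `n` qubits. -/
def operandsProg (r : ℕ) : ℕ → Prog Reg
  | 0 => .skip
  | n + 1 => .seq (qubitProg r) (operandsProg r n)

theorem run_operandsProg (l : List (Qubit qV (3 * k + r) qM)) (a b : ℕ) :
    Run (operandsProg r l.length)
      ⟨l.flatMap encodeQubit ++ rest, tmp, out, o₁, o₂, List.replicate a true,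
        List.replicate b true, [], [], []⟩
      ⟨rest, (l.flatMap fun q => encodeQubit (mergeQubit q)).reverse ++ tmp, out, o₁, o₂,
        List.replicate (l.foldl proofStep a) true, List.replicate (l.foldl posStep b) true,
        [], [], []⟩
      ((12 + 2 * r) * (l.flatMap encodeQubit).length) := by
  induction l generalizing tmp a b with
  | nil => exact Run.skip _
  | cons q l ih =>
    rw [List.flatMap_cons, List.append_assoc]
    refine (((run_qubitProg q a b).seq (ih (proofStep a q) (posStep b q))).mono ?_).cast ?_
    · rw [List.length_append, Nat.mul_add]
    · simp

/-- Translate a list of gates. -/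
def gatesProg (r : ℕ) : Prog Reg :=
  .scan .inp
    (.seq (emit [true]) (.ite .inp
      (.seq (emit [true]) (.ite .inp
        (.seq (emit [true]) (.ite .inp
          (.seq (emit [true]) (.seq (.ite .inp .skip .skip)
            (.seq (emit [false]) (operandsProg r 3))))
          (.seq (emit [false]) (operandsProg r 2))))
        (.seq (emit [false]) (operandsProg r 1))))
      (.seq (emit [false]) (operandsProg r 1))))
    (.seq (emit [false]) (operandsProg r 1))

/-- The code for the kind of a gate. -/
def Gate.kind {ι : Type} : Gate ι → ℕ
  | .not _ => 0
  | .hadamard _ => 1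
  | .phaseT _ => 2
  | .cnot _ _ _ => 3
  | .toffoli _ _ _ _ _ _ => 4

theorem encodeGate_eq (g : Gate (Qubit qV k qM)) :
    encodeGate g = encodeNat g.kind ++ g.operands.flatMap encodeQubit := by
  cases g <;> simp [encodeGate, Gate.kind, Gate.operands]

theorem kind_map {ι κ : Type} (f : ι ↪ κ) (g : Gate ι) : (g.map f).kind = g.kind := by
  cases g <;> rfl

theorem operands_map {ι κ : Type} (f : ι ↪ κ) (g : Gate ι) :
    (g.map f).operands = g.operands.map f := by
  cases g <;> rfl

/-- Relabelling keeps the kind of a gate, so the kind is copied bit by bit, and the bits read decide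
how many names follow. The bounds kept in `m` and `j` become those of the whole circuit and later
determine the extent of the swap test. -/
theorem run_gatesProg (gs : List (Gate (Qubit qV (3 * k + r) qM))) (a b : ℕ) :
    Run (gatesProg r)
      ⟨gs.flatMap encodeGate, tmp, out, o₁, o₂, List.replicate a true, List.replicate b true,
        [], [], []⟩
      ⟨[], ((gs.map (Gate.map mergeQubit)).flatMap encodeGate).reverse ++ tmp, out, o₁, o₂,
        List.replicate ((gs.flatMap Gate.operands).foldl proofStep a) true,
        List.replicate ((gs.flatMap Gate.operands).foldl posStep b) true, [], [], []⟩
      ((20 + 2 * r) * (gs.flatMap encodeGate).length + 1) := by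
  induction gs generalizing tmp a b with
  | nil => exact (Run.scan_stop rfl).mono (by simp)
  | cons g gs ih =>
    have hops := fun t => run_operandsProg (rest := gs.flatMap encodeGate) (tmp := t) (out := out)
      (o₁ := o₁) (o₂ := o₂) g.operands a b
    have hrest := ih (tmp := ((g.map mergeQubit).operands.flatMap encodeQubit).reverse ++
      ((encodeNat g.kind).reverse ++ tmp)) (g.operands.foldl proofStep a)
      (g.operands.foldl posStep b)
    rw [List.flatMap_cons, List.map_cons, List.flatMap_cons, List.flatMap_cons, encodeGate_eq g,
      encodeGate_eq (g.map mergeQubit), kind_map, List.foldl_append, List.foldl_append]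
    simp only [List.append_assoc, List.reverse_append]
    have hmap : (g.map mergeQubit).operands.flatMap encodeQubit =
        g.operands.flatMap fun q => encodeQubit (mergeQubit q) := by
      rw [operands_map, List.flatMap_map]
    rw [hmap] at hrest ⊢
    set X := (g.operands.flatMap encodeQubit).length with hX
    have hXle : (encodeNat g.kind).length + X = (encodeGate g).length := by
      rw [encodeGate_eq, List.length_append]
    set Y := (gs.flatMap encodeGate).length
    -- Here `t` counts the steps spent on the kind of the gate; the bits of the kind, charged at `20
    -- + 2 * r` each, pay for them.
    have hT : ∀ t, t ≤ 12 →
        t + (12 + 2 * r) * X + ((20 + 2 * r) * Y + 1) ≤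
          (20 + 2 * r) * ((encodeNat g.kind).length + (X + Y)) + 1 := by
      intro t ht
      have h₀ : (encodeNat g.kind).length = g.kind + 1 := by simp [encodeNat]
      have h₁ : (20 + 2 * r) * (g.kind + 1 + (X + Y)) =
        (20 + 2 * r) * Y + (12 + 2 * r) * X + (20 + 2 * r) * (g.kind + 1) + 8 * X := by ring
      have h₂ : 20 + 2 * r ≤ (20 + 2 * r) * (g.kind + 1) := Nat.le_mul_of_pos_right _ (by omega)
      rw [h₀, h₁]
      omega
    have hlen : (encodeNat g.kind ++ (g.operands.flatMap encodeQubit ++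
        gs.flatMap encodeGate)).length = (encodeNat g.kind).length + (X + Y) := by
      simp [X, Y]
    rw [hlen]
    cases g with
    | not t =>
      exact (Run.scan_false rfl ((run_emit [false] _).seq (hops _)) hrest).mono
        (le_trans (by simp only [List.length_cons, List.length_nil]; omega) (hT 2 (by omega)))
    | hadamard t =>
      exact (Run.scan_true rfl ((run_emit [true] _).seq (Run.ite_false (by
        simp [Store.get, Store.set, Gate.kind, encodeNat]) ((run_emit [false] _).seq (hops _))))
        hrest).mono
        (le_trans (by simp only [List.length_cons, List.length_nil]; omega) (hT 4 (by omega)))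
    | phaseT t =>
      exact (Run.scan_true rfl ((run_emit [true] _).seq (Run.ite_true rfl
        ((run_emit [true] _).seq (Run.ite_false (by
        simp [Store.get, Store.set, Gate.kind, encodeNat]) ((run_emit [false] _).seq (hops _))))))
        hrest).mono
        (le_trans (by simp only [List.length_cons, List.length_nil]; omega) (hT 6 (by omega)))
    | cnot c t h =>
      exact (Run.scan_true rfl ((run_emit [true] _).seq (Run.ite_true rfl
        ((run_emit [true] _).seq (Run.ite_true rfl ((run_emit [true] _).seq (Run.ite_false (by
        simp [Store.get, Store.set, Gate.kind, encodeNat])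
        ((run_emit [false] _).seq (hops _)))))))) hrest).mono
        (le_trans (by simp only [List.length_cons, List.length_nil]; omega) (hT 8 (by omega)))
    | toffoli c₁ c₂ t h₁₂ h₁ h₂ =>
      refine Run.mono (Run.scan_true rfl ((run_emit [true] _).seq (Run.ite_true rfl
        ((run_emit [true] _).seq (Run.ite_true rfl ((run_emit [true] _).seq (Run.ite_true rfl
        ((run_emit [true] _).seq ((run_pop .inp _).seq
        ((run_emit [false] _).seq (hops _)))))))))) hrest)
        (le_trans (by simp only [List.length_cons, List.length_nil]; omega) (hT 10 (by omega)))

/-! ### Writing the swap test -/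

/-- Write twice the number in the stack `i`. -/
def doubleProg (i : Reg) : Prog Reg :=
  .seq (.loop i (.seq (emit [true, true]) (.push .aux true))) (pour .aux i)

theorem run_doubleProg_cnt (n : ℕ) :
    Run (doubleProg .cnt) ⟨rest, tmp, out, o₁, o₂, m, j, [], List.replicate n true, flag⟩
      ⟨rest, List.replicate (2 * n) true ++ tmp, out, o₁, o₂, m, j, [], List.replicate n true,
        flag⟩ (6 * n + 2) := by
  have h : Run (.loop .cnt (.seq (emit [true, true]) (.push .aux true)))
      ⟨rest, tmp, out, o₁, o₂, m, j, [], List.replicate n true, flag⟩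
      ⟨rest, List.replicate (2 * n) true ++ tmp, out, o₁, o₂, m, j, List.replicate n true, [],
        flag⟩ (n * (2 + 1 + 1) + 1) :=
    Run.loop n (fun k d => ⟨rest, List.replicate (2 * d) true ++ tmp, out, o₁, o₂, m, j,
      List.replicate d true, List.replicate k true, flag⟩)
      (fun k d _ => ⟨rfl, (run_emit _ _).seq (Run.push _ _ _)⟩) (by simp [Store.get])
  refine ((h.seq (run_pour .aux .cnt (by decide) _ n rfl)).mono (by omega)).cast ?_
  simp [Store.set, Store.get]

theorem run_doubleProg_flag (n : ℕ) :
    Run (doubleProg .flag) ⟨rest, tmp, out, o₁, o₂, m, j, [], cnt, List.replicate n true⟩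
      ⟨rest, List.replicate (2 * n) true ++ tmp, out, o₁, o₂, m, j, [], cnt,
        List.replicate n true⟩ (6 * n + 2) := by
  have h : Run (.loop .flag (.seq (emit [true, true]) (.push .aux true)))
      ⟨rest, tmp, out, o₁, o₂, m, j, [], cnt, List.replicate n true⟩
      ⟨rest, List.replicate (2 * n) true ++ tmp, out, o₁, o₂, m, j, List.replicate n true, cnt,
        []⟩ (n * (2 + 1 + 1) + 1) :=
    Run.loop n (fun k d => ⟨rest, List.replicate (2 * d) true ++ tmp, out, o₁, o₂, m, j,
      List.replicate d true, cnt, List.replicate k true⟩)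
      (fun k d _ => ⟨rfl, (run_emit _ _).seq (Run.push _ _ _)⟩) (by simp [Store.get])
  refine ((h.seq (run_pour .aux .flag (by decide) _ n rfl)).mono (by omega)).cast ?_
  simp [Store.set, Store.get]

/-- The name of an even qubit of a merged proof. -/
def swapName (x a l : ℕ) : List Bool := true :: (encodeNat (x + 2 * a) ++ encodeNat (2 * l))

/-- Write the name of an even qubit of a merged proof. -/
def swapNameProg (x : ℕ) : Prog Reg :=
  .seq (emit (true :: List.replicate x true)) <| .seq (doubleProg .cnt) <| .seq (emit [false]) <|
  .seq (doubleProg .flag) (emit [false])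

theorem run_swapNameProg (x a l : ℕ) :
    Run (swapNameProg x)
      ⟨rest, tmp, out, o₁, o₂, m, j, [], List.replicate a true, List.replicate l true⟩
      ⟨rest, (swapName x a l).reverse ++ tmp, out, o₁, o₂, m, j, [], List.replicate a true,
        List.replicate l true⟩ (x + 6 * a + 6 * l + 7) := by
  refine (((run_emit _ _).seq ((run_doubleProg_cnt a).seq ((run_emit _ _).seq
    ((run_doubleProg_flag l).seq (run_emit _ _))))).mono ?_).cast ?_
  · simp; omega
  · simp only [swapName, Store.mk.injEq, true_and, and_true, encodeNat]
    simp [Nat.add_comm x]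
    rw [List.replicate_add, List.append_assoc]

/-- The code of a Toffoli gate with the control `0`. -/
def toffoliCode (p q : List Bool) : List Bool := encodeNat 4 ++ [false, false] ++ p ++ q

/-- Write a controlled swap. -/
def cswapProg (r : ℕ) : Prog Reg :=
  .seq (emit (encodeNat 4 ++ [false, false])) <| .seq (swapNameProg r) <|
  .seq (swapNameProg (r + 1)) <|
  .seq (emit (encodeNat 4 ++ [false, false])) <| .seq (swapNameProg (r + 1)) <|
  .seq (swapNameProg r) <|
  .seq (emit (encodeNat 4 ++ [false, false])) <| .seq (swapNameProg r) (swapNameProg (r + 1))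

/-- The code of a controlled swap. -/
def cswapCode (r a l : ℕ) : List Bool :=
  toffoliCode (swapName r a l) (swapName (r + 1) a l) ++
  (toffoliCode (swapName (r + 1) a l) (swapName r a l) ++
  toffoliCode (swapName r a l) (swapName (r + 1) a l))

theorem run_cswapProg (r a l : ℕ) :
    Run (cswapProg r)
      ⟨rest, tmp, out, o₁, o₂, m, j, [], List.replicate a true, List.replicate l true⟩
      ⟨rest, (cswapCode r a l).reverse ++ tmp, out, o₁, o₂, m, j, [], List.replicate a true,
        List.replicate l true⟩ (6 * r + 36 * a + 36 * l + 66) := by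
  refine (((run_emit _ _).seq ((run_swapNameProg r a l).seq ((run_swapNameProg (r + 1) a l).seq
    ((run_emit _ _).seq ((run_swapNameProg (r + 1) a l).seq ((run_swapNameProg r a l).seq
    ((run_emit _ _).seq ((run_swapNameProg r a l).seq
    (run_swapNameProg (r + 1) a l))))))))).mono ?_).cast ?_
  · simp [encodeNat]; omega
  · simp [cswapCode, toffoliCode]

/-- The code of the controlled swaps of the group `a`. -/
def groupCode (r J a : ℕ) : List Bool := (List.range J).flatMap (cswapCode r a)

/-- Write the controlled swaps of a group. -/
def groupProg (r : ℕ) : Prog Reg :=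
  .seq (.loop .j (.seq (.push .o₁ true) (.seq (cswapProg r) (.push .flag true)))) <|
  .seq (pour .o₁ .j) (.loop .flag .skip)

theorem run_clear_flag (n : ℕ) :
    Run (.loop .flag .skip) ⟨rest, tmp, out, o₁, o₂, m, j, aux, cnt, List.replicate n true⟩
      ⟨rest, tmp, out, o₁, o₂, m, j, aux, cnt, []⟩ (n * (0 + 1) + 1) :=
  Run.loop n (fun k _ => ⟨rest, tmp, out, o₁, o₂, m, j, aux, cnt, List.replicate k true⟩)
    (fun _ _ _ => ⟨rfl, Run.skip _⟩) (by simp [Store.get])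

theorem run_clear_cnt (n : ℕ) :
    Run (.loop .cnt .skip) ⟨rest, tmp, out, o₁, o₂, m, j, aux, List.replicate n true, flag⟩
      ⟨rest, tmp, out, o₁, o₂, m, j, aux, [], flag⟩ (n * (0 + 1) + 1) :=
  Run.loop n (fun k _ => ⟨rest, tmp, out, o₁, o₂, m, j, aux, List.replicate k true, flag⟩)
    (fun _ _ _ => ⟨rfl, Run.skip _⟩) (by simp [Store.get])

theorem run_clear_j (n : ℕ) :
    Run (.loop .j .skip) ⟨rest, tmp, out, o₁, o₂, m, List.replicate n true, aux, cnt, flag⟩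
      ⟨rest, tmp, out, o₁, o₂, m, [], aux, cnt, flag⟩ (n * (0 + 1) + 1) :=
  Run.loop n (fun k _ => ⟨rest, tmp, out, o₁, o₂, m, List.replicate k true, aux, cnt, flag⟩)
    (fun _ _ _ => ⟨rfl, Run.skip _⟩) (by simp [Store.get])

/-- The loop consumes `j`, so its units are collected in `o₁` and poured back; `flag` holds the
current position and is cleared at the end. -/
theorem run_groupProg (r a J : ℕ) :
    Run (groupProg r)
      ⟨rest, tmp, out, [], o₂, m, List.replicate J true, [], List.replicate a true, []⟩
      ⟨rest, (groupCode r J a).reverse ++ tmp, out, [], o₂, m, List.replicate J true, [],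
        List.replicate a true, []⟩ (J * (6 * r + 36 * a + 36 * J + 72) + 3) := by
  have h : Run (.loop .j (.seq (.push .o₁ true) (.seq (cswapProg r) (.push .flag true))))
      ⟨rest, tmp, out, [], o₂, m, List.replicate J true, [], List.replicate a true, []⟩
      ⟨rest, (groupCode r J a).reverse ++ tmp, out, List.replicate J true, o₂, m, [], [],
        List.replicate a true, List.replicate J true⟩
      (J * (1 + ((6 * r + 36 * a + 36 * J + 66) + 1) + 1) + 1) :=
    Run.loop J (fun k d => ⟨rest, (groupCode r d a).reverse ++ tmp, out, List.replicate d true, o₂,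
      m, List.replicate k true, [], List.replicate a true, List.replicate d true⟩)
      (fun k d hd => ⟨rfl, ((Run.push _ _ _).seq (((run_cswapProg r a d).mono (by omega)).seq
        (Run.push _ _ _))).cast (by
          simp [Store.set, Store.get, groupCode, List.range_succ, List.replicate_succ])⟩)
      (by simp [Store.get])
  refine ((h.seq ((run_pour .o₁ .j (by decide) _ J rfl).seq (run_clear_flag J))).mono ?_).cast ?_
  · have : J * (6 * r + 36 * a + 36 * J + 72) = J * (6 * r + 36 * a + 36 * J + 69) + 3 * J := by
      ring
    rw [this]
    have h₂ : J * (1 + ((6 * r + 36 * a + 36 * J + 66) + 1) + 1) =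
      J * (6 * r + 36 * a + 36 * J + 69) := by ring
    rw [h₂]
    omega
  · simp [Store.set, Store.get]

/-- Write the controlled swaps of all groups. -/
def swapTestProg (r : ℕ) : Prog Reg :=
  .loop .m (.seq (.ite .m .skip .skip) (.seq (.ite .m .skip .skip)
    (.seq (groupProg r) (.push .cnt true))))

/-- Each round removes up to three units of `m`, and an incomplete last group still gets its round:
`(M + 2) / 3` is `M / 3` rounded up. -/
theorem run_swapTestProg (r M J : ℕ) :
    Run (swapTestProg r)
      ⟨rest, tmp, out, [], o₂, List.replicate M true, List.replicate J true, [], [], []⟩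
      ⟨rest, ((List.range ((M + 2) / 3)).flatMap (groupCode r J)).reverse ++ tmp, out, [], o₂, [],
        List.replicate J true, [], List.replicate ((M + 2) / 3) true, []⟩
      ((M + 2) / 3 * (J * (6 * r + 36 * M + 36 * J + 72) + 7) + 1) := by
  set K := (M + 2) / 3 with hK
  have h : Run (swapTestProg r)
      ⟨rest, tmp, out, [], o₂, List.replicate (M - 3 * 0) true, List.replicate J true, [], [], []⟩
      ⟨rest, ((List.range K).flatMap (groupCode r J)).reverse ++ tmp, out, [], o₂,
        (List.replicate (M - 3 * K) true).tail, List.replicate J true, [], List.replicate K true,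
        []⟩ (K * (1 + (1 + ((J * (6 * r + 36 * M + 36 * J + 72) + 3) + 1)) + 1) + 1) :=
    Run.loop K (fun _ d => ⟨rest, ((List.range d).flatMap (groupCode r J)).reverse ++ tmp, out, [],
      o₂, List.replicate (M - 3 * d) true, List.replicate J true, [], List.replicate d true, []⟩)
      (fun k d hd => ⟨by
        simp only [Store.get]
        obtain ⟨x, hx⟩ : ∃ x, M - 3 * d = x + 1 := ⟨M - 3 * d - 1, by omega⟩
        rw [hx]; rfl, ((run_pop .m _).seq ((run_pop .m _).seq (((run_groupProg r d J).mono
          (by gcongr; omega)).seq (Run.push _ _ _)))).cast (by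
          simp only [Store.get, Store.set, List.tail_replicate, List.range_succ,
            List.flatMap_append, List.flatMap_cons, List.flatMap_nil, List.append_nil,
            List.reverse_append, List.append_assoc, List.replicate_succ, Store.mk.injEq, true_and,
            and_true]
          congr 1)⟩)
      (by
        simp only [Store.get]
        rw [show M - 3 * K = 0 by omega]
        simp)
  refine (h.mono (by apply le_of_eq; ring)).cast ?_
  rw [show M - 3 * K = 0 by omega]
  rfl

end

/-! ### The complete translation program and its running time -/

section

variable {qV k r qM : ℕ} {inp tmp out o₁ o₂ m j aux cnt flag : List Bool}

/-- Reverse the stream in `tmp` onto another stack. -/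
def reverseTo (i : Reg) : Prog Reg := .scan .tmp (.push i true) (.push i false)

theorem run_reverseTo_inp :
    Run (reverseTo .inp) ⟨inp, tmp, out, o₁, o₂, m, j, aux, cnt, flag⟩
      ⟨tmp.reverse ++ inp, [], out, o₁, o₂, m, j, aux, cnt, flag⟩ (2 * tmp.length + 1) := by
  induction tmp generalizing inp with
  | nil => exact Run.scan_stop rfl
  | cons b l ih =>
    rw [List.reverse_cons, List.append_assoc]
    cases b
    · exact Run.mono (Run.scan_false rfl (Run.push _ _ _) ih) (by rw [List.length_cons]; omega)
    · exact Run.mono (Run.scan_true rfl (Run.push _ _ _) ih) (by rw [List.length_cons]; omega)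

theorem run_reverseTo_out :
    Run (reverseTo .out) ⟨inp, tmp, out, o₁, o₂, m, j, aux, cnt, flag⟩
      ⟨inp, [], tmp.reverse ++ out, o₁, o₂, m, j, aux, cnt, flag⟩ (2 * tmp.length + 1) := by
  induction tmp generalizing out with
  | nil => exact Run.scan_stop rfl
  | cons b l ih =>
    rw [List.reverse_cons, List.append_assoc]
    cases b
    · exact Run.mono (Run.scan_false rfl (Run.push _ _ _) ih) (by rw [List.length_cons]; omega)
    · exact Run.mono (Run.scan_true rfl (Run.push _ _ _) ih) (by rw [List.length_cons]; omega)

/-- A step pushes at most one symbol. In this way the times of `readProg` and `writeProg` bound the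
time for reversing what they have written. -/
theorem Exec.length_le {S : Type} [DecidableEq S] {P : Prog S} {s s' : S → List Bool} {t : ℕ}
    (h : Exec P s s' t) (x : S) : (s' x).length ≤ (s x).length + t := by
  have hu : ∀ (s : S → List Bool) (i : S), (Function.update s i (s i).tail x).length ≤
      (s x).length := fun s i => by
    by_cases hx : x = i
    · subst hx; simp
    · simp [Function.update_of_ne hx]
  induction h with
  | skip s => simp
  | push i b s =>
    by_cases hx : x = i
    · subst hx; simp
    · simp [Function.update_of_ne hx]
  | seq _ _ ih₁ ih₂ => omega
  | @iteTrue i p q s _ _ _ _ ih => have := hu s i; omega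
  | @iteFalse i p q s _ _ _ _ ih => have := hu s i; omega
  | @loopStop i p s _ => have := hu s i; omega
  | @loopStep i p s _ _ _ _ _ _ _ ih₁ ih₂ => have := hu s i; omega
  | scanStop _ => omega
  | @scanTrue i p q s _ _ _ _ _ _ _ ih₁ ih₂ => have := hu s i; omega
  | @scanFalse i p q s _ _ _ _ _ _ _ ih₁ ih₂ => have := hu s i; omega

theorem Run.length_tmp_le {P : Prog Reg} {s s' : Store} {T : ℕ} (h : Run P s s' T) :
    s'.tmp.length ≤ s.tmp.length + T := by
  obtain ⟨t, ht, h⟩ := h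
  exact (h.length_le .tmp).trans (Nat.add_le_add_left ht _)

/-- Read the number of the output qubit. -/
def readOutput : Prog Reg := .loop .inp (.push .o₁ true)

theorem run_readOutput (n : ℕ) :
    Run readOutput ⟨encodeNat n ++ inp, tmp, out, [], o₂, m, j, aux, cnt, flag⟩
      ⟨inp, tmp, out, List.replicate n true, o₂, m, j, aux, cnt, flag⟩ (n * (1 + 1) + 1) := by
  rw [encodeNat_append]
  exact Run.loop n (fun k d => ⟨List.replicate k true ++ false :: inp, tmp, out,
    List.replicate d true, o₂, m, j, aux, cnt, flag⟩) (fun k d _ => ⟨rfl, Run.push _ _ _⟩)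
    (by simp [Store.get])

/-- Write the gates that compute the output. -/
def outputProg : Prog Reg :=
  -- The literals are the codes of `outputGates`, cut at the two places where the number of the
  -- output qubit has to be inserted. The first insertion saves that number in `o₂` for the second.
  .seq (emit [true, false, false, true, false, false, false, true, true, true, true]) <|
  .seq (.loop .o₁ (.seq (emit [true]) (.push .o₂ true))) <|
  .seq (emit [false, true, true, true, true, false, false, true, true, true, true]) <|
  .seq (.loop .o₂ (emit [true]))
  (emit [false, false, true, false, false, true, true, false,
    false, false, true, true, false, false, false, false,
    true, true, true, true, false, false, false, false, true, true, false, false, true, true, true,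
    false])

theorem run_outputProg (o : Fin qV) :
    Run outputProg ⟨inp, tmp, out, List.replicate o true, [], m, j, aux, cnt, flag⟩
      ⟨inp, ((outputGates o : List (Gate (Qubit (qV + 4) (2 * k + r) (2 * qM)))).flatMap
        encodeGate).reverse ++ tmp, out, [], [], m, j, aux, cnt, flag⟩ (5 * o + 60) := by
  have h₁ : ∀ tmp, Run (.loop .o₁ (.seq (emit [true]) (.push .o₂ true)))
      ⟨inp, tmp, out, List.replicate o true, [], m, j, aux, cnt, flag⟩
      ⟨inp, List.replicate o true ++ tmp, out, [], List.replicate o true, m, j, aux, cnt, flag⟩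
      (o * (1 + 1 + 1) + 1) := fun tmp =>
    Run.loop (o : ℕ) (fun k d => ⟨inp, List.replicate d true ++ tmp, out, List.replicate k true,
      List.replicate d true, m, j, aux, cnt, flag⟩)
      (fun k d _ => ⟨rfl, (run_emit _ _).seq (Run.push _ _ _)⟩) (by simp [Store.get])
  have h₂ : ∀ tmp, Run (.loop .o₂ (emit [true]))
      ⟨inp, tmp, out, [], List.replicate o true, m, j, aux, cnt, flag⟩
      ⟨inp, List.replicate o true ++ tmp, out, [], [], m, j, aux, cnt, flag⟩
      (o * (1 + 1) + 1) := fun tmp =>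
    Run.loop (o : ℕ) (fun k d => ⟨inp, List.replicate d true ++ tmp, out, [],
      List.replicate k true, m, j, aux, cnt, flag⟩)
      (fun k d _ => ⟨rfl, run_emit _ _⟩) (by simp [Store.get])
  refine (((run_emit _ _).seq ((h₁ _).seq ((run_emit _ _).seq ((h₂ _).seq
    (run_emit _ _))))).mono ?_).cast ?_
  · simp; omega
  · have e : encodeNat ((o : ℕ) + 4) = [true, true, true, true] ++ List.replicate o true ++
        [false] := rfl
    have ha : ∀ x : Fin 4, encodeQubit (ancilla x : Qubit (qV + 4) (2 * k + r) (2 * qM)) =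
        false :: encodeNat x := fun _ => rfl
    have hq : encodeQubit (mergeQubit (.inl o) : Qubit (qV + 4) (2 * k + r) (2 * qM)) =
        false :: encodeNat ((o : ℕ) + 4) := rfl
    simp only [outputGates, List.flatMap_cons, List.flatMap_nil, encodeGate, ha, hq, e]
    simp [encodeNat, List.replicate]

/-- Remove some units from the stack `m`. -/
def dropProofs : ℕ → Prog Reg
  | 0 => .skip
  | r + 1 => .seq (.ite .m .skip .skip) (dropProofs r)

theorem run_dropProofs (r n : ℕ) :
    Run (dropProofs r) ⟨inp, tmp, out, o₁, o₂, List.replicate n true, j, aux, cnt, flag⟩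
      ⟨inp, tmp, out, o₁, o₂, List.replicate (n - r) true, j, aux, cnt, flag⟩ r := by
  induction r generalizing n with
  | zero => exact Run.skip _
  | succ r ih =>
    have h : Run (.ite .m .skip .skip)
        ⟨inp, tmp, out, o₁, o₂, List.replicate n true, j, aux, cnt, flag⟩
        ⟨inp, tmp, out, o₁, o₂, List.replicate (n - 1) true, j, aux, cnt, flag⟩ 1 :=
      (run_pop .m _).cast (by simp [Store.set, Store.get])
    refine ((h.seq (ih (n - 1))).mono (by omega)).cast ?_
    rw [Nat.sub_sub, Nat.add_comm 1]

/-- Read the description of a circuit, and write the relabelled gates and those that compute the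
output. -/
def readProg (r : ℕ) : Prog Reg :=
  .seq (reverseTo .inp) <| .seq readOutput <| .seq (gatesProg r) outputProg

/-- Write the number of the output qubit and the swap test. -/
def writeProg (r : ℕ) : Prog Reg :=
  -- The number 3 of the new output qubit, followed by the Hadamard gate on ancilla 0.
  .seq (emit [true, true, true, false, true, false, false, false]) <|
  .seq (dropProofs r) <| .seq (swapTestProg r) <| .seq (emit [true, false, false, false]) <|
  .seq (.loop .cnt .skip) (.loop .j .skip)

/-- The program that translates the description of a circuit. -/
def mergeProg (r : ℕ) : Prog Reg :=
  -- The swap test precedes the old gates in the new circuit, but its extent is known only after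
  -- they have been read. So the end of the description goes to `out` first, and the beginning is
  -- then put in front of it.
  .seq (readProg r) <| .seq (reverseTo .out) <| .seq (writeProg r) (reverseTo .out)

theorem swapGates_encode (C : Circuit qV (3 * k + r) qM) :
    (swapGates C.swapPairs : List (Gate (Qubit (qV + 4) (2 * k + r) (2 * qM)))).flatMap
      encodeGate = (List.range (C.groupBound r)).flatMap (groupCode r (posBound C.touched)) := by
  have h : ∀ (a : Fin k) (l : Fin qM),
      (cswapGates (ancilla 0 : Qubit (qV + 4) (2 * k + r) (2 * qM)) (swapFst a l) (swapSnd a l)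
        (ancilla_ne_swapFst _ _ _) (ancilla_ne_swapSnd _ _ _)
        (swapFst_ne_swapSnd _ _ _ _)).flatMap encodeGate = cswapCode r a l := by
    intro a l
    have e : r + 1 + 2 * (a : ℕ) = r + 2 * a + 1 := by omega
    simp only [cswapGates, List.flatMap_cons, List.flatMap_nil, encodeGate, ancilla, swapFst,
      swapSnd, encodeQubit, cswapCode, toffoliCode, swapName, e]
    simp [encodeNat]
  simp only [swapGates, Circuit.swapPairs, List.flatMap_assoc, List.flatMap_map, h, groupCode]
  rw [← List.map_coe_finRange_eq_range, List.flatMap_map]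
  congr 1
  funext a
  change _ = (List.range _).flatMap (cswapCode r a)
  rw [← List.map_coe_finRange_eq_range, List.flatMap_map]
  rfl

theorem merge_encode (C : Circuit qV (3 * k + r) qM) :
    C.merge.encode = [true, true, true, false, true, false, false, false] ++
      ((List.range (C.groupBound r)).flatMap (groupCode r (posBound C.touched)) ++
      ([true, false, false, false] ++
      ((C.gates.map (Gate.map mergeQubit)).flatMap encodeGate ++
        (outputGates C.output : List (Gate (Qubit (qV + 4) (2 * k + r) (2 * qM)))).flatMap
          encodeGate))) := by
  have h : encodeGate (.hadamard (ancilla 0) : Gate (Qubit (qV + 4) (2 * k + r) (2 * qM))) =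
    [true, false, false, false] := rfl
  simp only [Circuit.encode, Circuit.merge, List.flatMap_cons, List.flatMap_append,
    swapGates_encode, h]
  rfl

theorem foldl_max_le_length {α : Type} (g : α → ℕ) (code : Fin qV ⊕ α → List Bool)
    (hg : ∀ p, g p ≤ (code (.inr p)).length) (l : List (Fin qV ⊕ α)) (a : ℕ) :
    l.foldl (fun m q => Sum.elim (fun _ => m) (fun p => max m (g p)) q) a ≤
      a + (l.flatMap code).length := by
  induction l generalizing a with
  | nil => simp
  | cons q l ih =>
    refine (ih _).trans ?_
    rw [List.flatMap_cons, List.length_append]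
    rcases q with x | p
    · simp only [Sum.elim_inl]; omega
    · have := hg p
      simp only [Sum.elim_inr]
      omega

theorem length_touched_le (gs : List (Gate (Qubit qV k qM))) :
    ((gs.flatMap Gate.operands).flatMap encodeQubit).length ≤ (gs.flatMap encodeGate).length := by
  induction gs with
  | nil => simp
  | cons g gs ih =>
    rw [List.flatMap_cons, List.flatMap_cons, List.flatMap_append, encodeGate_eq]
    simp only [List.length_append]
    omega

/-- Numbers are written in unary, so those that occur are at most the length of the description.
This makes the number of controlled swaps polynomial. -/
theorem proofBound_le_length (C : Circuit qV k qM) :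
    proofBound C.touched ≤ (C.gates.flatMap encodeGate).length :=
  ((foldl_max_le_length (fun p : Fin k × Fin qM => (p.1 : ℕ) + 1) encodeQubit (fun p => by
    simp [encodeQubit, encodeNat]) C.touched 0).trans
      (by rw [Nat.zero_add]; exact length_touched_le _))

theorem posBound_le_length (C : Circuit qV k qM) :
    posBound C.touched ≤ (C.gates.flatMap encodeGate).length :=
  ((foldl_max_le_length (fun p : Fin k × Fin qM => (p.2 : ℕ) + 1) encodeQubit (fun p => by
    simp [encodeQubit, encodeNat]; omega) C.touched 0).trans
      (by rw [Nat.zero_add]; exact length_touched_le _))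

/-- The swap test dominates: with `y` the length plus one, there are at most `y` groups of at most
`y` pairs, and writing one controlled swap takes a number of steps linear in `r` and `y`. The
constants are generous. -/
theorem run_mergeProg (C : Circuit qV (3 * k + r) qM) :
    Run (mergeProg r) { tmp := C.encode.reverse } { out := C.merge.encode }
      ((1000 + 100 * r) * (C.encode.length + 1) ^ 3) := by
  set L := C.encode.length with hL
  set M := proofBound C.touched
  set J := posBound C.touched
  have hLe : L = C.output + 1 + (C.gates.flatMap encodeGate).length := by
    simp [hL, Circuit.encode, encodeNat]; omega
  have hM : M ≤ L := (proofBound_le_length C).trans (by omega)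
  have hJ : J ≤ L := (posBound_le_length C).trans (by omega)
  have h₁ : Run (reverseTo .inp) { tmp := C.encode.reverse }
      ⟨encodeNat C.output ++ C.gates.flatMap encodeGate, [], [], [], [], [], [], [], [], []⟩
      (2 * L + 1) :=
    (run_reverseTo_inp.mono (by simp [hL])).cast (by simp [Circuit.encode])
  have h₂ := run_readOutput (inp := C.gates.flatMap encodeGate) (tmp := []) (out := []) (o₂ := [])
    (m := []) (j := []) (aux := []) (cnt := []) (flag := []) C.output
  have h₃ := run_gatesProg (tmp := []) (out := []) (o₁ := List.replicate C.output true)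
    (o₂ := []) C.gates 0 0
  have h₄ := run_outputProg (k := k) (r := r) (qM := qM) (inp := [])
    (tmp := ((C.gates.map (Gate.map mergeQubit)).flatMap encodeGate).reverse ++ []) (out := [])
    (m := List.replicate M true) (j := List.replicate J true) (aux := []) (cnt := [])
    (flag := []) C.output
  set y := L + 1 with hy
  have hA : Run (readProg r) _ _ _ := ((h₁.seq (h₂.seq (h₃.seq h₄))).mono
    (T' := (80 + 2 * r) * y) (by
      have e : (80 + 2 * r) * y = (20 + 2 * r) * (C.gates.flatMap encodeGate).length +
        (20 + 2 * r) * (C.output + 2) + 60 * y := by rw [hy, hLe]; ring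
      have e₂ : 20 * ((C.output : ℕ) + 2) ≤ (20 + 2 * r) * (C.output + 2) :=
        Nat.mul_le_mul_right _ (by omega)
      rw [e]
      omega))
  set sA := (outputGates C.output : List (Gate (Qubit (qV + 4) (2 * k + r) (2 * qM)))).flatMap
    encodeGate with hsA
  set sG := (C.gates.map (Gate.map mergeQubit)).flatMap encodeGate with hsG
  have hlen := hA.length_tmp_le
  simp only [List.length_reverse] at hlen
  have h₅ := run_reverseTo_out (inp := []) (tmp := sA.reverse ++ (sG.reverse ++ [])) (out := [])
    (o₁ := []) (o₂ := []) (m := List.replicate M true) (j := List.replicate J true) (aux := [])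
    (cnt := []) (flag := [])
  have h₇ := run_dropProofs (inp := []) (tmp := [false, false, false, true, false, true, true, true])
    (out := (sA.reverse ++ (sG.reverse ++ [])).reverse ++ [])
    (o₁ := []) (o₂ := []) (j := List.replicate J true) (aux := []) (cnt := []) (flag := []) r M
  have h₈ := run_swapTestProg (rest := []) (tmp := [false, false, false, true, false, true, true, true])
    (out := (sA.reverse ++ (sG.reverse ++ [])).reverse ++ []) (o₂ := []) r (M - r) J
  have hK : (M - r + 2) / 3 ≤ y := by omega
  have hy₁ : 1 ≤ y := by omega
  have hy₃ : y ≤ y ^ 3 := Nat.le_self_pow (by decide) y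
  have hT₈ : (M - r + 2) / 3 * (J * (6 * r + 36 * (M - r) + 36 * J + 72) + 7) + 1 ≤
      (6 * r + 152) * y ^ 3 := by
    have a₁ : 6 * r + 36 * (M - r) + 36 * J + 72 ≤ (6 * r + 144) * y := by
      have : 6 * r ≤ 6 * r * y := Nat.le_mul_of_pos_right _ hy₁
      rw [Nat.add_mul]
      omega
    have a₂ : J * (6 * r + 36 * (M - r) + 36 * J + 72) ≤ y * ((6 * r + 144) * y) :=
      Nat.mul_le_mul (by omega) a₁
    have a₃ : 7 ≤ 7 * y ^ 2 := Nat.le_mul_of_pos_right _ (by positivity)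
    calc _ ≤ y * (y * ((6 * r + 144) * y) + 7 * y ^ 2) + y ^ 3 :=
          Nat.add_le_add (Nat.mul_le_mul hK (Nat.add_le_add a₂ a₃)) (by omega)
      _ = (6 * r + 152) * y ^ 3 := by ring
  have hB : Run (writeProg r) _ _ _ :=
    ((run_emit [true, true, true, false, true, false, false, false]
    ⟨[], [], (sA.reverse ++ (sG.reverse ++ [])).reverse ++ [], [], [], List.replicate M true,
      List.replicate J true, [], [], []⟩).seq (h₇.seq (h₈.seq
      ((run_emit [true, false, false, false] _).seq ((run_clear_cnt _).seq
        (run_clear_j _)))))).mono (T' := (7 * r + 170) * y ^ 3) (by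
      have a₁ : r ≤ r * y ^ 3 := Nat.le_mul_of_pos_right _ (by positivity)
      have a₂ : (7 * r + 170) * y ^ 3 = (6 * r + 152) * y ^ 3 + r * y ^ 3 + 18 * y ^ 3 := by ring
      simp only [List.length_cons, List.length_nil]
      omega)
  have hlenB := hB.length_tmp_le
  have hfinal : Run (mergeProg r) _ _ _ := hA.seq (h₅.seq (hB.seq run_reverseTo_out))
  refine (hfinal.mono ?_).cast ?_
  · dsimp only at hlenB ⊢
    rw [List.length_nil] at hlenB
    have a₁ : (80 + 2 * r) * y ≤ (80 + 2 * r) * y ^ 3 := Nat.mul_le_mul_left _ hy₃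
    have a₂ : (1000 + 100 * r) * y ^ 3 = 3 * ((80 + 2 * r) * y ^ 3) + 3 * ((7 * r + 170) * y ^ 3) +
      (250 + 73 * r) * y ^ 3 := by ring
    have a₃ : 250 * y ^ 3 ≤ (250 + 73 * r) * y ^ 3 := Nat.mul_le_mul_right _ (by omega)
    omega
  · rw [merge_encode]
    simp only [Circuit.groupBound, Store.mk.injEq, true_and, and_true]
    simp only [List.append_nil, List.reverse_append, List.reverse_reverse, List.append_assoc]
    rfl

/-- Merging the proofs preserves polynomial-time uniformity. -/
theorem PolyTimeComputable.merge {qV qM k : List Bool → ℕ} {r : ℕ}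
    {C : ∀ x, Circuit (qV x) (3 * k x + r) (qM x)}
    (h : PolyTimeComputable fun x => (C x).encode) :
    PolyTimeComputable fun x => (C x).merge.encode := by
  refine h.comp_prog (P := mergeProg r) (inp := .tmp) (out := .out)
    (Polynomial.C (1000 + 100 * r) * (Polynomial.X + 1) ^ 3) fun x => ?_
  obtain ⟨t, ht, hx⟩ := run_mergeProg (C x)
  refine ⟨t, by simpa using ht, ?_⟩
  have e₁ : singleStk Reg.tmp (C x).encode.reverse =
      Store.get { tmp := (C x).encode.reverse } := by
    funext i
    cases i <;> rfl
  have e₂ : singleStk Reg.out (C x).merge.encode = Store.get { out := (C x).merge.encode } := by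
    funext i
    cases i <;> rfl
  rw [e₁, e₂]
  exact hx

end

/-! ### Runs of gates -/

section Gates

variable {ι κ : Type} [Fintype ι] [DecidableEq ι] [Fintype κ] [DecidableEq κ]

theorem flipBit_flipBit (b : ι → Bool) (t : ι) : flipBit (flipBit b t) t = b := by
  simp [flipBit]

theorem flipBit_of_ne (b : ι → Bool) {q t : ι} (h : q ≠ t) : flipBit b t q = b q :=
  Function.update_of_ne h _ _

/-- The state after a list of gates has been applied. -/
def runGates (gs : List (Gate ι)) (ψ : QState ι) : QState ι :=
  gs.foldl (fun χ g => g.apply χ) ψ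

theorem runGates_cons (g : Gate ι) (gs : List (Gate ι)) (ψ : QState ι) :
    runGates (g :: gs) ψ = runGates gs (g.apply ψ) := rfl

theorem runGates_append (gs hs : List (Gate ι)) (ψ : QState ι) :
    runGates (gs ++ hs) ψ = runGates hs (runGates gs ψ) := List.foldl_append

theorem Gate.apply_add (g : Gate ι) (ψ χ : QState ι) :
    g.apply (ψ + χ) = g.apply ψ + g.apply χ := by
  ext b
  cases g <;> simp only [Gate.apply, PiLp.add_apply]
  · ring
  · ring
  · split <;> rfl
  · split <;> rfl

theorem Gate.apply_smul (g : Gate ι) (c : ℂ) (ψ : QState ι) :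
    g.apply (c • ψ) = c • g.apply ψ := by
  ext b
  cases g <;> simp only [Gate.apply, PiLp.smul_apply, smul_eq_mul]
  · ring
  · ring
  · split <;> rfl
  · split <;> rfl

theorem runGates_add (gs : List (Gate ι)) (ψ χ : QState ι) :
    runGates gs (ψ + χ) = runGates gs ψ + runGates gs χ := by
  induction gs generalizing ψ χ with
  | nil => rfl
  | cons g gs ih => rw [runGates_cons, Gate.apply_add, ih]; rfl

theorem runGates_smul (gs : List (Gate ι)) (c : ℂ) (ψ : QState ι) :
    runGates gs (c • ψ) = c • runGates gs ψ := by
  induction gs generalizing ψ with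
  | nil => rfl
  | cons g gs ih => rw [runGates_cons, Gate.apply_smul, ih]; rfl

theorem runGates_sub (gs : List (Gate ι)) (ψ χ : QState ι) :
    runGates gs (ψ - χ) = runGates gs ψ - runGates gs χ := by
  have h : ψ - χ = ψ + (-1 : ℂ) • χ := by rw [neg_one_smul, sub_eq_add_neg]
  rw [h, runGates_add, runGates_smul, neg_one_smul, sub_eq_add_neg]

theorem sum_flipBit (t : ι) (F : (ι → Bool) → ℝ) : ∑ b, F (flipBit b t) = ∑ b, F b :=
  Equiv.sum_comp (Function.Involutive.toPerm (fun b => flipBit b t) fun b => flipBit_flipBit b t) F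

/-- Flipping a bit under a condition that does not depend on that bit permutes the basis. -/
theorem sum_condFlip (t : ι) (d : (ι → Bool) → Bool) (hd : ∀ b, d (flipBit b t) = d b)
    (p : (ι → Bool) → ℝ) (ψ : QState ι) :
    ∑ b, p b * ‖if d b then ψ (flipBit b t) else ψ b‖ ^ 2 =
      ∑ b, p (if d b then flipBit b t else b) * ‖ψ b‖ ^ 2 := by
  have hinv : Function.Involutive fun b : ι → Bool => if d b then flipBit b t else b := by
    intro b
    by_cases h : d b
    · simp [h, hd, flipBit_flipBit]
    · simp [h]
  rw [← Equiv.sum_comp (hinv.toPerm _)]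
  refine Finset.sum_congr rfl fun b _ => ?_
  by_cases h : d b
  · simp [h, hd, flipBit_flipBit]
  · simp [h]

/-- Weights `p` on measurement outcomes are pulled back from the state after a gate to the state
before it. `sum_outputGates` moves the acceptance condition through the last gates in this way. -/
theorem sum_not (t : ι) (p : (ι → Bool) → ℝ) (ψ : QState ι) :
    ∑ b, p b * ‖(Gate.not t).apply ψ b‖ ^ 2 = ∑ b, p (flipBit b t) * ‖ψ b‖ ^ 2 := by
  have h := sum_condFlip t (fun _ => true) (fun _ => rfl) p ψ
  simp only [if_true] at h
  exact h

theorem sum_cnot (c t : ι) (h : c ≠ t) (p : (ι → Bool) → ℝ) (ψ : QState ι) :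
    ∑ b, p b * ‖(Gate.cnot c t h).apply ψ b‖ ^ 2 =
      ∑ b, p (if b c then flipBit b t else b) * ‖ψ b‖ ^ 2 :=
  sum_condFlip t (fun b => b c) (fun b => flipBit_of_ne b h) p ψ

theorem sum_toffoli (c₁ c₂ t : ι) (h₁₂ : c₁ ≠ c₂) (h₁ : c₁ ≠ t) (h₂ : c₂ ≠ t)
    (p : (ι → Bool) → ℝ) (ψ : QState ι) :
    ∑ b, p b * ‖(Gate.toffoli c₁ c₂ t h₁₂ h₁ h₂).apply ψ b‖ ^ 2 =
      ∑ b, p (if b c₁ && b c₂ then flipBit b t else b) * ‖ψ b‖ ^ 2 :=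
  sum_condFlip t (fun b => b c₁ && b c₂)
    (fun b => by simp only [flipBit_of_ne b h₁, flipBit_of_ne b h₂]) p ψ

theorem norm_inv_sqrt_two_mul_sq (z : ℂ) :
    ‖((Real.sqrt 2 : ℝ) : ℂ)⁻¹ * z‖ ^ 2 = ‖z‖ ^ 2 / 2 := by
  rw [norm_mul, mul_pow, norm_inv, inv_pow, Complex.norm_real, Real.norm_eq_abs, sq_abs,
    Real.sq_sqrt (by norm_num)]
  ring

theorem sum_eq_half_sum_flipBit (t : ι) (F : (ι → Bool) → ℝ) :
    ∑ b, F b = ∑ b, (F (Function.update b t false) + F (Function.update b t true)) / 2 := by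
  have h : ∀ b : ι → Bool, F (Function.update b t false) + F (Function.update b t true) =
      F b + F (flipBit b t) := by
    intro b
    rcases hb : b t
    · rw [flipBit, hb, ← hb, Function.update_eq_self, hb]; rfl
    · rw [flipBit, hb, ← hb, Function.update_eq_self, hb, add_comm]; rfl
  simp only [h]
  rw [← Finset.sum_div, Finset.sum_add_distrib, sum_flipBit]
  ring

theorem sum_hadamard (t : ι) (ψ : QState ι) :
    ∑ b, ‖(Gate.hadamard t).apply ψ b‖ ^ 2 = ∑ b, ‖ψ b‖ ^ 2 := by
  rw [sum_eq_half_sum_flipBit t, sum_eq_half_sum_flipBit t fun b => ‖ψ b‖ ^ 2]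
  refine Finset.sum_congr rfl fun b _ => ?_
  simp only [Gate.apply, Function.update_idem, Function.update_self, Bool.false_eq_true,
    if_false, if_true, norm_inv_sqrt_two_mul_sq, one_mul, neg_one_mul]
  have := parallelogram_law_with_norm ℂ (ψ (Function.update b t false))
    (ψ (Function.update b t true))
  rw [← sub_eq_add_neg]
  nlinarith

/-- The Hadamard gate applied to a qubit in the state 0. -/
theorem sum_hadamard_zero (t : ι) (p : (ι → Bool) → ℝ) (ψ : QState ι)
    (hψ : ∀ b, b t = true → ψ b = 0) :
    ∑ b, p b * ‖(Gate.hadamard t).apply ψ b‖ ^ 2 =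
      ∑ b, (p b + p (flipBit b t)) / 2 * ‖ψ b‖ ^ 2 := by
  rw [sum_eq_half_sum_flipBit t, sum_eq_half_sum_flipBit t
    fun b => (p b + p (flipBit b t)) / 2 * ‖ψ b‖ ^ 2]
  refine Finset.sum_congr rfl fun b _ => ?_
  have h₀ : ψ (Function.update b t true) = 0 := hψ _ (by simp)
  have h₁ : flipBit (Function.update b t false) t = Function.update b t true := by
    simp [flipBit]
  simp only [Gate.apply, Function.update_idem, Function.update_self, Bool.false_eq_true,
    if_false, if_true, norm_inv_sqrt_two_mul_sq, h₀, mul_zero, add_zero, norm_zero, h₁]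
  ring

theorem Gate.norm_apply (g : Gate ι) (ψ : QState ι) : ‖g.apply ψ‖ = ‖ψ‖ := by
  have key : ‖g.apply ψ‖ ^ 2 = ‖ψ‖ ^ 2 := by
    rw [EuclideanSpace.norm_sq_eq, EuclideanSpace.norm_sq_eq]
    cases g with
    | not t => simpa using sum_not t (fun _ => 1) ψ
    | hadamard t => exact sum_hadamard t ψ
    | phaseT t =>
      refine Finset.sum_congr rfl fun b _ => ?_
      simp only [Gate.apply, norm_mul]
      split
      · have : Complex.I * Real.pi / 4 = ((Real.pi / 4 : ℝ) : ℂ) * Complex.I := by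
          push_cast; ring
        rw [this, Complex.norm_exp_ofReal_mul_I, one_mul]
      · rw [norm_one, one_mul]
    | cnot c t h => simpa using sum_cnot c t h (fun _ => 1) ψ
    | toffoli c₁ c₂ t h₁₂ h₁ h₂ => simpa using sum_toffoli c₁ c₂ t h₁₂ h₁ h₂ (fun _ => 1) ψ
  exact (sq_eq_sq₀ (norm_nonneg _) (norm_nonneg _)).1 key

theorem norm_runGates (gs : List (Gate ι)) (ψ : QState ι) : ‖runGates gs ψ‖ = ‖ψ‖ := by
  induction gs generalizing ψ with
  | nil => rfl
  | cons g gs ih => rw [runGates_cons, ih, Gate.norm_apply]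

/-! ### Slices and projections -/

theorem update_extend (f : ι ↪ κ) (b : ι → Bool) (z : κ → Bool) (t : ι) (v : Bool) :
    Function.update (Function.extend f b z) (f t) v =
      Function.extend f (Function.update b t v) z := by
  funext x
  by_cases hx : ∃ i, f i = x
  · obtain ⟨i, rfl⟩ := hx
    rw [f.injective.extend_apply]
    by_cases hi : i = t
    · subst hi; simp
    · rw [Function.update_of_ne (f.injective.ne hi), Function.update_of_ne hi,
        f.injective.extend_apply]
  · have hx' : x ≠ f t := fun h => hx ⟨t, h.symm⟩
    rw [Function.update_of_ne hx', Function.extend_apply' _ _ _ hx,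
      Function.extend_apply' _ _ _ hx]

theorem flipBit_extend (f : ι ↪ κ) (b : ι → Bool) (z : κ → Bool) (t : ι) :
    flipBit (Function.extend f b z) (f t) = Function.extend f (flipBit b t) z := by
  rw [flipBit, f.injective.extend_apply, update_extend]; rfl

/-- The part of a state on the qubits in the range of `f`, when the other qubits are given by
`z`. -/
def slice (f : ι ↪ κ) (z : κ → Bool) (ψ : QState κ) : QState ι :=
  WithLp.toLp 2 fun b => ψ (Function.extend f b z)

/-- A relabelled gate neither reads nor changes qubits outside the range of `f`, so it acts on every
slice separately. -/
theorem slice_apply_map (f : ι ↪ κ) (z : κ → Bool) (g : Gate ι) (ψ : QState κ) :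
    slice f z ((g.map f).apply ψ) = g.apply (slice f z ψ) := by
  ext b
  cases g <;> simp only [slice, Gate.map, Gate.apply, flipBit_extend, update_extend,
    f.injective.extend_apply]

theorem slice_runGates (f : ι ↪ κ) (z : κ → Bool) (gs : List (Gate ι)) (ψ : QState κ) :
    slice f z (runGates (gs.map (Gate.map f)) ψ) = runGates gs (slice f z ψ) := by
  induction gs generalizing ψ with
  | nil => rfl
  | cons g gs ih => rw [List.map_cons, runGates_cons, ih, slice_apply_map]; rfl

/-- The bits of `z` in the range of `f` are overridden by `b`, so every string arises once for each
choice of them. Exchanging `b` with the overridden bits is an involution on the pairs. -/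
theorem sum_slice (f : ι ↪ κ) (F : (κ → Bool) → ℝ) :
    ∑ z : κ → Bool, ∑ b : ι → Bool, F (Function.extend f b z) =
      Fintype.card (ι → Bool) * ∑ b, F b := by
  have hinv : Function.Involutive fun p : (κ → Bool) × (ι → Bool) =>
      (Function.extend f p.2 p.1, fun i => p.1 (f i)) := by
    rintro ⟨z, b⟩
    refine Prod.ext ?_ ?_
    · funext x
      by_cases hx : ∃ i, f i = x
      · obtain ⟨i, rfl⟩ := hx
        exact f.injective.extend_apply _ _ _
      · change Function.extend f _ (Function.extend f b z) x = z x
        rw [Function.extend_apply' _ _ _ hx, Function.extend_apply' _ _ _ hx]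
    · funext i
      exact f.injective.extend_apply _ _ _
  have h := Equiv.sum_comp (hinv.toPerm _) fun p : (κ → Bool) × (ι → Bool) => F p.1
  rw [Fintype.sum_prod_type, Fintype.sum_prod_type] at h
  refine h.trans ?_
  simp [Finset.mul_sum]

/-- The projection onto the basis states with a given property. -/
def proj (D : (ι → Bool) → Prop) [DecidablePred D] (ψ : QState ι) : QState ι :=
  WithLp.toLp 2 fun b => if D b then ψ b else 0

theorem proj_apply_gate (D : (ι → Bool) → Prop) [DecidablePred D] (g : Gate ι)
    (hD : ∀ t ∈ g.operands, ∀ b v, D (Function.update b t v) ↔ D b) (ψ : QState ι) :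
    proj D (g.apply ψ) = g.apply (proj D ψ) := by
  ext b
  have hu : ∀ t ∈ g.operands, (∀ v, D (Function.update b t v) ↔ D b) ∧ (D (flipBit b t) ↔ D b) :=
    fun t ht => ⟨hD t ht b, hD t ht b _⟩
  by_cases h : D b <;> cases g with
  | not t => simp [proj, Gate.apply, h, hu t (by simp [Gate.operands])]
  | hadamard t => simp [proj, Gate.apply, h, hu t (by simp [Gate.operands])]
  | phaseT t => simp [proj, Gate.apply, h]
  | cnot c t => simp [proj, Gate.apply, h, hu t (by simp [Gate.operands])]
  | toffoli c₁ c₂ t => simp [proj, Gate.apply, h, hu t (by simp [Gate.operands])]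

theorem proj_runGates (D : (ι → Bool) → Prop) [DecidablePred D] (gs : List (Gate ι))
    (hD : ∀ t ∈ gs.flatMap Gate.operands, ∀ b v, D (Function.update b t v) ↔ D b)
    (ψ : QState ι) : proj D (runGates gs ψ) = runGates gs (proj D ψ) := by
  induction gs generalizing ψ with
  | nil => rfl
  | cons g gs ih =>
    rw [runGates_cons, ih, proj_apply_gate, ← runGates_cons]
    · exact fun t ht => hD t (by rw [List.flatMap_cons]; exact List.mem_append_left _ ht)
    · exact fun t ht => hD t (by rw [List.flatMap_cons]; exact List.mem_append_right _ ht)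

theorem proj_sub (D : (ι → Bool) → Prop) [DecidablePred D] (ψ χ : QState ι) :
    proj D (ψ - χ) = proj D ψ - proj D χ := by
  ext b
  simp only [proj, PiLp.sub_apply]
  split <;> simp

theorem norm_proj_le (D : (ι → Bool) → Prop) [DecidablePred D] (ψ : QState ι) :
    ‖proj D ψ‖ ≤ ‖ψ‖ := by
  refine (sq_le_sq₀ (norm_nonneg _) (norm_nonneg _)).1 ?_
  rw [EuclideanSpace.norm_sq_eq, EuclideanSpace.norm_sq_eq]
  refine Finset.sum_le_sum fun b _ => ?_
  simp only [proj]
  split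
  · rfl
  · simp

/-! ### Probabilities of acceptance and rejection -/

/-- The (unnormalised) probability that the output qubit `o` is 0 after the gates `gs`. -/
def rejW (o : ι) (gs : List (Gate ι)) (ψ : QState ι) : ℝ :=
  ‖proj (fun b => b o = false) (runGates gs ψ)‖ ^ 2

theorem rejW_eq (o : ι) (gs : List (Gate ι)) (ψ : QState ι) :
    rejW o gs ψ = ∑ b, if b o = false then ‖runGates gs ψ b‖ ^ 2 else 0 := by
  rw [rejW, EuclideanSpace.norm_sq_eq]
  refine Finset.sum_congr rfl fun b _ => ?_
  simp only [proj]
  split <;> simp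

theorem sum_accept (o : ι) (gs : List (Gate ι)) (ψ : QState ι) :
    (∑ b, if b o then ‖runGates gs ψ b‖ ^ 2 else 0) = ‖ψ‖ ^ 2 - rejW o gs ψ := by
  rw [eq_sub_iff_add_eq, rejW_eq, ← Finset.sum_add_distrib, ← norm_runGates gs ψ,
    EuclideanSpace.norm_sq_eq]
  refine Finset.sum_congr rfl fun b _ => ?_
  cases b o <;> simp

theorem rejW_nonneg (o : ι) (gs : List (Gate ι)) (ψ : QState ι) : 0 ≤ rejW o gs ψ := sq_nonneg _

/-- The square root is the norm of the image under a linear contraction, a unitary followed by a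
projection. This transfers rejection from a product state to the nearby symmetric part of the actual
state. -/
theorem sqrt_rejW_le (o : ι) (gs : List (Gate ι)) (ψ χ : QState ι) :
    Real.sqrt (rejW o gs ψ) ≤ Real.sqrt (rejW o gs χ) + ‖ψ - χ‖ := by
  rw [rejW, rejW, Real.sqrt_sq (norm_nonneg _), Real.sqrt_sq (norm_nonneg _)]
  have h : proj (fun b => b o = false) (runGates gs ψ) =
      proj (fun b => b o = false) (runGates gs χ) +
        proj (fun b => b o = false) (runGates gs (ψ - χ)) := by
    rw [runGates_sub, proj_sub]; abel
  rw [h]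
  refine (norm_add_le _ _).trans (add_le_add_right ?_ _)
  exact (norm_proj_le _ _).trans (norm_runGates _ _).le

theorem rejW_smul (o : ι) (gs : List (Gate ι)) (c : ℂ) (ψ : QState ι) :
    rejW o gs (c • ψ) = ‖c‖ ^ 2 * rejW o gs ψ := by
  simp only [rejW_eq, runGates_smul, PiLp.smul_apply, smul_eq_mul, norm_mul, mul_pow,
    Finset.mul_sum, mul_ite, mul_zero]

theorem sum_rejW_slice (f : ι ↪ κ) (o : ι) (gs : List (Gate ι)) (ψ : QState κ) :
    ∑ z, rejW o gs (slice f z ψ) =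
      Fintype.card (ι → Bool) * rejW (f o) (gs.map (Gate.map f)) ψ := by
  rw [rejW_eq, ← sum_slice f]
  refine Finset.sum_congr rfl fun z _ => ?_
  rw [rejW_eq]
  refine Finset.sum_congr rfl fun b _ => ?_
  rw [← slice_runGates, f.injective.extend_apply]
  rfl

theorem sum_norm_slice (f : ι ↪ κ) (ψ : QState κ) :
    ∑ z, ‖slice f z ψ‖ ^ 2 = Fintype.card (ι → Bool) * ‖ψ‖ ^ 2 := by
  rw [EuclideanSpace.norm_sq_eq, ← sum_slice f]
  refine Finset.sum_congr rfl fun z _ => ?_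
  rw [EuclideanSpace.norm_sq_eq]
  rfl

/-- Both sides are sums over the slices with the same multiplicity, which cancels. -/
theorem le_rejW_of_slice (f : ι ↪ κ) (o : ι) (gs : List (Gate ι)) (ψ : QState κ) (δ : ℝ)
    (h : ∀ z, δ * ‖slice f z ψ‖ ^ 2 ≤ rejW o gs (slice f z ψ)) :
    δ * ‖ψ‖ ^ 2 ≤ rejW (f o) (gs.map (Gate.map f)) ψ := by
  have hs := Finset.sum_le_sum fun z (_ : z ∈ Finset.univ) => h z
  rw [← Finset.mul_sum, sum_norm_slice, sum_rejW_slice, mul_left_comm] at hs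
  exact le_of_mul_le_mul_left hs (by exact_mod_cast Fintype.card_pos)

theorem rejW_le_of_slice (f : ι ↪ κ) (o : ι) (gs : List (Gate ι)) (ψ : QState κ) (ε : ℝ)
    (h : ∀ z, rejW o gs (slice f z ψ) ≤ ε * ‖slice f z ψ‖ ^ 2) :
    rejW (f o) (gs.map (Gate.map f)) ψ ≤ ε * ‖ψ‖ ^ 2 := by
  have hs := Finset.sum_le_sum fun z (_ : z ∈ Finset.univ) => h z
  rw [← Finset.mul_sum, sum_norm_slice, sum_rejW_slice, mul_left_comm ε] at hs
  exact le_of_mul_le_mul_left hs (by exact_mod_cast Fintype.card_pos)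

/-- The projection onto the basis states given by `y` on the qubits outside `T`. -/
def fixOff (T : List ι) (y : {q // q ∉ T} → Bool) : QState ι → QState ι :=
  proj fun b => (fun q : {q // q ∉ T} => b q) = y

theorem sum_norm_fixOff (T : List ι) (ψ : QState ι) :
    ∑ y, ‖fixOff T y ψ‖ ^ 2 = ‖ψ‖ ^ 2 := by
  simp only [EuclideanSpace.norm_sq_eq]
  rw [Finset.sum_comm]
  refine Finset.sum_congr rfl fun b _ => ?_
  simp only [fixOff, proj]
  rw [Finset.sum_eq_single (fun q : {q // q ∉ T} => b q)]
  · simp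
  · intro y _ hy
    simp [hy.symm]
  · simp

theorem runGates_fixOff (gs : List (Gate ι)) (y : {q // q ∉ gs.flatMap Gate.operands} → Bool)
    (ψ : QState ι) : runGates gs (fixOff _ y ψ) = fixOff _ y (runGates gs ψ) := by
  refine (proj_runGates _ gs (fun t ht b v => ?_) ψ).symm
  have : (fun q : {q // q ∉ gs.flatMap Gate.operands} => Function.update b t v q) =
      fun q : {q // q ∉ gs.flatMap Gate.operands} => b q := by
    funext q
    exact Function.update_of_ne (fun h : (q : ι) = t => q.2 (by rw [h]; exact ht)) _ _
  rw [this]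

/-- Measuring the untouched qubits before the circuit has no effect on the output: fixing them
commutes with the gates and with the projection of the output qubit, and the squared norms of the
pieces add up. -/
theorem sum_rejW_fixOff (o : ι) (gs : List (Gate ι)) (ψ : QState ι) :
    ∑ y, rejW o gs (fixOff (gs.flatMap Gate.operands) y ψ) = rejW o gs ψ := by
  simp only [rejW, runGates_fixOff]
  rw [← sum_norm_fixOff (gs.flatMap Gate.operands) (proj _ (runGates gs ψ))]
  refine Finset.sum_congr rfl fun y _ => ?_
  congr 2
  ext b
  simp only [fixOff, proj]
  split <;> split <;> rfl

theorem le_rejW_of_fixOff (o : ι) (gs : List (Gate ι)) (ψ : QState ι) (δ : ℝ)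
    (h : ∀ y, δ * ‖fixOff (gs.flatMap Gate.operands) y ψ‖ ^ 2 ≤
      rejW o gs (fixOff (gs.flatMap Gate.operands) y ψ)) :
    δ * ‖ψ‖ ^ 2 ≤ rejW o gs ψ := by
  have hs := Finset.sum_le_sum fun y (_ : y ∈ Finset.univ) => h y
  rwa [← Finset.mul_sum, sum_norm_fixOff, sum_rejW_fixOff] at hs

/-- If every nonzero piece had a larger ratio of rejection, so would their sum. -/
theorem exists_fixOff_rejW_le (o : ι) (gs : List (Gate ι)) (ψ : QState ι) (hψ : ψ ≠ 0) (ε : ℝ)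
    (h : rejW o gs ψ ≤ ε * ‖ψ‖ ^ 2) :
    ∃ y, fixOff (gs.flatMap Gate.operands) y ψ ≠ 0 ∧
      rejW o gs (fixOff (gs.flatMap Gate.operands) y ψ) ≤
        ε * ‖fixOff (gs.flatMap Gate.operands) y ψ‖ ^ 2 := by
  by_contra! hcon
  have hle : ∀ y, ε * ‖fixOff (gs.flatMap Gate.operands) y ψ‖ ^ 2 ≤
      rejW o gs (fixOff (gs.flatMap Gate.operands) y ψ) := by
    intro y
    by_cases hy : fixOff (gs.flatMap Gate.operands) y ψ = 0
    · rw [hy]; simpa using rejW_nonneg o gs 0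
    · exact (hcon y hy).le
  obtain ⟨y, hy⟩ : ∃ y, fixOff (gs.flatMap Gate.operands) y ψ ≠ 0 := by
    by_contra! h0
    have := sum_norm_fixOff (gs.flatMap Gate.operands) ψ
    simp only [h0, norm_zero, ne_eq, OfNat.ofNat_ne_zero, not_false_eq_true, zero_pow,
      Finset.sum_const_zero] at this
    exact hψ (norm_eq_zero.1 (eq_zero_of_pow_eq_zero this.symm))
  have hlt := Finset.sum_lt_sum (fun y (_ : y ∈ Finset.univ) => hle y)
    ⟨y, Finset.mem_univ _, hcon y hy⟩
  rw [← Finset.mul_sum, sum_norm_fixOff, sum_rejW_fixOff] at hlt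
  exact absurd h (not_le.2 hlt)

end Gates

/-! ### The swap test -/

section Swap

variable {ι : Type} [Fintype ι] [DecidableEq ι]

/-- Three controlled-nots in alternating directions make a swap; the Toffoli gates add the control.
-/
theorem runGates_cswapGates (c x y : ι) (hx : c ≠ x) (hy : c ≠ y) (hxy : x ≠ y) (ψ : QState ι)
    (b : ι → Bool) :
    runGates (cswapGates c x y hx hy hxy) ψ b = if b c then ψ (b ∘ Equiv.swap x y) else ψ b := by
  have hyx := hxy.symm
  by_cases hc : b c
  · have h : ∀ b' : ι → Bool, b' = b ∘ Equiv.swap x y → ψ b' = ψ (b ∘ Equiv.swap x y) :=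
      fun b' h => by rw [h]
    rcases hbx : b x <;> rcases hby : b y <;>
      simp [cswapGates, runGates, Gate.apply, flipBit, hc, hbx, hby, hx, hy, hxy, hyx] <;>
      refine h _ ?_ <;> funext q <;> by_cases hqx : q = x <;> by_cases hqy : q = y <;>
      simp_all [Function.update_apply, Equiv.swap_apply_def]
  · simp [cswapGates, runGates, Gate.apply, flipBit, hc, hx, hy]

end Swap

/-! ### Witness states with the work space in the state 0 -/

section Embed

variable {qV k qM : ℕ}

/-- The state of all qubits, when the work space is in the state 0. -/
def embed (Ψ : QState (Fin k × Fin qM)) : QState (Qubit qV k qM) :=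
  WithLp.toLp 2 fun b => if ∀ a, b (.inl a) = false then Ψ fun w => b (.inr w) else 0

/-- The product of the states of the witness spaces. -/
def prodState {I J : Type} [Fintype I] [Fintype J] (φ : I → QState J) : QState (I × J) :=
  WithLp.toLp 2 fun w => ∏ i, φ i fun j => w (i, j)

theorem initialState_eq (φ : Fin k → QState (Fin qM)) :
    (initialState φ : QState (Qubit qV k qM)) = embed (prodState φ) := by
  ext b
  simp [initialState, embed, prodState]

theorem embed_sub (Ψ Φ : QState (Fin k × Fin qM)) :
    (embed (Ψ - Φ) : QState (Qubit qV k qM)) = embed Ψ - embed Φ := by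
  ext b
  simp only [embed, PiLp.sub_apply]
  split <;> simp

theorem norm_embed (Ψ : QState (Fin k × Fin qM)) :
    ‖(embed Ψ : QState (Qubit qV k qM))‖ = ‖Ψ‖ := by
  refine (sq_eq_sq₀ (norm_nonneg _) (norm_nonneg _)).1 ?_
  rw [EuclideanSpace.norm_sq_eq, EuclideanSpace.norm_sq_eq,
    ← Equiv.sum_comp (Equiv.sumArrowEquivProdArrow (Fin qV) (Fin k × Fin qM) Bool).symm,
    Fintype.sum_prod_type, Finset.sum_eq_single fun _ => false]
  · simp [embed]
  · intro u _ hu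
    have : ¬ ∀ a, u a = false := fun h => hu (funext h)
    simp [embed, this]
  · simp

end Embed

/-! ### The swap test circuit and the acceptance probability of the merged circuit -/

section Merge

variable {qV k r qM : ℕ}

/-- The permutation of the qubits that the controlled swaps perform if the control is 1. -/
def swapPerm (l : List (Fin k × Fin qM)) : Equiv.Perm (Qubit (qV + 4) (2 * k + r) (2 * qM)) :=
  l.foldr (fun p π => π * Equiv.swap (swapFst p.1 p.2) (swapSnd p.1 p.2)) 1

theorem swapPerm_ancilla (l : List (Fin k × Fin qM)) (a : Fin (qV + 4)) :
    (swapPerm l : Equiv.Perm (Qubit (qV + 4) (2 * k + r) (2 * qM))) (.inl a) = .inl a := by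
  induction l with
  | nil => rfl
  | cons p l ih =>
    change swapPerm l (Equiv.swap _ _ _) = _
    rw [Equiv.swap_apply_of_ne_of_ne (by simp [swapFst]) (by simp [swapSnd]), ih]

theorem runGates_swapGates (l : List (Fin k × Fin qM))
    (ψ : QState (Qubit (qV + 4) (2 * k + r) (2 * qM)))
    (b : Qubit (qV + 4) (2 * k + r) (2 * qM) → Bool) :
    runGates (swapGates l) ψ b = if b (ancilla 0) then ψ (b ∘ swapPerm l) else ψ b := by
  induction l generalizing ψ with
  | nil => simp [swapGates, runGates, swapPerm]
  | cons p l ih =>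
    have h : swapGates (p :: l) = cswapGates (ancilla 0) (swapFst p.1 p.2) (swapSnd p.1 p.2)
      (ancilla_ne_swapFst _ _ _) (ancilla_ne_swapSnd _ _ _) (swapFst_ne_swapSnd _ _ _ _) ++
        swapGates (qV := qV) (r := r) l := rfl
    rw [h, runGates_append, ih, runGates_cswapGates, runGates_cswapGates]
    have h₁ : (b ∘ swapPerm l) (ancilla 0) = b (ancilla 0) :=
      congrArg b (swapPerm_ancilla l _)
    rw [h₁]
    split
    · rfl
    · rfl

theorem swapFst_inj {a a' : Fin k} {j j' : Fin qM}
    (h : (swapFst a j : Qubit (qV + 4) (2 * k + r) (2 * qM)) = swapFst a' j') :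
    (a, j) = (a', j') := by
  simp only [swapFst, Sum.inr.injEq, Prod.mk.injEq, Fin.mk.injEq] at h
  exact Prod.ext (Fin.ext (by dsimp only; omega)) (Fin.ext (by dsimp only; omega))

theorem swapSnd_inj {a a' : Fin k} {j j' : Fin qM}
    (h : (swapSnd a j : Qubit (qV + 4) (2 * k + r) (2 * qM)) = swapSnd a' j') :
    (a, j) = (a', j') := by
  simp only [swapSnd, Sum.inr.injEq, Prod.mk.injEq, Fin.mk.injEq] at h
  exact Prod.ext (Fin.ext (by dsimp only; omega)) (Fin.ext (by dsimp only; omega))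

theorem swapPerm_of_ne (l : List (Fin k × Fin qM)) (q : Qubit (qV + 4) (2 * k + r) (2 * qM))
    (h : ∀ p ∈ l, q ≠ swapFst p.1 p.2 ∧ q ≠ swapSnd p.1 p.2) : swapPerm l q = q := by
  induction l with
  | nil => rfl
  | cons p l ih =>
    change swapPerm l (Equiv.swap _ _ _) = _
    rw [Equiv.swap_apply_of_ne_of_ne (h p (by simp)).1 (h p (by simp)).2]
    exact ih fun p hp => h p (by simp [hp])

theorem swapPerm_swapFst {l : List (Fin k × Fin qM)} (hl : l.Nodup) (a : Fin k) (j : Fin qM)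
    (h : (a, j) ∈ l) :
    (swapPerm l : Equiv.Perm (Qubit (qV + 4) (2 * k + r) (2 * qM))) (swapFst a j) =
      swapSnd a j := by
  induction l with
  | nil => simp at h
  | cons p l ih =>
    change swapPerm l (Equiv.swap _ _ _) = _
    rw [List.nodup_cons] at hl
    by_cases hp : (a, j) = p
    · subst hp
      rw [Equiv.swap_apply_left]
      refine swapPerm_of_ne l _ fun p hp => ⟨(swapFst_ne_swapSnd _ _ _ _).symm, fun h' => ?_⟩
      rw [swapSnd_inj h'] at hl
      exact hl.1 hp
    · rw [Equiv.swap_apply_of_ne_of_ne (fun h' => hp (swapFst_inj h')) (swapFst_ne_swapSnd _ _ _ _)]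
      exact ih hl.2 ((List.mem_cons.1 h).resolve_left hp)

theorem swapPerm_swapSnd {l : List (Fin k × Fin qM)} (hl : l.Nodup) (a : Fin k) (j : Fin qM)
    (h : (a, j) ∈ l) :
    (swapPerm l : Equiv.Perm (Qubit (qV + 4) (2 * k + r) (2 * qM))) (swapSnd a j) =
      swapFst a j := by
  induction l with
  | nil => simp at h
  | cons p l ih =>
    change swapPerm l (Equiv.swap _ _ _) = _
    rw [List.nodup_cons] at hl
    by_cases hp : (a, j) = p
    · subst hp
      rw [Equiv.swap_apply_right]
      refine swapPerm_of_ne l _ fun p hp => ⟨fun h' => ?_, swapFst_ne_swapSnd _ _ _ _⟩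
      rw [swapFst_inj h'] at hl
      exact hl.1 hp
    · rw [Equiv.swap_apply_of_ne_of_ne (swapFst_ne_swapSnd _ _ _ _).symm
        (fun h' => hp (swapSnd_inj h'))]
      exact ih hl.2 ((List.mem_cons.1 h).resolve_left hp)

theorem Circuit.mem_swapPairs (C : Circuit qV (3 * k + r) qM) (a : Fin k) (j : Fin qM) :
    (a, j) ∈ C.swapPairs ↔ (a : ℕ) < C.groupBound r ∧ (j : ℕ) < posBound C.touched := by
  simp only [swapPairs, List.mem_flatMap, List.mem_map, List.mem_finRange, true_and]
  constructor
  · rintro ⟨a', j', h⟩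
    obtain ⟨rfl, rfl⟩ := Prod.mk.inj h
    exact ⟨a'.2, j'.2⟩
  · rintro ⟨ha, hj⟩
    exact ⟨⟨a, ha⟩, ⟨j, hj⟩, rfl⟩

theorem Circuit.nodup_swapPairs (C : Circuit qV (3 * k + r) qM) : C.swapPairs.Nodup := by
  refine List.nodup_flatMap.2 ⟨fun a _ => ?_, ?_⟩
  · refine (List.nodup_finRange _).map fun j j' h => ?_
    exact Fin.castLE_injective _ (Prod.mk.inj h).2
  · refine (List.nodup_finRange _).imp fun {a a'} h => ?_
    simp only [Function.onFun, List.disjoint_left, List.mem_map, not_exists]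
    rintro _ ⟨j, _, rfl⟩ j' ⟨_, h'⟩
    exact h (Fin.ext (congrArg Fin.val (Prod.mk.inj h').1).symm)

/-- The state with the qubits relabelled. -/
def permState {ι : Type} [Fintype ι] (π : ι → ι) (Ψ : QState ι) : QState ι :=
  WithLp.toLp 2 fun w => Ψ (w ∘ π)

/-- The projection of a state to one of the two outcomes of the swap test. -/
def swapPart {ι : Type} [Fintype ι] (π : ι → ι) (s : ℂ) (Ψ : QState ι) : QState ι :=
  (2⁻¹ : ℂ) • (Ψ + s • permState π Ψ)

/-- A rejection by the given circuit counts only for one of the two equally likely values of the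
coin, hence the weight 1/2. Ancilla 0 must be 0, that is, the swap test must have succeeded. -/
theorem sum_outputGates (o : Fin qV) (ψ : QState (Qubit (qV + 4) (2 * k + r) (2 * qM)))
    (hψ : ∀ b, ¬ (b (ancilla 1) = false ∧ b (ancilla 2) = false ∧ b (ancilla 3) = false) →
      ψ b = 0) :
    (∑ b, if b (ancilla 3) then ‖runGates (outputGates o) ψ b‖ ^ 2 else 0) =
      ∑ b, (if b (ancilla 0) = false then (if b (mergeQubit (.inl o)) = false then 1 / 2 else 1)
        else 0) * ‖ψ b‖ ^ 2 := by
  have h01 : (ancilla 0 : Qubit (qV + 4) (2 * k + r) (2 * qM)) ≠ ancilla 1 :=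
    ancilla_injective.ne (by decide)
  have h02 : (ancilla 0 : Qubit (qV + 4) (2 * k + r) (2 * qM)) ≠ ancilla 2 :=
    ancilla_injective.ne (by decide)
  have h03 : (ancilla 0 : Qubit (qV + 4) (2 * k + r) (2 * qM)) ≠ ancilla 3 :=
    ancilla_injective.ne (by decide)
  have h12 : (ancilla 1 : Qubit (qV + 4) (2 * k + r) (2 * qM)) ≠ ancilla 2 :=
    ancilla_injective.ne (by decide)
  have h13 : (ancilla 1 : Qubit (qV + 4) (2 * k + r) (2 * qM)) ≠ ancilla 3 :=
    ancilla_injective.ne (by decide)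
  have h23 : (ancilla 2 : Qubit (qV + 4) (2 * k + r) (2 * qM)) ≠ ancilla 3 :=
    ancilla_injective.ne (by decide)
  have hq := mergeQubit_ne_ancilla (k := k) (r := r) (qM := qM) (.inl o)
  have h : ∀ b, (if b (ancilla 3) then ‖runGates (outputGates o) ψ b‖ ^ 2 else 0) =
      (if b (ancilla 3) then 1 else 0) * ‖runGates (outputGates o) ψ b‖ ^ 2 := by
    intro b; split <;> simp
  rw [Finset.sum_congr rfl fun b _ => h b]
  simp only [outputGates, runGates_cons]
  simp only [runGates, List.foldl_nil]
  rw [sum_toffoli, sum_not _ _ , sum_not, sum_toffoli, sum_not, sum_hadamard_zero]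
  · refine Finset.sum_congr rfl fun b _ => ?_
    by_cases hb : b (ancilla 1) = false ∧ b (ancilla 2) = false ∧ b (ancilla 3) = false
    · obtain ⟨h1, h2, h3⟩ := hb
      congr 1
      rcases hb0 : b (ancilla 0) <;> rcases hbq : b (mergeQubit (.inl o)) <;>
      simp [flipBit, h01, h02, h03, h12, h13, h23, h01.symm, h02.symm, h03.symm, h12.symm,
        h13.symm, h23.symm, hq, (hq _).symm, h1, h2, h3, hb0, hbq]
    · rw [hψ b hb]; simp
  · intro b hb
    exact hψ b (by simp [hb])

/-- The state after the swap test, before the given circuit is run. -/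
def swapTestState (π : Fin (2 * k + r) × Fin (2 * qM) → Fin (2 * k + r) × Fin (2 * qM))
    (Ψ : QState (Fin (2 * k + r) × Fin (2 * qM))) :
    QState (Qubit (qV + 4) (2 * k + r) (2 * qM)) :=
  WithLp.toLp 2 fun b => if ∀ a, Sum.inl a ≠ (ancilla 0 : Qubit (qV + 4) (2 * k + r) (2 * qM)) →
      b (.inl a) = false then
    swapPart π (if b (ancilla 0) then -1 else 1) Ψ (fun w => b (.inr w)) else 0

/-- The first Hadamard gate superposes both values of the control, the swaps act in the branch 1,
and the second Hadamard gate forms the sum of the branches at control 0 and their difference at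
control 1. -/
theorem runGates_swapTest (l : List (Fin k × Fin qM))
    (π : Fin (2 * k + r) × Fin (2 * qM) → Fin (2 * k + r) × Fin (2 * qM))
    (hπ : ∀ w, (swapPerm l : Equiv.Perm (Qubit (qV + 4) (2 * k + r) (2 * qM))) (.inr w) =
      .inr (π w))
    (Ψ : QState (Fin (2 * k + r) × Fin (2 * qM))) :
    runGates (.hadamard (ancilla 0) :: (swapGates l ++ [.hadamard (ancilla 0)])) (embed Ψ) =
      (swapTestState π Ψ : QState (Qubit (qV + 4) (2 * k + r) (2 * qM))) := by
  have hs : ((Real.sqrt 2 : ℝ) : ℂ)⁻¹ * ((Real.sqrt 2 : ℝ) : ℂ)⁻¹ = 2⁻¹ := by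
    rw [← mul_inv, ← Complex.ofReal_mul, Real.mul_self_sqrt (by norm_num)]
    norm_num
  have h₁ : (Gate.hadamard (ancilla 0)).apply (embed Ψ) =
      (WithLp.toLp 2 fun b => if ∀ a, Sum.inl a ≠
        (ancilla 0 : Qubit (qV + 4) (2 * k + r) (2 * qM)) → b (.inl a) = false then
        ((Real.sqrt 2 : ℝ) : ℂ)⁻¹ * Ψ (fun w => b (.inr w)) else 0 :
        QState (Qubit (qV + 4) (2 * k + r) (2 * qM))) := by
    ext b
    have hz : ¬ ∀ a, Function.update b (ancilla 0) true (.inl a) = false := fun h => by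
      have := h ⟨0, by omega⟩
      simp [ancilla] at this
    have ho : (∀ a, Function.update b (ancilla 0) false (.inl a) = false) ↔
        ∀ a, Sum.inl a ≠ (ancilla 0 : Qubit (qV + 4) (2 * k + r) (2 * qM)) →
          b (.inl a) = false := by
      refine forall_congr' fun a => ?_
      by_cases ha : Sum.inl a = (ancilla 0 : Qubit (qV + 4) (2 * k + r) (2 * qM))
      · simp [ha]
      · simp [ha, Function.update_of_ne ha]
    have hw : (fun w => Function.update b (ancilla 0) false (.inr w)) = fun w => b (.inr w) := by
      funext w
      exact Function.update_of_ne (by simp [ancilla]) _ _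
    simp only [Gate.apply, embed]
    rw [if_neg hz, hw]
    simp only [ho, mul_zero, add_zero, mul_ite]
  rw [runGates_cons, runGates_append, h₁]
  ext b
  have ho : ∀ v, (∀ a, Sum.inl a ≠ (ancilla 0 : Qubit (qV + 4) (2 * k + r) (2 * qM)) →
      Function.update b (ancilla 0) v (.inl a) = false) ↔
      ∀ a, Sum.inl a ≠ (ancilla 0 : Qubit (qV + 4) (2 * k + r) (2 * qM)) →
        b (.inl a) = false := by
    intro v
    refine forall₂_congr fun a ha => ?_
    rw [Function.update_of_ne ha]
  have hw : ∀ v w, Function.update b (ancilla 0) v (.inr w) = b (.inr w) :=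
    fun v w => Function.update_of_ne (by simp [ancilla]) _ _
  simp only [runGates_cons, Gate.apply]
  simp only [runGates, List.foldl_nil]
  change _ * (runGates _ _ _ + _ * runGates _ _ _) = _
  rw [runGates_swapGates, runGates_swapGates]
  simp only [Function.update_self, Bool.false_eq_true, if_false, if_true, Function.comp_apply,
    swapPerm_ancilla, ho, hw, hπ, swapTestState, swapPart, permState, PiLp.smul_apply,
    PiLp.add_apply, smul_eq_mul]
  by_cases hb : ∀ a, Sum.inl a ≠ (ancilla 0 : Qubit (qV + 4) (2 * k + r) (2 * qM)) →
      b (.inl a) = false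
  · simp only [if_pos hb, ← hs]
    change _ = _ * (_ + _ * Ψ fun w => b (.inr (π w)))
    split <;> ring
  · simp only [if_neg hb, mul_zero, add_zero]

/-- The gates of `C` touch no ancilla. Hence ancillas 1, 2 and 3 are still 0 when the output gates
begin, and the projection onto ancilla 0 being 0 can be moved before `C`, where it leaves `swapPart
π 1`. Of this part, what `C` rejects counts half. -/
theorem Circuit.merge_acceptProb (C : Circuit qV (3 * k + r) qM)
    (π : Fin (2 * k + r) × Fin (2 * qM) → Fin (2 * k + r) × Fin (2 * qM))
    (hπ : ∀ w, (swapPerm C.swapPairs : Equiv.Perm (Qubit (qV + 4) (2 * k + r) (2 * qM)))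
      (.inr w) = .inr (π w))
    (φ : Fin (2 * k + r) → QState (Fin (2 * qM))) :
    C.merge.acceptProb φ = ‖swapPart π 1 (prodState φ)‖ ^ 2 -
      rejW (mergeQubit (.inl C.output)) (C.gates.map (Gate.map mergeQubit))
        (embed (swapPart π 1 (prodState φ)) :
          QState (Qubit (qV + 4) (2 * k + r) (2 * qM))) / 2 := by
  set Ψ := prodState φ
  set gs : List (Gate (Qubit (qV + 4) (2 * k + r) (2 * qM))) :=
    C.gates.map (Gate.map mergeQubit) with hgs
  have hrun : C.merge.run (initialState φ) =
      runGates (outputGates C.output) (runGates gs (swapTestState π Ψ)) := by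
    rw [initialState_eq, ← runGates_swapTest C.swapPairs π hπ, ← runGates_append,
      ← runGates_append]
    simp [run, merge, runGates, hgs, Ψ]
  have hanc : ∀ m : Fin 4, ∀ t ∈ gs.flatMap Gate.operands, t ≠ ancilla m := by
    intro m t ht
    simp only [hgs, List.mem_flatMap, List.mem_map] at ht
    obtain ⟨_, ⟨g, _, rfl⟩, ht⟩ := ht
    cases g <;> simp only [Gate.map, Gate.operands, List.mem_cons, List.not_mem_nil,
      or_false] at ht <;> rcases ht with rfl | rfl | rfl <;> exact mergeQubit_ne_ancilla _ _
  have hψ : ∀ b, ¬ (b (ancilla 1) = false ∧ b (ancilla 2) = false ∧ b (ancilla 3) = false) →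
      runGates gs (swapTestState π Ψ) b = 0 := by
    intro b hb
    have hp : proj (fun b => b (ancilla 1) = false ∧ b (ancilla 2) = false ∧
        b (ancilla 3) = false) (swapTestState π Ψ) =
          (swapTestState π Ψ : QState (Qubit (qV + 4) (2 * k + r) (2 * qM))) := by
      ext b
      simp only [proj, swapTestState]
      split
      · rfl
      · next h =>
        rw [if_neg]
        intro h'
        refine h ⟨h' _ ?_, h' _ ?_, h' _ ?_⟩ <;> simp [ancilla]
    rw [← hp, ← proj_runGates]
    · simp [proj, hb]
    · intro t ht b v
      simp only [Function.update_of_ne (hanc _ t ht).symm]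
  have hproj : proj (fun b => b (ancilla 0) = false) (swapTestState π Ψ) =
      (embed (swapPart π 1 Ψ) : QState (Qubit (qV + 4) (2 * k + r) (2 * qM))) := by
    ext b
    simp only [proj, swapTestState, embed]
    by_cases hb : b (ancilla 0) = false
    · rw [if_pos hb]
      have : (∀ a, Sum.inl a ≠ (ancilla 0 : Qubit (qV + 4) (2 * k + r) (2 * qM)) →
          b (.inl a) = false) ↔ ∀ a, b (.inl a) = false := by
        refine forall_congr' fun a => ⟨fun h => ?_, fun h _ => h⟩
        by_cases ha : Sum.inl a = (ancilla 0 : Qubit (qV + 4) (2 * k + r) (2 * qM))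
        · rw [ha, hb]
        · exact h ha
      simp only [this, hb, Bool.false_eq_true, if_false]
    · rw [if_neg hb, if_neg fun h => hb (h _)]
  have hacc : C.merge.acceptProb φ = ∑ b, if b (ancilla 3) then
      ‖runGates (outputGates C.output) (runGates gs (swapTestState π Ψ)) b‖ ^ 2 else 0 := by
    rw [acceptProb, hrun]
    rfl
  rw [hacc, sum_outputGates _ _ hψ, ← norm_embed (qV := qV + 4), ← hproj, rejW, ← proj_runGates]
  · rw [← norm_runGates gs (proj _ _), ← proj_runGates, EuclideanSpace.norm_sq_eq,
      EuclideanSpace.norm_sq_eq, Finset.sum_div, ← Finset.sum_sub_distrib]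
    · refine Finset.sum_congr rfl fun b _ => ?_
      simp only [proj]
      split <;> split <;> simp <;> ring
    · intro t ht b v
      simp only [Function.update_of_ne (hanc _ t ht).symm]
  · intro t ht b v
    simp only [Function.update_of_ne (hanc _ t ht).symm]

end Merge

open scoped ComplexConjugate

/-! ### Overlaps of product states -/

section Overlap

variable {X Y : Type} [Fintype X] [Fintype Y]

theorem inner_eq_sum (x y : EuclideanSpace ℂ X) : inner ℂ x y = ∑ i, conj (x i) * y i := by
  rw [PiLp.inner_apply]
  exact Finset.sum_congr rfl fun i _ => by rw [RCLike.inner_apply, mul_comm]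

theorem exists_smul_norm_eq_one {E : Type} [NormedAddCommGroup E] [InnerProductSpace ℂ E]
    [Nontrivial E] (w : E) : ∃ v : E, ‖v‖ = 1 ∧ inner ℂ v w = (‖w‖ : ℂ) := by
  by_cases hw : w = 0
  · obtain ⟨v, hv⟩ := exists_norm_eq E zero_le_one
    exact ⟨v, hv, by simp [hw]⟩
  · have hw' : (‖w‖ : ℂ) ≠ 0 := by simpa using hw
    refine ⟨((‖w‖ : ℂ)⁻¹) • w, norm_smul_inv_norm hw, ?_⟩
    rw [inner_smul_left, inner_self_eq_norm_sq_to_K, map_inv₀, Complex.conj_ofReal]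
    change (‖w‖ : ℂ)⁻¹ * (‖w‖ : ℂ) ^ 2 = _
    field_simp

/-- The overlap of two bipartite pure states when their first components are exchanged. -/
def pairOverlap (m n : X × Y → ℂ) : ℝ := ∑ y, ∑ y', ‖∑ x, conj (m (x, y)) * n (x, y')‖ ^ 2

theorem pairOverlap_comm (m n : X × Y → ℂ) : pairOverlap m n = pairOverlap n m := by
  unfold pairOverlap
  rw [Finset.sum_comm]
  refine Finset.sum_congr rfl fun y _ => Finset.sum_congr rfl fun y' _ => ?_
  rw [← Complex.norm_conj, map_sum]
  simp only [map_mul, Complex.conj_conj, mul_comm]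

theorem pairOverlap_nonneg (m n : X × Y → ℂ) : 0 ≤ pairOverlap m n :=
  Finset.sum_nonneg fun _ _ => Finset.sum_nonneg fun _ _ => sq_nonneg _

/-- The left side is the expectation, in the state m ⊗ n, of the exchange of the first components.
Grouped by the second components it is a sum of squared moduli, the trace of the product of the
reduced states on `X`. -/
theorem sum_exchange (m n : X × Y → ℂ) :
    ∑ p : X × Y, ∑ q : X × Y, (conj (m p) * conj (n q)) * (m (q.1, p.2) * n (p.1, q.2)) =
      (pairOverlap m n : ℂ) := by
  have h : ∀ y y', ((‖∑ x, conj (m (x, y)) * n (x, y')‖ ^ 2 : ℝ) : ℂ) =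
      ∑ x, ∑ x', (conj (m (x, y)) * conj (n (x', y'))) * (m (x', y) * n (x, y')) := by
    intro y y'
    rw [Complex.ofReal_pow, ← Complex.mul_conj', map_sum, Finset.sum_mul_sum]
    refine Finset.sum_congr rfl fun x _ => Finset.sum_congr rfl fun x' _ => ?_
    rw [map_mul, Complex.conj_conj]
    ring
  rw [pairOverlap]
  rw [Complex.ofReal_sum, Fintype.sum_prod_type_right]
  refine Finset.sum_congr rfl fun y _ => ?_
  rw [Complex.ofReal_sum]
  simp only [h, Fintype.sum_prod_type_right (α₁ := X)]
  rw [Finset.sum_comm]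

/-- If two pure states have a large overlap when their first components are exchanged, then the
first state is close to a product state. -/
theorem exists_product_overlap [Nonempty X] [Nonempty Y] (m n : X × Y → ℂ)
    (hn : ∑ p, ‖n p‖ ^ 2 = 1) :
    ∃ (u : EuclideanSpace ℂ X) (v : EuclideanSpace ℂ Y) (c : ℝ), ‖u‖ = 1 ∧ ‖v‖ = 1 ∧ 0 ≤ c ∧
      pairOverlap m n ≤ c ^ 2 ∧ ∑ p : X × Y, conj (u p.1 * v p.2) * m p = c := by
  let col : Y → EuclideanSpace ℂ X := fun y' => WithLp.toLp 2 fun x => n (x, y')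
  have hcol : ∑ y', ‖col y'‖ ^ 2 = 1 := by
    rw [← hn, Fintype.sum_prod_type_right]
    exact Finset.sum_congr rfl fun y' _ => EuclideanSpace.norm_sq_eq _
  -- Takes the place of an eigenvector for the largest eigenvalue: the squared norms of the columns
  -- of `n` sum to 1, so some nonzero column does at least as well as the average.
  obtain ⟨y', hy'0, hy'⟩ : ∃ y', col y' ≠ 0 ∧ pairOverlap m n * ‖col y'‖ ^ 2 ≤
      ∑ y, ‖∑ x, conj (m (x, y)) * n (x, y')‖ ^ 2 := by
    by_contra! hcon
    have hle : ∀ y', ∑ y, ‖∑ x, conj (m (x, y)) * n (x, y')‖ ^ 2 ≤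
        pairOverlap m n * ‖col y'‖ ^ 2 := by
      intro y'
      by_cases h0 : col y' = 0
      · have : ∀ x, n (x, y') = 0 := fun x => congrArg (fun f : EuclideanSpace ℂ X => f x) h0
        simp [this, h0]
      · exact (hcon y' h0).le
    obtain ⟨y', hy'⟩ : ∃ y', col y' ≠ 0 := by
      by_contra! h0
      simp [h0] at hcol
    have hlt := Finset.sum_lt_sum (fun y' (_ : y' ∈ Finset.univ) => hle y')
      ⟨y', Finset.mem_univ _, hcon y' hy'⟩
    rw [← Finset.mul_sum, hcol, mul_one, Finset.sum_comm] at hlt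
    exact lt_irrefl _ hlt
  have hpos : 0 < ‖col y'‖ := norm_pos_iff.2 hy'0
  let u : EuclideanSpace ℂ X := ((‖col y'‖ : ℂ)⁻¹) • col y'
  -- Contracting `m` with `u` leaves `w`; the best `v` is `w` normalised, and the overlap `‖w‖` is
  -- then real and nonnegative.
  let w : EuclideanSpace ℂ Y := WithLp.toLp 2 fun y => ∑ x, conj (u x) * m (x, y)
  obtain ⟨v, hv, hvw⟩ := exists_smul_norm_eq_one w
  refine ⟨u, v, ‖w‖, norm_smul_inv_norm hy'0, hv, norm_nonneg _, ?_, ?_⟩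
  · have hw : ‖w‖ ^ 2 = (‖col y'‖ ^ 2)⁻¹ * ∑ y, ‖∑ x, conj (m (x, y)) * n (x, y')‖ ^ 2 := by
      rw [EuclideanSpace.norm_sq_eq, Finset.mul_sum]
      refine Finset.sum_congr rfl fun y _ => ?_
      have : w y = (‖col y'‖ : ℂ)⁻¹ * conj (∑ x, conj (m (x, y)) * n (x, y')) := by
        simp only [w, u, col, PiLp.smul_apply, smul_eq_mul, map_sum, map_mul, map_inv₀,
          Complex.conj_ofReal, Complex.conj_conj, Finset.mul_sum]
        exact Finset.sum_congr rfl fun x _ => by ring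
      rw [this, norm_mul, mul_pow, Complex.norm_conj, norm_inv, Complex.norm_real, norm_norm,
        inv_pow]
    rw [hw, inv_mul_eq_div, le_div_iff₀ (by positivity)]
    exact hy'
  · rw [← hvw, inner_eq_sum, Fintype.sum_prod_type_right]
    refine Finset.sum_congr rfl fun y _ => ?_
    simp only [w, Finset.mul_sum, map_mul]
    exact Finset.sum_congr rfl fun x _ => by ring

end Overlap

/-! ### Products of states -/

section Product

variable {I M : Type} [Fintype I] [DecidableEq I] [Fintype M] [DecidableEq M]

theorem inner_prodState (φ χ : I → QState M) :
    inner ℂ (prodState φ) (prodState χ) = ∏ i, inner ℂ (φ i) (χ i) := by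
  simp only [inner_eq_sum]
  rw [Finset.prod_univ_sum, Fintype.piFinset_univ, ← Equiv.sum_comp (Equiv.curry I M Bool)]
  refine Finset.sum_congr rfl fun w _ => ?_
  simp only [prodState, map_prod, ← Finset.prod_mul_distrib]
  rfl

theorem norm_prodState (φ : I → QState M) : ‖prodState φ‖ = ∏ i, ‖φ i‖ := by
  have h := inner_prodState φ φ
  simp only [inner_self_eq_norm_sq_to_K, Finset.prod_pow] at h
  have h' : ‖prodState φ‖ ^ 2 = (∏ i, ‖φ i‖) ^ 2 := by exact_mod_cast h
  exact (sq_eq_sq₀ (norm_nonneg _) (Finset.prod_nonneg fun _ _ => norm_nonneg _)).1 h'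

/-- A sum of products over all strings, when the factors depend on single letters and on pairs
of letters. -/
theorem sum_prod_groups {P G A : Type} [Fintype P] [DecidableEq P] [Fintype G] [DecidableEq G]
    [Fintype A] (e : P ⊕ G × Fin 2 ≃ I) (f : P → A → ℂ) (g : G → A → A → ℂ) :
    ∑ x : I → A, (∏ p, f p (x (e (.inl p)))) *
      ∏ a, g a (x (e (.inr (a, 0)))) (x (e (.inr (a, 1)))) =
      (∏ p, ∑ α, f p α) * ∏ a, ∑ α, ∑ β, g a α β := by
  let E : (I → A) ≃ (P → A) × (G → A × A) :=
    (Equiv.arrowCongr e.symm (Equiv.refl A)).trans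
      ((Equiv.sumArrowEquivProdArrow _ _ _).trans (Equiv.prodCongr (Equiv.refl _)
        ((Equiv.curry G (Fin 2) A).trans (Equiv.arrowCongr (Equiv.refl G)
          (finTwoArrowEquiv A)))))
  have h := Equiv.sum_comp E fun y : (P → A) × (G → A × A) =>
    (∏ p, f p (y.1 p)) * ∏ a, g a (y.2 a).1 (y.2 a).2
  refine Eq.trans ?_ (h.trans ?_)
  · rfl
  · rw [Fintype.sum_prod_type]
    simp only [← Finset.mul_sum, ← Finset.sum_mul]
    rw [Finset.prod_univ_sum, Fintype.piFinset_univ]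
    congr 1
    simp only [← Fintype.sum_prod_type']
    rw [Finset.prod_univ_sum, Fintype.piFinset_univ]

theorem prod_groups {P G : Type} [Fintype P] [Fintype G] {R : Type} [CommMonoid R]
    (e : P ⊕ G × Fin 2 ≃ I) (h : I → R) :
    ∏ i, h i = (∏ p, h (e (.inl p))) * ∏ a, h (e (.inr (a, 0))) * h (e (.inr (a, 1))) := by
  rw [← Equiv.prod_comp e, Fintype.prod_sum_type, Fintype.prod_prod_type]
  simp only [Fin.prod_univ_two]

/-- The product of a state of the qubits in `S` and a state of the other qubits. -/
def joinState (S : M → Prop) [DecidablePred S] (u : QState {m // S m})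
    (v : QState {m // ¬ S m}) : QState M :=
  WithLp.toLp 2 fun b => u (fun m => b m) * v (fun m => b m)

/-- The two parts of a string. -/
abbrev splitBits (S : M → Prop) [DecidablePred S] :
    (M → Bool) ≃ ({m // S m} → Bool) × ({m // ¬ S m} → Bool) :=
  Equiv.piEquivPiSubtypeProd S fun _ => Bool

theorem norm_joinState (S : M → Prop) [DecidablePred S] (u : QState {m // S m})
    (v : QState {m // ¬ S m}) : ‖joinState S u v‖ = ‖u‖ * ‖v‖ := by
  refine (sq_eq_sq₀ (norm_nonneg _) (by positivity)).1 ?_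
  rw [mul_pow, EuclideanSpace.norm_sq_eq, EuclideanSpace.norm_sq_eq, EuclideanSpace.norm_sq_eq,
    Finset.sum_mul_sum, ← Fintype.sum_prod_type', ← Equiv.sum_comp (splitBits S)]
  refine Finset.sum_congr rfl fun b _ => ?_
  rw [← mul_pow, ← norm_mul]
  rfl

/-- The overlap of two states when the qubits in `S` are exchanged. -/
def partOverlap (S : M → Prop) [DecidablePred S] (φ χ : QState M) : ℝ :=
  pairOverlap (fun p => φ ((splitBits S).symm p)) (fun p => χ ((splitBits S).symm p))

/-- The string `β` on `S` and the string `α` elsewhere. -/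
def mixBits (S : M → Prop) [DecidablePred S] (β α : M → Bool) : M → Bool :=
  fun m => if S m then β m else α m

theorem sum_mixBits (S : M → Prop) [DecidablePred S] (φ χ : QState M) :
    ∑ α, ∑ β, (conj (φ α) * conj (χ β)) * (φ (mixBits S β α) * χ (mixBits S α β)) =
      (partOverlap S φ χ : ℂ) := by
  rw [partOverlap, ← sum_exchange, ← Equiv.sum_comp (splitBits S)]
  refine Finset.sum_congr rfl fun α _ => ?_
  rw [← Equiv.sum_comp (splitBits S)]
  refine Finset.sum_congr rfl fun β _ => ?_
  simp only [Equiv.symm_apply_apply]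
  rfl

theorem exists_joinState_overlap (S : M → Prop) [DecidablePred S] (φ χ : QState M)
    (hχ : ‖χ‖ = 1) :
    ∃ (u : QState {m // S m}) (v : QState {m // ¬ S m}) (c : ℝ), ‖u‖ = 1 ∧ ‖v‖ = 1 ∧ 0 ≤ c ∧
      partOverlap S φ χ ≤ c ^ 2 ∧ inner ℂ (joinState S u v) φ = c := by
  obtain ⟨u, v, c, hu, hv, hc, hle, h⟩ := exists_product_overlap
    (fun p => φ ((splitBits S).symm p)) (fun p => χ ((splitBits S).symm p)) (by
      rw [Equiv.sum_comp (splitBits S).symm fun b => ‖χ b‖ ^ 2, ← EuclideanSpace.norm_sq_eq, hχ,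
        one_pow])
  refine ⟨u, v, c, hu, hv, hc, hle, ?_⟩
  rw [← h, inner_eq_sum, ← Equiv.sum_comp (splitBits S)]
  refine Finset.sum_congr rfl fun b _ => ?_
  simp only [Equiv.symm_apply_apply]
  rfl

end Product

/-! ### The swap test on product states -/

section SwapTest

variable {P G I M : Type} [Fintype P] [DecidableEq P] [Fintype G] [DecidableEq G] [Fintype I]
  [DecidableEq I] [Fintype M] [DecidableEq M]

/-- The exchange of the qubits in `S a` of the two states of each group `a`. -/
def groupSwap (e : P ⊕ G × Fin 2 ≃ I) (S : G → M → Prop) [∀ a, DecidablePred (S a)]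
    (w : I × M) : I × M :=
  match e.symm w.1 with
  | .inl _ => w
  | .inr (a, s) => if S a w.2 then (e (.inr (a, s.rev)), w.2) else w

variable (e : P ⊕ G × Fin 2 ≃ I) (S : G → M → Prop) [∀ a, DecidablePred (S a)]

theorem groupSwap_inl (p : P) (m : M) : groupSwap e S (e (.inl p), m) = (e (.inl p), m) := by
  simp [groupSwap]

theorem groupSwap_inr (a : G) (s : Fin 2) (m : M) :
    groupSwap e S (e (.inr (a, s)), m) =
      if S a m then (e (.inr (a, s.rev)), m) else (e (.inr (a, s)), m) := by
  simp [groupSwap]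

theorem groupSwap_involutive : Function.Involutive (groupSwap e S) := by
  rintro ⟨i, m⟩
  obtain ⟨p | ⟨a, s⟩, rfl⟩ := e.surjective i
  · simp only [groupSwap_inl]
  · by_cases h : S a m <;> simp [groupSwap_inr, h]

theorem norm_permState_of_involutive {ι : Type} [Fintype ι] [DecidableEq ι] {π : ι → ι}
    (hπ : Function.Involutive π) (Ψ : QState ι) : ‖permState π Ψ‖ = ‖Ψ‖ := by
  refine (sq_eq_sq₀ (norm_nonneg _) (norm_nonneg _)).1 ?_
  rw [EuclideanSpace.norm_sq_eq, EuclideanSpace.norm_sq_eq,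
    ← Equiv.sum_comp (Equiv.arrowCongr (hπ.toPerm π) (Equiv.refl Bool)) fun b => ‖Ψ b‖ ^ 2]
  rfl

theorem permState_prodState (φ : I → QState M) (w : I × M → Bool) :
    permState (groupSwap e S) (prodState φ) w =
      (∏ p, φ (e (.inl p)) fun m => w (e (.inl p), m)) *
        ∏ a, φ (e (.inr (a, 0)))
            (mixBits (S a) (fun m => w (e (.inr (a, 1)), m)) fun m => w (e (.inr (a, 0)), m)) *
          φ (e (.inr (a, 1)))
            (mixBits (S a) (fun m => w (e (.inr (a, 0)), m)) fun m => w (e (.inr (a, 1)), m)) := by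
  simp only [permState, prodState]
  rw [prod_groups e]
  simp only [Function.comp_apply, groupSwap_inl, groupSwap_inr]
  congr 1
  refine Finset.prod_congr rfl fun a _ => ?_
  refine congrArg₂ (· * ·) (congrArg (φ _).ofLp (funext fun m => ?_))
    (congrArg (φ _).ofLp (funext fun m => ?_)) <;> simp only [mixBits] <;> split <;> rfl

/-- The exchange stays inside the groups, so the sum over strings factorises. Each single proof
contributes its squared norm 1, each group its overlap. -/
theorem inner_permState (φ : I → QState M) (hφ : ∀ i, ‖φ i‖ = 1) :
    inner ℂ (prodState φ) (permState (groupSwap e S) (prodState φ)) =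
      ((∏ a, partOverlap (S a) (φ (e (.inr (a, 0)))) (φ (e (.inr (a, 1)))) : ℝ) : ℂ) := by
  rw [inner_eq_sum]
  have h := sum_prod_groups (A := M → Bool) e
    (fun p α => conj (φ (e (.inl p)) α) * φ (e (.inl p)) α)
    (fun a α β => (conj (φ (e (.inr (a, 0))) α) * conj (φ (e (.inr (a, 1))) β)) *
      (φ (e (.inr (a, 0))) (mixBits (S a) β α) * φ (e (.inr (a, 1))) (mixBits (S a) α β)))
  simp only [sum_mixBits, ← inner_eq_sum, inner_self_eq_norm_sq_to_K, hφ] at h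
  rw [Complex.ofReal_prod]
  refine Eq.trans ?_ (h.trans (by simp))
  rw [← Equiv.sum_comp (Equiv.curry I M Bool)]
  refine Finset.sum_congr rfl fun w _ => ?_
  rw [permState_prodState]
  simp only [prodState, map_prod]
  rw [prod_groups e, mul_mul_mul_comm, ← Finset.prod_mul_distrib, ← Finset.prod_mul_distrib]
  rfl

/-- This is the probability that the swap test fails: ‖Ψ − πΨ‖² / 4 for unit vectors with a real
inner product. -/
theorem norm_swapPart_neg (φ : I → QState M) (hφ : ∀ i, ‖φ i‖ = 1) :
    ‖swapPart (groupSwap e S) (-1) (prodState φ)‖ ^ 2 =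
      (1 - ∏ a, partOverlap (S a) (φ (e (.inr (a, 0)))) (φ (e (.inr (a, 1))))) / 2 := by
  have hΨ : ‖prodState φ‖ = 1 := by rw [norm_prodState]; simp [hφ]
  have hΨ' : ‖permState (groupSwap e S) (prodState φ)‖ = 1 := by
    rw [norm_permState_of_involutive (groupSwap_involutive e S), hΨ]
  rw [swapPart, neg_one_smul, ← sub_eq_add_neg, norm_smul, mul_pow,
    norm_sub_sq (𝕜 := ℂ), inner_permState e S φ hφ, hΨ, hΨ']
  simp only [norm_inv, Complex.norm_ofNat, RCLike.re_to_complex, Complex.ofReal_re]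
  ring

theorem norm_swapPart_add (φ : I → QState M) (hφ : ∀ i, ‖φ i‖ = 1) :
    ‖swapPart (groupSwap e S) 1 (prodState φ)‖ ^ 2 +
      ‖swapPart (groupSwap e S) (-1) (prodState φ)‖ ^ 2 = 1 := by
  have hΨ : ‖prodState φ‖ = 1 := by rw [norm_prodState]; simp [hφ]
  have hΨ' : ‖permState (groupSwap e S) (prodState φ)‖ = 1 := by
    rw [norm_permState_of_involutive (groupSwap_involutive e S), hΨ]
  have h := parallelogram_law_with_norm ℂ (prodState φ)
    (permState (groupSwap e S) (prodState φ))
  rw [hΨ, hΨ'] at h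
  rw [swapPart, swapPart, neg_one_smul, one_smul, ← sub_eq_add_neg, norm_smul, norm_smul,
    mul_pow, mul_pow]
  simp only [norm_inv, Complex.norm_ofNat]
  linarith

theorem swapPart_add {ι : Type} [Fintype ι] (π : ι → ι) (Ψ : QState ι) :
    swapPart π 1 Ψ + swapPart π (-1) Ψ = Ψ := by
  rw [swapPart, swapPart, ← smul_add, neg_one_smul, one_smul, add_add_add_comm, add_neg_cancel,
    add_zero, ← two_smul ℂ, smul_smul]
  norm_num

/-- Product states that pass the swap test are close to states in which also the exchanged qubits
and the other qubits are in a product state. -/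
theorem exists_joinState_close (φ : I → QState M) (hφ : ∀ i, ‖φ i‖ = 1) :
    ∃ (u : ∀ a, Fin 2 → QState {m // S a m}) (v : ∀ a, Fin 2 → QState {m // ¬ S a m})
      (χ : I → QState M), (∀ i, ‖χ i‖ = 1) ∧
      (∀ a s, χ (e (.inr (a, s))) = joinState (S a) (u a s) (v a s)) ∧
      ‖prodState χ - swapPart (groupSwap e S) 1 (prodState φ)‖ ≤
        3 * ‖swapPart (groupSwap e S) (-1) (prodState φ)‖ := by
  -- Each proof is compared with its partner `s.rev` in the group.
  choose u v c hu hv hc hle hin using fun (a : G) (s : Fin 2) =>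
    exists_joinState_overlap (S a) (φ (e (.inr (a, s)))) (φ (e (.inr (a, s.rev)))) (hφ _)
  let χ : I → QState M := fun i => Sum.elim (fun p => φ (e (.inl p)))
    (fun q => joinState (S q.1) (u q.1 q.2) (v q.1 q.2)) (e.symm i)
  have hχl : ∀ p, χ (e (.inl p)) = φ (e (.inl p)) := fun p => by simp [χ]
  have hχr : ∀ a s, χ (e (.inr (a, s))) = joinState (S a) (u a s) (v a s) :=
    fun a s => by simp [χ]
  have hχ : ∀ i, ‖χ i‖ = 1 := by
    intro i
    obtain ⟨p | ⟨a, s⟩, rfl⟩ := e.surjective i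
    · rw [hχl, hφ]
    · rw [hχr, norm_joinState, hu, hv, one_mul]
  refine ⟨u, v, χ, hχ, hχr, ?_⟩
  have hin' : inner ℂ (prodState χ) (prodState φ) = ((∏ a, c a 0 * c a 1 : ℝ) : ℂ) := by
    rw [inner_prodState, prod_groups e]
    simp only [hχl, hχr, hin, inner_self_eq_norm_sq_to_K, hφ]
    push_cast
    simp
  -- The overlap is symmetric, so it is at most both `c a 0 ^ 2` and `c a 1 ^ 2`, hence at most
  -- their geometric mean.
  have hprod : ∏ a, partOverlap (S a) (φ (e (.inr (a, 0)))) (φ (e (.inr (a, 1)))) ≤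
      ∏ a, c a 0 * c a 1 := by
    refine Finset.prod_le_prod (fun a _ => pairOverlap_nonneg _ _) fun a _ => ?_
    have h0 := hle a 0
    have h1 := hle a 1
    have hcomm := pairOverlap_comm (fun p => φ (e (.inr (a, 0))) ((splitBits (S a)).symm p))
      (fun p => φ (e (.inr (a, 1))) ((splitBits (S a)).symm p))
    have h1' : partOverlap (S a) (φ (e (.inr (a, 0)))) (φ (e (.inr (a, 1)))) ≤ c a 1 ^ 2 :=
      hcomm.trans_le h1
    refine le_of_sq_le_sq ?_ (mul_nonneg (hc a 0) (hc a 1))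
    rw [mul_pow, sq]
    exact mul_le_mul h0 h1' (pairOverlap_nonneg _ _) (sq_nonneg _)
  -- The squared distance is 2 − 2 ∏ c, at most 2 − 2 ∏ overlap, which is four times the failure
  -- probability.
  have hdist : ‖prodState χ - prodState φ‖ ≤
      2 * ‖swapPart (groupSwap e S) (-1) (prodState φ)‖ := by
    refine (sq_le_sq₀ (norm_nonneg _) (by positivity)).1 ?_
    rw [mul_pow, norm_swapPart_neg e S φ hφ, norm_sub_sq (𝕜 := ℂ), hin', norm_prodState,
      norm_prodState]
    simp only [hχ, hφ, Finset.prod_const_one, RCLike.re_to_complex, Complex.ofReal_re]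
    linarith
  -- The state differs from its symmetric part by the antisymmetric part, which turns the factor 2
  -- into 3.
  have h3 : prodState χ - swapPart (groupSwap e S) 1 (prodState φ) =
      (prodState χ - prodState φ) + swapPart (groupSwap e S) (-1) (prodState φ) := by
    rw [sub_add, sub_right_inj, eq_sub_iff_add_eq]
    exact swapPart_add _ _
  rw [h3]
  refine (norm_add_le _ _).trans ?_
  linarith

end SwapTest

/-! ### Products of states in circuits -/

section Basic

variable {qV k qM : ℕ}

theorem prodState_smul {I J : Type} [Fintype I] [Fintype J] (c : I → ℂ) (φ : I → QState J) :
    prodState (fun i => c i • φ i) = (∏ i, c i) • prodState φ := by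
  ext w
  simp [prodState, Finset.prod_mul_distrib]

theorem embed_smul (c : ℂ) (Ψ : QState (Fin k × Fin qM)) :
    (embed (c • Ψ) : QState (Qubit qV k qM)) = c • embed Ψ := by
  ext b
  simp only [embed, PiLp.smul_apply]
  split <;> simp

theorem norm_initialState (φ : Fin k → QState (Fin qM)) :
    ‖(initialState φ : QState (Qubit qV k qM))‖ = ∏ i, ‖φ i‖ := by
  rw [initialState_eq, norm_embed, norm_prodState]

theorem Circuit.acceptProb_eq (C : Circuit qV k qM) (φ : Fin k → QState (Fin qM)) :
    C.acceptProb φ = (∏ i, ‖φ i‖) ^ 2 - rejW (.inl C.output) C.gates (initialState φ) := by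
  rw [← norm_initialState (qV := qV), ← sum_accept]
  rfl

/-- Up to a scalar, every product of nonzero states is a product of pure states. -/
theorem initialState_eq_smul (θ : Fin k → QState (Fin qM)) (hθ : ∀ i, θ i ≠ 0) :
    (initialState θ : QState (Qubit qV k qM)) =
      (∏ i, (‖θ i‖ : ℂ)) • initialState fun i => ((‖θ i‖ : ℂ)⁻¹) • θ i := by
  rw [initialState_eq, initialState_eq, ← embed_smul, ← prodState_smul]
  congr 2
  funext i
  rw [smul_smul, mul_inv_cancel₀ (by simpa using hθ i), one_smul]

/-- Both sides scale alike, so nonzero factors may be normalised; a zero factor makes the whole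
product vanish. -/
theorem Circuit.le_rejW_of_acceptProb_le (C : Circuit qV k qM) (δ : ℝ)
    (h : ∀ φ : Fin k → QState (Fin qM), (∀ i, ‖φ i‖ = 1) → C.acceptProb φ ≤ 1 - δ)
    (θ : Fin k → QState (Fin qM)) :
    δ * ‖(initialState θ : QState (Qubit qV k qM))‖ ^ 2 ≤
      rejW (.inl C.output) C.gates (initialState θ) := by
  by_cases hθ : ∀ i, θ i ≠ 0
  · have hu : ∀ i, ‖((‖θ i‖ : ℂ)⁻¹) • θ i‖ = 1 := fun i => norm_smul_inv_norm (hθ i)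
    have h' := h _ hu
    rw [acceptProb_eq] at h'
    rw [initialState_eq_smul θ hθ, rejW_smul, norm_smul, mul_pow, norm_initialState]
    simp only [hu, Finset.prod_const_one, one_pow, mul_one] at h' ⊢
    rw [mul_comm]
    exact mul_le_mul_of_nonneg_left (by linarith) (sq_nonneg _)
  · push Not at hθ
    obtain ⟨i, hi⟩ := hθ
    rw [norm_initialState, Finset.prod_eq_zero (Finset.mem_univ i) (by simp [hi])]
    simpa using rejW_nonneg _ _ _

/-- Membership is decided through decidable equality of the sum, as for the general index types in
`fixOff`. -/
instance decidableMemListSum {α β : Type} [DecidableEq α] [DecidableEq β] (q : α ⊕ β)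
    (T : List (α ⊕ β)) : Decidable (q ∈ T) :=
  @List.instDecidableMemOfLawfulBEq _ instBEqOfDecidableEq _ q T

/-- Fixing the qubits outside `T` fixes the qubits of each proof. -/
theorem fixOff_embed (T : List (Qubit qV k qM)) (y : {q // q ∉ T} → Bool) :
    ∃ (c : ℂ) (y₀ : Fin k × Fin qM → Bool), ∀ Φ, fixOff T y (embed Φ) =
      c • embed (proj (fun b => ∀ i j, Sum.inr (i, j) ∉ T → b (i, j) = y₀ (i, j)) Φ) := by
  -- The scalar records whether `y` agrees with an empty work space; on qubits in `T` the value
  -- `false` is arbitrary.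
  refine ⟨if ∀ a, (h : Sum.inl a ∉ T) → y ⟨.inl a, h⟩ = false then 1 else 0,
    fun w => if h : Sum.inr w ∉ T then y ⟨.inr w, h⟩ else false, fun Φ => ?_⟩
  ext b
  simp only [fixOff, proj, embed, PiLp.smul_apply, smul_eq_mul]
  by_cases hb : ∀ a, b (.inl a) = false
  · have : ((fun q : {q // q ∉ T} => b q) = y) ↔
        (∀ a, (h : Sum.inl a ∉ T) → y ⟨.inl a, h⟩ = false) ∧ ∀ i j, Sum.inr (i, j) ∉ T →
          b (.inr (i, j)) = if h : Sum.inr (i, j) ∉ T then y ⟨.inr (i, j), h⟩ else false := by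
      constructor
      · rintro rfl
        refine ⟨fun a _ => hb a, fun i j h => ?_⟩
        rw [dif_pos h]
      · rintro ⟨h₁, h₂⟩
        funext ⟨q, hq⟩
        rcases q with a | ⟨i, j⟩
        · exact (hb a).trans (h₁ a hq).symm
        · exact (h₂ i j hq).trans (dif_pos hq)
    rw [if_pos hb, if_pos hb]
    simp only [this]
    split_ifs <;> simp_all
  · rw [if_neg hb, if_neg hb]
    simp

theorem fixOff_smul {ι : Type} [Fintype ι] [DecidableEq ι] (T : List ι)
    (y : {q // q ∉ T} → Bool) (c : ℂ) (ψ : QState ι) :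
    fixOff T y (c • ψ) = c • fixOff T y ψ := by
  ext b
  simp only [fixOff, proj, PiLp.smul_apply]
  split <;> simp

theorem proj_prodState {I J : Type} [Fintype I] [Fintype J] (D : I → (J → Bool) → Prop)
    [∀ i, DecidablePred (D i)] [DecidablePred fun b : I × J → Bool => ∀ i, D i fun j => b (i, j)]
    (φ : I → QState J) :
    proj (fun b : I × J → Bool => ∀ i, D i fun j => b (i, j)) (prodState φ) =
      prodState fun i => proj (D i) (φ i) := by
  ext b
  simp only [proj, prodState]
  split
  · next h => simp [h]
  · next h =>
    push Not at h
    obtain ⟨i, hi⟩ := h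
    rw [Finset.prod_eq_zero (Finset.mem_univ i) (if_neg hi)]

end Basic

/-! ### The qubits of the merged proofs -/

section Indices

variable {qV k r qM : ℕ}

/-- The `r` single proofs and the `k` groups of `m` proofs. -/
def groupEquiv (r k m : ℕ) : Fin r ⊕ Fin k × Fin m ≃ Fin (m * k + r) :=
  ((Equiv.refl _).sumCongr finProdFinEquiv).trans (finSumFinEquiv.trans (finCongr (by ring)))

theorem groupEquiv_inl {m : ℕ} (p : Fin r) : (groupEquiv r k m (.inl p) : ℕ) = p := by
  simp [groupEquiv]

theorem groupEquiv_inr {m : ℕ} (a : Fin k) (s : Fin m) :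
    (groupEquiv r k m (.inr (a, s)) : ℕ) = r + (s + m * a) := by
  simp [groupEquiv]

/-- The even and the odd qubits of a merged proof. -/
def posEquiv (qM : ℕ) : Fin qM × Fin 2 ≃ Fin (2 * qM) :=
  finProdFinEquiv.trans (finCongr (Nat.mul_comm _ _))

theorem posEquiv_val (j : Fin qM) (s : Fin 2) : (posEquiv qM (j, s) : ℕ) = s + 2 * j := by
  simp [posEquiv]

/-- The place of the witness qubits of the given verifier in the new one. -/
def mergeWit : Fin (3 * k + r) × Fin qM ↪ Fin (2 * k + r) × Fin (2 * qM) where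
  toFun w := (⟨mergeIdx r w.1, mergeIdx_lt w.1.2⟩,
    ⟨2 * w.2 + mergeReg r w.1, by have := mergeReg_lt r w.1; omega⟩)
  inj' w w' h := Sum.inr_injective
    ((mergeQubit (qV := 0) (k := k) (r := r) (qM := qM)).injective (congrArg Sum.inr h))

theorem mergeQubit_inr (w : Fin (3 * k + r) × Fin qM) :
    (mergeQubit (.inr w) : Qubit (qV + 4) (2 * k + r) (2 * qM)) = .inr (mergeWit w) := rfl

theorem mergeWit_single (p : Fin r) (j : Fin qM) :
    mergeWit (groupEquiv r k 3 (.inl p), j) = (groupEquiv r k 2 (.inl p), posEquiv qM (j, 0)) := by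
  refine Prod.ext (Fin.ext ?_) (Fin.ext ?_)
  · simp only [mergeWit, Function.Embedding.coeFn_mk, groupEquiv_inl, mergeIdx]
    split <;> omega
  · simp only [mergeWit, Function.Embedding.coeFn_mk, groupEquiv_inl, mergeReg, posEquiv_val]
    split <;> simp <;> omega

/-- The even qubits of the second merged proof are left out: they hold the copy that serves only for
the comparison. -/
theorem mergeWit_group (a : Fin k) (s : Fin 3) (j : Fin qM) :
    mergeWit (groupEquiv r k 3 (.inr (a, s)), j) =
      (groupEquiv r k 2 (.inr (a, if s = 2 then 1 else 0)),
        posEquiv qM (j, if s = 0 then 0 else 1)) := by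
  refine Prod.ext (Fin.ext ?_) (Fin.ext ?_)
  · simp only [mergeWit, Function.Embedding.coeFn_mk, groupEquiv_inr, mergeIdx]
    fin_cases s <;> simp <;> omega
  · simp only [mergeWit, Function.Embedding.coeFn_mk, groupEquiv_inr, mergeReg, posEquiv_val]
    fin_cases s <;> simp <;> omega

theorem extend_single (b : Fin (3 * k + r) × Fin qM → Bool)
    (z : Fin (2 * k + r) × Fin (2 * qM) → Bool) (p : Fin r) (j : Fin qM) :
    Function.extend mergeWit b z (groupEquiv r k 2 (.inl p), posEquiv qM (j, 0)) =
      b (groupEquiv r k 3 (.inl p), j) := by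
  rw [← mergeWit_single, mergeWit.injective.extend_apply]

theorem extend_group (b : Fin (3 * k + r) × Fin qM → Bool)
    (z : Fin (2 * k + r) × Fin (2 * qM) → Bool) (a : Fin k) (s : Fin 3) (j : Fin qM) :
    Function.extend mergeWit b z (groupEquiv r k 2 (.inr (a, if s = 2 then 1 else 0)),
        posEquiv qM (j, if s = 0 then 0 else 1)) =
      b (groupEquiv r k 3 (.inr (a, s)), j) := by
  rw [← mergeWit_group, mergeWit.injective.extend_apply]

theorem extend_single_odd (b : Fin (3 * k + r) × Fin qM → Bool)
    (z : Fin (2 * k + r) × Fin (2 * qM) → Bool) (p : Fin r) (j : Fin qM) :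
    Function.extend mergeWit b z (groupEquiv r k 2 (.inl p), posEquiv qM (j, 1)) =
      z (groupEquiv r k 2 (.inl p), posEquiv qM (j, 1)) := by
  refine Function.extend_apply' _ _ _ ?_
  rintro ⟨⟨i, j'⟩, h⟩
  obtain ⟨p' | ⟨a, s⟩, rfl⟩ := (groupEquiv r k 3).surjective i
  · rw [mergeWit_single] at h
    simp at h
  · rw [mergeWit_group] at h
    simp at h

theorem extend_snd_even (b : Fin (3 * k + r) × Fin qM → Bool)
    (z : Fin (2 * k + r) × Fin (2 * qM) → Bool) (a : Fin k) (j : Fin qM) :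
    Function.extend mergeWit b z (groupEquiv r k 2 (.inr (a, 1)), posEquiv qM (j, 0)) =
      z (groupEquiv r k 2 (.inr (a, 1)), posEquiv qM (j, 0)) := by
  refine Function.extend_apply' _ _ _ ?_
  rintro ⟨⟨i, j'⟩, h⟩
  obtain ⟨p' | ⟨a, s⟩, rfl⟩ := (groupEquiv r k 3).surjective i
  · rw [mergeWit_single] at h
    simp at h
  · rw [mergeWit_group] at h
    fin_cases s <;> simp at h

theorem prod_groups_three {R : Type} [CommMonoid R] (h : Fin (3 * k + r) → R) :
    ∏ i, h i = (∏ p, h (groupEquiv r k 3 (.inl p))) * ∏ a, h (groupEquiv r k 3 (.inr (a, 0))) *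
      h (groupEquiv r k 3 (.inr (a, 1))) * h (groupEquiv r k 3 (.inr (a, 2))) := by
  rw [← Equiv.prod_comp (groupEquiv r k 3), Fintype.prod_sum_type, Fintype.prod_prod_type]
  simp only [Fin.prod_univ_three]

/-- The qubits exchanged by the swap test in the merged proofs of the group `a`. -/
def Circuit.swapSet (C : Circuit qV (3 * k + r) qM) (a : Fin k) (m : Fin (2 * qM)) : Prop :=
  ((posEquiv qM).symm m).2 = 0 ∧ (a, ((posEquiv qM).symm m).1) ∈ C.swapPairs

instance (C : Circuit qV (3 * k + r) qM) (a : Fin k) : DecidablePred (C.swapSet a) :=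
  fun _ => inferInstanceAs (Decidable (_ ∧ _))

theorem Circuit.swapSet_posEquiv (C : Circuit qV (3 * k + r) qM) (a : Fin k) (j : Fin qM)
    (s : Fin 2) : C.swapSet a (posEquiv qM (j, s)) ↔ s = 0 ∧ (a, j) ∈ C.swapPairs := by
  simp [swapSet]

/-- The reason why a swap test read off from the description suffices: whatever it leaves out of the
first proof of a group is untouched by the circuit. -/
theorem Circuit.mem_swapPairs_of_touched (C : Circuit qV (3 * k + r) qM) (a : Fin k)
    (j : Fin qM) (h : Sum.inr (groupEquiv r k 3 (.inr (a, 0)), j) ∈ C.touched) :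
    (a, j) ∈ C.swapPairs := by
  have h₁ := lt_proofBound h
  rw [groupEquiv_inr, Fin.val_zero] at h₁
  refine (C.mem_swapPairs a j).2 ⟨?_, lt_posBound h⟩
  unfold groupBound
  omega

theorem swapFst_eq (a : Fin k) (j : Fin qM) :
    (swapFst a j : Qubit (qV + 4) (2 * k + r) (2 * qM)) =
      .inr (groupEquiv r k 2 (.inr (a, 0)), posEquiv qM (j, 0)) := by
  refine congrArg Sum.inr (Prod.ext (Fin.ext ?_) (Fin.ext ?_))
  · rw [groupEquiv_inr]; simp
  · rw [posEquiv_val]; simp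

theorem swapSnd_eq (a : Fin k) (j : Fin qM) :
    (swapSnd a j : Qubit (qV + 4) (2 * k + r) (2 * qM)) =
      .inr (groupEquiv r k 2 (.inr (a, 1)), posEquiv qM (j, 0)) := by
  refine congrArg Sum.inr (Prod.ext (Fin.ext ?_) (Fin.ext ?_))
  · rw [groupEquiv_inr]; simp; omega
  · rw [posEquiv_val]; simp

theorem Circuit.swapPerm_inr (C : Circuit qV (3 * k + r) qM)
    (w : Fin (2 * k + r) × Fin (2 * qM)) :
    (swapPerm C.swapPairs : Equiv.Perm (Qubit (qV + 4) (2 * k + r) (2 * qM))) (.inr w) =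
      .inr (groupSwap (groupEquiv r k 2) C.swapSet w) := by
  obtain ⟨i, m⟩ := w
  obtain ⟨⟨j, t⟩, rfl⟩ := (posEquiv qM).surjective m
  have hne : ∀ i', (∀ a s, (a, j) ∈ C.swapPairs → t = 0 → i' ≠ groupEquiv r k 2 (.inr (a, s))) →
      (swapPerm C.swapPairs : Equiv.Perm (Qubit (qV + 4) (2 * k + r) (2 * qM)))
        (.inr (i', posEquiv qM (j, t))) = .inr (i', posEquiv qM (j, t)) := by
    intro i' h
    refine swapPerm_of_ne _ _ fun p hp => ⟨fun h' => ?_, fun h' => ?_⟩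
    · rw [swapFst_eq] at h'
      simp only [Sum.inr.injEq, Prod.mk.injEq, EmbeddingLike.apply_eq_iff_eq] at h'
      obtain ⟨h₁, rfl, h₂⟩ := h'
      exact h _ _ hp h₂ h₁
    · rw [swapSnd_eq] at h'
      simp only [Sum.inr.injEq, Prod.mk.injEq, EmbeddingLike.apply_eq_iff_eq] at h'
      obtain ⟨h₁, rfl, h₂⟩ := h'
      exact h _ _ hp h₂ h₁
  obtain ⟨p | ⟨a, s⟩, rfl⟩ := (groupEquiv r k 2).surjective i
  · rw [groupSwap_inl]
    exact hne _ fun a s _ _ => by simp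
  · rw [groupSwap_inr]
    simp only [swapSet_posEquiv]
    split
    · next h =>
      obtain ⟨rfl, h⟩ := h
      have h₁ := swapPerm_swapFst (qV := qV) (r := r) C.nodup_swapPairs a j h
      have h₂ := swapPerm_swapSnd (qV := qV) (r := r) C.nodup_swapPairs a j h
      rw [swapFst_eq, swapSnd_eq] at h₁ h₂
      fin_cases s
      · exact h₁
      · exact h₂
    · next h =>
      refine hne _ fun a' s' h' ht => ?_
      simp only [ne_eq, EmbeddingLike.apply_eq_iff_eq, Sum.inr.injEq, Prod.mk.injEq, not_and]
      rintro rfl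
      exact absurd ⟨ht, h'⟩ h

/-- The slices of a state of the merged proofs. -/
theorem slice_embed (z : Qubit (qV + 4) (2 * k + r) (2 * qM) → Bool)
    (Ψ : QState (Fin (2 * k + r) × Fin (2 * qM))) :
    slice mergeQubit z (embed Ψ) =
      ((if ∀ m, z (ancilla m) = false then 1 else 0 : ℂ) •
        embed (slice mergeWit (fun w => z (.inr w)) Ψ) : QState (Qubit qV (3 * k + r) qM)) := by
  ext b
  have hin : (fun w => Function.extend mergeQubit b z (.inr w)) =
      Function.extend mergeWit (fun w => b (.inr w)) fun w => z (.inr w) := by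
    funext w
    by_cases hw : ∃ w', mergeWit w' = w
    · obtain ⟨w', rfl⟩ := hw
      rw [mergeWit.injective.extend_apply, ← mergeQubit_inr, mergeQubit.injective.extend_apply]
    · rw [Function.extend_apply' _ _ _ hw, Function.extend_apply']
      rintro ⟨a | w', h⟩
      · exact Sum.inl_ne_inr h
      · exact hw ⟨w', Sum.inr_injective h⟩
  have hl : (∀ a, Function.extend mergeQubit b z (.inl a) = false) ↔
      (∀ m : Fin 4, z (ancilla m) = false) ∧ ∀ a, b (.inl a) = false := by
    have hanc : ∀ m : Fin 4, Function.extend mergeQubit b z (ancilla m) = z (ancilla m) :=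
      fun m => Function.extend_apply' _ _ _ fun ⟨q, hq⟩ => mergeQubit_ne_ancilla q m hq
    constructor
    · refine fun h => ⟨fun m => (hanc m).symm.trans (h _), fun a => ?_⟩
      rw [← mergeQubit.injective.extend_apply b z (.inl a)]
      exact h _
    · rintro ⟨h₁, h₂⟩ a
      by_cases ha : (a : ℕ) < 4
      · exact (hanc ⟨a, ha⟩).trans (h₁ _)
      · have : (Sum.inl a : Qubit (qV + 4) (2 * k + r) (2 * qM)) =
            mergeQubit (.inl ⟨a - 4, by omega⟩) :=
          congrArg Sum.inl (Fin.ext (by change (a : ℕ) = a - 4 + 4; omega))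
        rw [this, mergeQubit.injective.extend_apply]
        exact h₂ _
  simp only [slice, embed, PiLp.smul_apply, smul_eq_mul, hin, hl]
  split_ifs <;> simp_all

end Indices

variable {qV k r qM : ℕ}

/-! ### Soundness -/

/-- The part of a slice of a product of merged proofs that has fixed bits on the untouched qubits
is a product, provided that the exchanged qubits of the first proof of each group are in a product
state with the other qubits of this proof. -/
theorem Circuit.exists_proj_slice_eq (C : Circuit qV (3 * k + r) qM)
    (χ : Fin (2 * k + r) → QState (Fin (2 * qM)))
    (u : ∀ a, QState {m // C.swapSet a m}) (v : ∀ a, QState {m // ¬ C.swapSet a m})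
    (hχ : ∀ a, χ (groupEquiv r k 2 (.inr (a, 0))) = joinState (C.swapSet a) (u a) (v a))
    (y : Fin (3 * k + r) × Fin qM → Bool) (z : Fin (2 * k + r) × Fin (2 * qM) → Bool) :
    ∃ θ : Fin (3 * k + r) → QState (Fin qM),
      proj (fun b => ∀ i j, Sum.inr (i, j) ∉ C.touched → b (i, j) = y (i, j))
        (slice mergeWit z (prodState χ)) = prodState θ := by
  -- One factor for each old proof: in a group, `u` for the first, `v` for the second, and the whole
  -- second merged proof for the third.
  let F : Fin r ⊕ Fin k × Fin 3 → (Fin (2 * k + r) × Fin (2 * qM) → Bool) → ℂ :=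
    Sum.elim (fun p w => χ (groupEquiv r k 2 (.inl p)) fun m => w (groupEquiv r k 2 (.inl p), m))
      fun q w => if q.2 = 0 then u q.1 fun m => w (groupEquiv r k 2 (.inr (q.1, 0)), m)
        else if q.2 = 1 then v q.1 fun m => w (groupEquiv r k 2 (.inr (q.1, 0)), m)
        else χ (groupEquiv r k 2 (.inr (q.1, 1))) fun m => w (groupEquiv r k 2 (.inr (q.1, 1)), m)
  -- The string shown to the factor `i` when its proof has the bits `β`. The other proofs are filled
  -- with `y`, which is right on untouched qubits; the factor depends on no other qubits of them.
  let X : Fin (3 * k + r) → (Fin qM → Bool) → Fin (2 * k + r) × Fin (2 * qM) → Bool :=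
    fun i β => Function.extend mergeWit (fun w => if w.1 = i then β w.2 else y w) z
  have hF : ∀ b : Fin (3 * k + r) × Fin qM → Bool,
      (∀ i j, Sum.inr (i, j) ∉ C.touched → b (i, j) = y (i, j)) → ∀ i,
        F ((groupEquiv r k 3).symm i) (Function.extend mergeWit b z) =
          F ((groupEquiv r k 3).symm i) (X i fun j => b (i, j)) := by
    intro b hb i
    obtain ⟨p | ⟨a, s⟩, rfl⟩ := (groupEquiv r k 3).surjective i
    · simp only [Equiv.symm_apply_apply, F, Sum.elim_inl]
      refine congrArg (χ _).ofLp (funext fun m => ?_)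
      obtain ⟨⟨j, t⟩, rfl⟩ := (posEquiv qM).surjective m
      fin_cases t
      · exact (extend_single _ _ _ _).trans (by simp [X, extend_single])
      · exact (extend_single_odd _ _ _ _).trans (extend_single_odd _ _ _ _).symm
    · simp only [Equiv.symm_apply_apply, F, Sum.elim_inr]
      have h₀ : ∀ (b : Fin (3 * k + r) × Fin qM → Bool) j, Function.extend mergeWit b z
          (groupEquiv r k 2 (.inr (a, 0)), posEquiv qM (j, 0)) =
            b (groupEquiv r k 3 (.inr (a, 0)), j) := fun b j => extend_group b z a 0 j
      have h₁ : ∀ (b : Fin (3 * k + r) × Fin qM → Bool) j, Function.extend mergeWit b z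
          (groupEquiv r k 2 (.inr (a, 0)), posEquiv qM (j, 1)) =
            b (groupEquiv r k 3 (.inr (a, 1)), j) := fun b j => extend_group b z a 1 j
      have h₂ : ∀ (b : Fin (3 * k + r) × Fin qM → Bool) j, Function.extend mergeWit b z
          (groupEquiv r k 2 (.inr (a, 1)), posEquiv qM (j, 1)) =
            b (groupEquiv r k 3 (.inr (a, 2)), j) := fun b j => extend_group b z a 2 j
      fin_cases s
      · refine congrArg (u a).ofLp (funext fun ⟨m, hm⟩ => ?_)
        obtain ⟨⟨j, t⟩, rfl⟩ := (posEquiv qM).surjective m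
        obtain ⟨rfl, -⟩ := (C.swapSet_posEquiv a j t).1 hm
        exact (h₀ _ _).trans (by simp [X, h₀])
      · refine congrArg (v a).ofLp (funext fun ⟨m, hm⟩ => ?_)
        obtain ⟨⟨j, t⟩, rfl⟩ := (posEquiv qM).surjective m
        fin_cases t
        · refine (h₀ _ _).trans ?_
          -- The factor `v` also sees the even qubits that are not exchanged, which belong to
          -- another old proof; they are untouched, so their bits are fixed.
          have hj : Sum.inr (groupEquiv r k 3 (.inr (a, 0)), j) ∉ C.touched := fun h =>
            hm ((C.swapSet_posEquiv a j 0).2 ⟨rfl, C.mem_swapPairs_of_touched a j h⟩)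
          rw [hb _ _ hj]
          simp [X, h₀]
        · exact (h₁ _ _).trans (by simp [X, h₁])
      · refine congrArg (χ _).ofLp (funext fun m => ?_)
        obtain ⟨⟨j, t⟩, rfl⟩ := (posEquiv qM).surjective m
        fin_cases t
        · exact (extend_snd_even _ _ _ _).trans (extend_snd_even _ _ _ _).symm
        · exact (h₂ _ _).trans (by simp [X, h₂])
  have hprod : ∀ w, prodState χ w = ∏ i, F ((groupEquiv r k 3).symm i) w := by
    intro w
    rw [prod_groups_three]
    simp only [prodState, Equiv.symm_apply_apply, F, Sum.elim_inl, Sum.elim_inr]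
    rw [prod_groups (groupEquiv r k 2)]
    congr 1
    refine Finset.prod_congr rfl fun a _ => ?_
    rw [hχ]
    rfl
  refine ⟨fun i => proj (fun β => ∀ j, Sum.inr (i, j) ∉ C.touched → β j = y (i, j))
    (WithLp.toLp 2 fun β => F ((groupEquiv r k 3).symm i) (X i β)), ?_⟩
  rw [← proj_prodState fun i β => ∀ j, Sum.inr (i, j) ∉ C.touched → β j = y (i, j)]
  ext b
  simp only [proj]
  split
  · next hb =>
    simp only [slice, hprod]
    exact Finset.prod_congr rfl fun i _ => hF b hb i
  · rfl

/-- The symmetric part is compared with the nearby product state of `exists_joinState_close`. Each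
slice of that state, with the untouched bits fixed, is a multiple of a product of old proofs and
hence rejected with weight at least δ; the pieces add up. -/
theorem Circuit.merge_acceptProb_le (C : Circuit qV (3 * k + r) qM) (δ : ℝ) (hδ : 0 ≤ δ)
    (h : ∀ φ : Fin (3 * k + r) → QState (Fin qM), (∀ i, ‖φ i‖ = 1) → C.acceptProb φ ≤ 1 - δ)
    (φ : Fin (2 * k + r) → QState (Fin (2 * qM))) (hφ : ∀ i, ‖φ i‖ = 1) :
    C.merge.acceptProb φ ≤ 1 - δ / 20 := by
  obtain ⟨u, v, χ, hχ, hjoin, hclose⟩ :=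
    exists_joinState_close (groupEquiv r k 2) C.swapSet φ hφ
  rw [C.merge_acceptProb (groupSwap (groupEquiv r k 2) C.swapSet) C.swapPerm_inr]
  have hadd := norm_swapPart_add (groupEquiv r k 2) C.swapSet φ hφ
  set Ψ₁ := swapPart (groupSwap (groupEquiv r k 2) C.swapSet) 1 (prodState φ)
  set Ψ₂ := swapPart (groupSwap (groupEquiv r k 2) C.swapSet) (-1) (prodState φ)
  set gs : List (Gate (Qubit (qV + 4) (2 * k + r) (2 * qM))) :=
    C.gates.map (Gate.map mergeQubit)
  have hrej : δ * ‖(embed (prodState χ) : QState (Qubit (qV + 4) (2 * k + r) (2 * qM)))‖ ^ 2 ≤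
      rejW (mergeQubit (.inl C.output)) gs (embed (prodState χ)) := by
    refine le_rejW_of_slice _ _ _ _ _ fun z => le_rejW_of_fixOff _ _ _ _ fun y => ?_
    obtain ⟨c, y₀, hy⟩ := fixOff_embed (C.gates.flatMap Gate.operands) y
    obtain ⟨θ, hθ⟩ := C.exists_proj_slice_eq χ (fun a => u a 0) (fun a => v a 0)
      (fun a => hjoin a 0) y₀ fun w => z (.inr w)
    have hs : fixOff (C.gates.flatMap Gate.operands) y (slice mergeQubit z
        (embed (prodState χ) : QState (Qubit (qV + 4) (2 * k + r) (2 * qM)))) =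
          ((if ∀ m, z (ancilla m) = false then 1 else 0 : ℂ) * c) • initialState θ := by
      rw [slice_embed, fixOff_smul, hy, initialState_eq, ← hθ, mul_smul]
      rfl
    rw [hs, rejW_smul, norm_smul, mul_pow, mul_left_comm]
    exact mul_le_mul_of_nonneg_left (C.le_rejW_of_acceptProb_le δ h θ) (sq_nonneg _)
  have hdist := sqrt_rejW_le (mergeQubit (.inl C.output)) gs
    (embed (prodState χ) : QState (Qubit (qV + 4) (2 * k + r) (2 * qM))) (embed Ψ₁)
  rw [← embed_sub, norm_embed] at hdist
  rw [norm_embed, norm_prodState] at hrej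
  simp only [hχ, Finset.prod_const_one, one_pow, mul_one] at hrej
  set R := rejW (mergeQubit (.inl C.output)) gs
    (embed Ψ₁ : QState (Qubit (qV + 4) (2 * k + r) (2 * qM)))
  have hR : 0 ≤ R := rejW_nonneg _ _ _
  have hsq : Real.sqrt δ ≤ Real.sqrt R + 3 * ‖Ψ₂‖ :=
    (Real.sqrt_le_sqrt hrej).trans (hdist.trans (by linarith))
  have hδ' : δ ≤ (Real.sqrt R + 3 * ‖Ψ₂‖) ^ 2 := by
    rw [← Real.sq_sqrt hδ]
    exact pow_le_pow_left₀ (Real.sqrt_nonneg _) hsq 2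
  have hR' := Real.sq_sqrt hR
  -- With f = ‖Ψ₂‖ the square gives (√R + 3f)² ≤ 11 (R/2 + f²), so 1/11 and hence 1/20 of δ is lost.
  nlinarith [sq_nonneg (3 * Real.sqrt R - 2 * ‖Ψ₂‖)]

/-! ### Completeness -/

/-- The even qubits of a string. -/
def evenBits (x : Fin (2 * qM) → Bool) : Fin qM → Bool := fun j => x (posEquiv qM (j, 0))

/-- The odd qubits of a string. -/
def oddBits (x : Fin (2 * qM) → Bool) : Fin qM → Bool := fun j => x (posEquiv qM (j, 1))

/-- The product of a state of the even qubits and a state of the odd qubits. -/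
def interState (u v : QState (Fin qM)) : QState (Fin (2 * qM)) :=
  WithLp.toLp 2 fun x => u (evenBits x) * v (oddBits x)

theorem norm_interState (u v : QState (Fin qM)) : ‖interState u v‖ = ‖u‖ * ‖v‖ := by
  let E : (Fin (2 * qM) → Bool) ≃ (Fin qM → Bool) × (Fin qM → Bool) :=
    (Equiv.arrowCongr (posEquiv qM).symm (Equiv.refl Bool)).trans
      ((Equiv.curry (Fin qM) (Fin 2) Bool).trans
        ((Equiv.piComm _).trans (finTwoArrowEquiv _)))
  refine (sq_eq_sq₀ (norm_nonneg _) (by positivity)).1 ?_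
  rw [mul_pow, EuclideanSpace.norm_sq_eq, EuclideanSpace.norm_sq_eq, EuclideanSpace.norm_sq_eq,
    Finset.sum_mul_sum, ← Fintype.sum_prod_type', ← Equiv.sum_comp E]
  refine Finset.sum_congr rfl fun b _ => ?_
  rw [← mul_pow, ← norm_mul]
  rfl

/-- The product of two copies of a state is invariant under the exchange of some qubits, if the
state has fixed bits on the other qubits. -/
theorem mul_mixBits {M : Type} [Fintype M] (S : M → Prop) [DecidablePred S] (θ : QState M)
    (y : M → Bool) (hθ : ∀ β, θ β ≠ 0 → ∀ j, ¬ S j → β j = y j) (α β : M → Bool) :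
    θ (mixBits S β α) * θ (mixBits S α β) = θ α * θ β := by
  -- If both strings have the prescribed bits outside `S`, mixing exchanges them entirely; otherwise
  -- both products vanish.
  by_cases h : (∀ j, ¬ S j → α j = y j) ∧ ∀ j, ¬ S j → β j = y j
  · have h₁ : mixBits S β α = β := by
      funext j
      by_cases hj : S j
      · simp [mixBits, hj]
      · simp [mixBits, hj, h.1 j hj, h.2 j hj]
    have h₂ : mixBits S α β = α := by
      funext j
      by_cases hj : S j
      · simp [mixBits, hj]
      · simp [mixBits, hj, h.1 j hj, h.2 j hj]
    rw [h₁, h₂, mul_comm]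
  · have h₁ : ∀ γ γ' : M → Bool, (∀ j, ¬ S j → mixBits S γ γ' j = y j) ↔
        ∀ j, ¬ S j → γ' j = y j := fun γ γ' => by
      refine forall₂_congr fun j hj => ?_
      simp [mixBits, hj]
    have hz : ∀ γ, (¬ ∀ j, ¬ S j → γ j = y j) → θ γ = 0 := fun γ h => by
      by_contra h'
      exact h (hθ γ h')
    rcases not_and_or.1 h with h | h
    · rw [hz α h, hz _ ((h₁ β α).not.2 h), zero_mul, zero_mul]
    · rw [hz β h, hz _ ((h₁ α β).not.2 h), mul_zero, mul_zero]

/-- The merged proofs. -/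
def mergedProofs (θ : Fin (3 * k + r) → QState (Fin qM)) (i : Fin (2 * k + r)) :
    QState (Fin (2 * qM)) :=
  -- All merged proofs have the same size; the odd qubits of a single proof are padding that the
  -- merged circuit never uses.
  Sum.elim (fun p => interState (θ (groupEquiv r k 3 (.inl p)))
      (EuclideanSpace.single (fun _ => false) 1))
    (fun q => interState (θ (groupEquiv r k 3 (.inr (q.1, 0))))
      (θ (groupEquiv r k 3 (.inr (q.1, q.2.succ))))) ((groupEquiv r k 2).symm i)

theorem mergedProofs_inl (θ : Fin (3 * k + r) → QState (Fin qM)) (p : Fin r) :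
    mergedProofs θ (groupEquiv r k 2 (.inl p)) = interState (θ (groupEquiv r k 3 (.inl p)))
      (EuclideanSpace.single (fun _ => false) 1) := by
  simp [mergedProofs]

theorem mergedProofs_inr (θ : Fin (3 * k + r) → QState (Fin qM)) (a : Fin k) (s : Fin 2) :
    mergedProofs θ (groupEquiv r k 2 (.inr (a, s))) =
      interState (θ (groupEquiv r k 3 (.inr (a, 0))))
        (θ (groupEquiv r k 3 (.inr (a, s.succ)))) := by
  simp [mergedProofs]

theorem norm_mergedProofs (θ : Fin (3 * k + r) → QState (Fin qM)) (hθ : ∀ i, ‖θ i‖ = 1)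
    (i : Fin (2 * k + r)) : ‖mergedProofs θ i‖ = 1 := by
  obtain ⟨p | ⟨a, s⟩, rfl⟩ := (groupEquiv r k 2).surjective i
  · rw [mergedProofs_inl, norm_interState, hθ]
    simp
  · rw [mergedProofs_inr, norm_interState, hθ, hθ, one_mul]

/-- The qubits fixed by `z` are the padding of the single proofs and the second copies of the first
proofs. They form separate factors, so their amplitudes become scalars. -/
theorem slice_mergedProofs (θ : Fin (3 * k + r) → QState (Fin qM))
    (z : Fin (2 * k + r) × Fin (2 * qM) → Bool) :
    ∃ c : ℂ, slice mergeWit z (prodState (mergedProofs θ)) = c • prodState θ := by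
  let c₁ : Fin r → ℂ := fun p => (EuclideanSpace.single (fun _ => false) 1 : QState (Fin qM))
    fun j => z (groupEquiv r k 2 (.inl p), posEquiv qM (j, 1))
  let c₂ : Fin k → ℂ := fun a => θ (groupEquiv r k 3 (.inr (a, 0)))
    fun j => z (groupEquiv r k 2 (.inr (a, 1)), posEquiv qM (j, 0))
  refine ⟨(∏ p, c₁ p) * ∏ a, c₂ a, ?_⟩
  ext b
  have hp₀ : ∀ p, evenBits (fun m => Function.extend mergeWit b z
      (groupEquiv r k 2 (.inl p), m)) = fun j => b (groupEquiv r k 3 (.inl p), j) :=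
    fun p => funext fun j => extend_single b z p j
  have hp₁ : ∀ p, oddBits (fun m => Function.extend mergeWit b z
      (groupEquiv r k 2 (.inl p), m)) =
        fun j => z (groupEquiv r k 2 (.inl p), posEquiv qM (j, 1)) :=
    fun p => funext fun j => extend_single_odd b z p j
  have h₀ : ∀ a, evenBits (fun m => Function.extend mergeWit b z
      (groupEquiv r k 2 (.inr (a, 0)), m)) = fun j => b (groupEquiv r k 3 (.inr (a, 0)), j) :=
    fun a => funext fun j => extend_group b z a 0 j
  have h₁ : ∀ a, oddBits (fun m => Function.extend mergeWit b z
      (groupEquiv r k 2 (.inr (a, 0)), m)) = fun j => b (groupEquiv r k 3 (.inr (a, 1)), j) :=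
    fun a => funext fun j => extend_group b z a 1 j
  have h₂ : ∀ a, evenBits (fun m => Function.extend mergeWit b z
      (groupEquiv r k 2 (.inr (a, 1)), m)) =
        fun j => z (groupEquiv r k 2 (.inr (a, 1)), posEquiv qM (j, 0)) :=
    fun a => funext fun j => extend_snd_even b z a j
  have h₃ : ∀ a, oddBits (fun m => Function.extend mergeWit b z
      (groupEquiv r k 2 (.inr (a, 1)), m)) = fun j => b (groupEquiv r k 3 (.inr (a, 2)), j) :=
    fun a => funext fun j => extend_group b z a 2 j
  simp only [slice, prodState, PiLp.smul_apply, smul_eq_mul]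
  rw [prod_groups (groupEquiv r k 2), prod_groups_three]
  simp only [mergedProofs_inl, mergedProofs_inr, interState, hp₀, hp₁, h₀, h₁, h₂, h₃]
  rw [mul_mul_mul_comm, ← Finset.prod_mul_distrib, ← Finset.prod_mul_distrib]
  congr 1
  · exact Finset.prod_congr rfl fun p _ => mul_comm _ _
  · refine Finset.prod_congr rfl fun a _ => ?_
    change _ * _ * (c₂ a * _) = c₂ a * (_ * _ * _)
    rw [show (0 : Fin 2).succ = (1 : Fin 3) from rfl, show (1 : Fin 2).succ = (2 : Fin 3) from rfl]
    ring

/-- Both merged proofs of a group have the same state on the even qubits. Exchanging only a part of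
these is harmless since the others have fixed bits. -/
theorem permState_mergedProofs (C : Circuit qV (3 * k + r) qM)
    (θ : Fin (3 * k + r) → QState (Fin qM)) (y : Fin (3 * k + r) × Fin qM → Bool)
    (hθ : ∀ i β, θ i β ≠ 0 → ∀ j, Sum.inr (i, j) ∉ C.touched → β j = y (i, j)) :
    permState (groupSwap (groupEquiv r k 2) C.swapSet) (prodState (mergedProofs θ)) =
      prodState (mergedProofs θ) := by
  ext w
  rw [permState_prodState]
  simp only [prodState]
  rw [prod_groups (groupEquiv r k 2)]
  congr 1
  refine Finset.prod_congr rfl fun a _ => ?_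
  have hev : ∀ α β : Fin (2 * qM) → Bool, evenBits (mixBits (C.swapSet a) β α) =
      mixBits (fun j => (a, j) ∈ C.swapPairs) (evenBits β) (evenBits α) := by
    intro α β
    funext j
    simp [evenBits, mixBits, C.swapSet_posEquiv]
  have hod : ∀ α β : Fin (2 * qM) → Bool, oddBits (mixBits (C.swapSet a) β α) = oddBits α := by
    intro α β
    funext j
    simp [oddBits, mixBits, C.swapSet_posEquiv]
  simp only [mergedProofs_inr, interState, hev, hod]
  rw [mul_mul_mul_comm, mul_mixBits _ _ fun j => y (groupEquiv r k 3 (.inr (a, 0)), j)]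
  · ring
  · exact fun β hβ j hj => hθ _ β hβ j fun h => hj (C.mem_swapPairs_of_touched a j h)

/-- Good proofs can be replaced by good proofs with fixed bits on the untouched qubits. -/
theorem Circuit.exists_fixed_proofs (C : Circuit qV k qM) (ε : ℝ)
    (φ : Fin k → QState (Fin qM)) (hφ : ∀ i, ‖φ i‖ = 1) (h : 1 - ε ≤ C.acceptProb φ) :
    ∃ (θ : Fin k → QState (Fin qM)) (y : Fin k × Fin qM → Bool), (∀ i, ‖θ i‖ = 1) ∧
      (∀ i β, θ i β ≠ 0 → ∀ j, Sum.inr (i, j) ∉ C.touched → β j = y (i, j)) ∧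
      rejW (.inl C.output) C.gates (initialState θ) ≤ ε := by
  have hnorm : ‖(initialState φ : QState (Qubit qV k qM))‖ = 1 := by
    rw [norm_initialState]; simp [hφ]
  rw [acceptProb_eq] at h
  simp only [hφ, Finset.prod_const_one, one_pow] at h
  obtain ⟨y', hy', hrej⟩ := exists_fixOff_rejW_le (.inl C.output) C.gates (initialState φ)
    (by intro h0; rw [h0, norm_zero] at hnorm; exact zero_ne_one hnorm) ε
    (by rw [hnorm]; linarith)
  obtain ⟨c, y, hy⟩ := fixOff_embed (C.gates.flatMap Gate.operands) y'
  -- Fixing bits projects each factor of a product state separately, so the result is again a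
  -- product of proofs.
  let χ : Fin k → QState (Fin qM) := fun i =>
    proj (fun β => ∀ j, Sum.inr (i, j) ∉ C.gates.flatMap Gate.operands → β j = y (i, j)) (φ i)
  have heq : fixOff _ y' (initialState φ) = c • initialState χ := by
    rw [initialState_eq, hy, initialState_eq]
    congr 2
    exact proj_prodState
      (fun i β => ∀ j, Sum.inr (i, j) ∉ C.gates.flatMap Gate.operands → β j = y (i, j)) φ
  rw [heq] at hy' hrej
  have hχ : ∀ i, χ i ≠ 0 := by
    intro i hi
    refine hy' ?_
    rw [← norm_eq_zero, norm_smul, norm_initialState, Finset.prod_eq_zero (Finset.mem_univ i)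
      (by simp [hi]), mul_zero]
  have hu : ∀ i, ‖((‖χ i‖ : ℂ)⁻¹) • χ i‖ = 1 := fun i => norm_smul_inv_norm (hχ i)
  refine ⟨fun i => ((‖χ i‖ : ℂ)⁻¹) • χ i, y, hu, ?_, ?_⟩
  · intro i β hβ
    by_contra hcon
    refine hβ ?_
    have : χ i β = 0 := if_neg hcon
    simp [this]
  · rw [initialState_eq_smul χ hχ, smul_smul] at hy' hrej
    rw [rejW_smul, norm_smul, mul_pow, norm_initialState] at hrej
    simp only [hu, Finset.prod_const_one, one_pow, mul_one] at hrej
    rw [mul_comm ε] at hrej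
    refine le_of_mul_le_mul_left hrej ?_
    have : c * ∏ i, (‖χ i‖ : ℂ) ≠ 0 := fun h0 => hy' (by rw [h0, zero_smul])
    positivity

/-- The merged state is invariant under the exchange and passes the swap test with certainty. Only
half of the rejection weight is lost, and that weight is at most ε because every slice is a multiple
of the old initial state. -/
theorem Circuit.exists_le_merge_acceptProb (C : Circuit qV (3 * k + r) qM) (ε : ℝ)
    (φ : Fin (3 * k + r) → QState (Fin qM)) (hφ : ∀ i, ‖φ i‖ = 1)
    (h : 1 - ε ≤ C.acceptProb φ) :
    ∃ χ : Fin (2 * k + r) → QState (Fin (2 * qM)), (∀ i, ‖χ i‖ = 1) ∧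
      1 - ε / 2 ≤ C.merge.acceptProb χ := by
  obtain ⟨θ, y, hθ, hy, hrej⟩ := C.exists_fixed_proofs ε φ hφ h
  refine ⟨mergedProofs θ, norm_mergedProofs θ hθ, ?_⟩
  have hpart : swapPart (groupSwap (groupEquiv r k 2) C.swapSet) 1 (prodState (mergedProofs θ)) =
      prodState (mergedProofs θ) := by
    rw [swapPart, permState_mergedProofs C θ y hy, one_smul, ← two_smul ℂ, smul_smul]
    norm_num
  have hnorm : ‖prodState (mergedProofs θ)‖ = 1 := by
    rw [norm_prodState]; simp [norm_mergedProofs θ hθ]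
  rw [C.merge_acceptProb (groupSwap (groupEquiv r k 2) C.swapSet) C.swapPerm_inr, hpart, hnorm]
  have hle := rejW_le_of_slice mergeQubit (.inl C.output) C.gates
    (embed (prodState (mergedProofs θ)) : QState (Qubit (qV + 4) (2 * k + r) (2 * qM))) ε
    fun z => by
      obtain ⟨c, hc⟩ := slice_mergedProofs θ fun w => z (.inr w)
      rw [slice_embed, hc, embed_smul, smul_smul, ← initialState_eq, rejW_smul, norm_smul,
        mul_pow, norm_initialState, mul_left_comm]
      simp only [hθ, Finset.prod_const_one, one_pow, mul_one]
      exact mul_le_mul_of_nonneg_left hrej (sq_nonneg _)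
  rw [norm_embed, hnorm] at hle
  linarith

/-! ### The class -/

/-- The verifier that performs the swap test on merged proofs. -/
def Verifier.merge {k : ℕ → ℕ} {r : ℕ} (V : Verifier fun n => 3 * k n + r) :
    Verifier fun n => 2 * k n + r where
  qV n := V.qV n + 4
  qM n := 2 * V.qM n
  qV_pos _ := Nat.succ_pos _
  qM_pos n := Nat.mul_pos two_pos (V.qM_pos n)
  qV_polyBounded := by
    obtain ⟨p, hp⟩ := V.qV_polyBounded
    exact ⟨p + 4, fun n => by simpa using hp n⟩
  qM_polyBounded := by
    obtain ⟨p, hp⟩ := V.qM_polyBounded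
    exact ⟨2 * p, fun n => by simpa using hp n⟩
  circuit x := (V.circuit x).merge
  polyTime := PolyTimeComputable.merge (k := fun x => k x.length) V.polyTime

end QuantumMA

end

theorem mainTheorem2 (k : ℕ → ℕ) (hk_pos : ∀ n, 1 ≤ k n) (hk : QuantumMA.PolyBounded k)
    (r : ℕ) (hr : r ∈ ({0, 1, 2} : Set ℕ))
    (ε δ : ℕ → ℝ) (hε : ∀ n, ε n ∈ Set.Icc (0 : ℝ) 1) (hδ : ∀ n, δ n ∈ Set.Icc (0 : ℝ) 1)
    (hεδ : ∀ n, 10 * ε n < δ n) :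
    QuantumMA.QMA (fun n => 3 * k n + r) (fun n => 1 - ε n) (fun n => 1 - δ n) ⊆
      QuantumMA.QMA (fun n => 2 * k n + r) (fun n => 1 - ε n / 2) (fun n => 1 - δ n / 20) := by
  rintro A ⟨V, hyes, hno⟩
  refine ⟨V.merge, fun x hx => ?_, fun x hx φ hφ => ?_⟩
  · obtain ⟨φ, hφ, hacc⟩ := hyes x hx
    exact (V.circuit x).exists_le_merge_acceptProb (ε x.length) φ hφ hacc
  · exact (V.circuit x).merge_acceptProb_le (δ x.length) (hδ x.length).1
      (fun φ hφ => hno x hx φ hφ) φ hφ
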